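/- **Setting.** Let $\mathbb K\in\{\mathbb R,\mathbb C\}$, let $B,\bar B$ be Banach spaces over $\mathbb K$, and let $G:B\to\bar B$ be analytic at $0$ with $G[0]=0$. For $z_1,z_2,\dots\in B$ let $T^i[z_1,\dots,z_i]$ be the $i$-th derivative at $\varepsilon=0$ of $\varepsilon\mapsto G[\varepsilon z_1+\dots+\frac1{i!}\varepsilon^i z_i]$, and let $X_n$ be the set of $[z_1,\dots,z_n]$ with $T^1=\dots=T^n=0$. Let $k\ge1$, let $[\bar z_1,\dots,\bar z_k]$ be the leading coefficients of some element of $X_{2k}$, and let $\bar X_n$ ($n\ge k$) be the set of elements of $X_n$ with leading coefficients $\bar z_1,\dots,\bar z_k$. Let $A_0,A_1,\dots\in L[B,\bar B]$ be the Taylor coefficients at $\varepsilon=0$ of $\varepsilon\mapsto G'[\varepsilon\bar z_1+\dots+\frac1{k!}\varepsilon^k\bar z_k]$. Put $N_0=B$, $R_0^c=\bar B$ and, recursively for $0\le i\le k$, let $S_{i+1}\in L[N_i,R_i^c]$ be $$S_{i+1}n=\frac{(2i)!}{i!}\,P_{R_i^c}\sum_{a=1}^{i}A_a v_{i-a}\quad(i\ge1),\qquad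 S_1=A_0=G'[0],$$ where $v_0=n$ and $v_1,\dots,v_{i-1}$ continue $n\in N_i$ to a solution of $\sum_{a+b=m}A_av_b=0$ for $0\le m<i$ (the value does not depend on the continuation; one is constructed explicitly from $S_1^{-1}P_{R_1},\dots$). Let $N_{i+1}=N[S_{i+1}]\subset N_i$ and $R_{i+1}=S_{i+1}N_i$, and assume that there are closed subspaces with $$B=N_1^c\oplus\dots\oplus N_{k+1}^c\oplus N_{k+1},\qquad \bar B=R_1\oplus\dots\oplus R_{k+1}\oplus R_{k+1}^c,$$ $N_i=N_{i+1}^c\oplus N_{i+1}$, $R_i^c=R_{i+1}\oplus R_{i+1}^c$, all $R_i$ closed, with continuous projections and continuous inverses of the bijections $S_i:N_i^c\to R_i$. Assume that the sum operator $[S_1\cdots S_{k+1}]:N_0\times\dots\times N_k\to\bar B$ is surjective. Assume that $\bar z_1,\dots,\bar z_k$ are not all $0$, let $l$ be the smallest index with $\bar z_l\ne0$, and let $P$ be a closed complement of $\mathrm{span}\{\bar z_l\}$ in $N_{k+1}$. **The solution family.** Consider $\hat I\in B^{k+1}$ and $\hat M,\hat L\in GL[B^{k+1},B^{k+1}]$,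 both block upper triangular with nonzero multiples of the identity as diagonal blocks, and put $$(z_{2k+1},\dots,z_{k+1})^T=\hat I+\hat M\big[n^c+\hat L\,\bar n\big],\qquad n^c\in N_1^c\times\dots\times N_{k+1}^c,\quad \bar n=(n_1,\dots,n_{k+1})\in N_1\times\dots\times N_{k+1},$$ such that always $[\bar z_1,\dots,\bar z_k,z_{k+1},\dots,z_{2k}]\in\bar X_{2k}$, and $[\bar z_1,\dots,\bar z_k,z_{k+1},\dots,z_{2k+1}]\in\bar X_{2k+1}$ if $n^c=0$. Write $$A(\varepsilon,n^c,\bar n)=\varepsilon\bar z_1+\dots+\tfrac1{k!}\varepsilon^k\bar z_k+\tfrac1{(k+1)!}\varepsilon^{k+1}z_{k+1}+\dots+\tfrac1{(2k+1)!}\varepsilon^{2k+1}z_{2k+1}$$ and $z_0(\varepsilon)=A(\varepsilon,0,0)$ (the centre line). A *solution family* is $z(\varepsilon,\bar n)=A(\varepsilon,n^c(\varepsilon,\bar n),\bar n)$, where $n^c(0,\bar n)=0$ for all $\bar n$ and, for every $c>0$, there is $\varepsilon_0>0$ such that $n^c$ is smooth and $G[z(\varepsilon,\bar n)]=0$ for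 $|\varepsilon|<\varepsilon_0$, $|\bar n|<c$. Its reduced family is $z_{red}(\varepsilon,p)=z(\varepsilon,0,\dots,0,p)$, $p\in P$. **Corollary 3 (Regularity and Uniqueness).** Such $\hat I,\hat M,\hat L$ exist; for each choice of them a solution family exists; and for every solution family the following hold. (i) For every $c>0$ there is $\varepsilon_0>0$ such that $z_{red}$ is smooth on $\{0<|\varepsilon|<\varepsilon_0,\ |p|<c\}$ and an immersion at each of its points: the derivative $\mathbb K\times P\to B$ is injective with closed complemented range. That is, $z_{red}$ defines a regular (immersed) Banach manifold in $B$ for $\varepsilon\neq0$. (ii) For all $r,c>0$ there is $\varepsilon_1>0$ such that for all $0<\varepsilon_0\le\varepsilon_1$ the pointed wedge $$W_0=\{A(\varepsilon,n^c,(0,\dots,0,p)):\ 0<|\varepsilon|<\varepsilon_0,\ n^c\in N_1^c\times\dots\times N_{k+1}^c,\ |n^c|<r,\ p\in P,\ |p|<c\}$$ is open in $B$, contains $z_0(\varepsilon)$ for $0<|\varepsilon|<\varepsilon_0$, does not contain $0$, and the solutions of $G[z]=0$ in $W_0$ are exactly the points $z_{red}(\varepsilon,p)$ with $0<|\varepsilon|<\varepsilon_0$,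 $|p|<c$. (iii) For all $0<c<c'$ and $\varepsilon_1>0$ there are $\delta,\varepsilon_0>0$ such that, whenever $0<|\varepsilon|<\varepsilon_0$, $n_i\in N_i$ with $|n_i|<\delta$ ($1\le i\le k$), $\alpha\in\mathbb K$ with $|\alpha|<\delta$, and $p\in P$ with $|p|<c$, one has $$z(\varepsilon,n_1,\dots,n_k,\alpha\bar z_l+p)=z_{red}(\varepsilon',p')\quad\text{for some }0<|\varepsilon'|<\varepsilon_1,\ p'\in P,\ |p'|<c'.$$ -/

import Mathlib

open scoped ContDiff Nat

namespace Undet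

section

variable {K : Type*} [RCLike K]
variable {B : Type*} [NormedAddCommGroup B] [NormedSpace K B]
variable {B' : Type*} [NormedAddCommGroup B'] [NormedSpace K B']

/-- The polynomial arc `ε ↦ ε z₁ + ε² z₂ / 2! + ⋯ + εⁿ zₙ / n!`. -/
noncomputable def arc (z : ℕ → B) (n : ℕ) (ε : K) : B :=
  ∑ j ∈ Finset.Icc 1 n, (ε ^ j / (j ! : K)) • z j

/-- The `i`-th undetermined coefficient `Tⁱ[z₁, …, zᵢ]` : the `i`-th derivative at `ε = 0` of
`G [ε z₁ + ⋯ + εⁱ zᵢ / i!]`. -/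
noncomputable def T (G : B → B') (z : ℕ → B) (i : ℕ) : B' :=
  iteratedDeriv i (fun ε : K => G (arc z i ε)) 0

/-- `[z₁, …, zₙ] ∈ Xₙ`, i.e. `T¹ = ⋯ = Tⁿ = 0` (only the entries `z 1, …, z n` matter). -/
def MemX (K : Type*) [RCLike K] [NormedSpace K B] [NormedSpace K B']
    (G : B → B') (n : ℕ) (z : ℕ → B) : Prop :=
  ∀ i ∈ Finset.Icc 1 n, T (K := K) G z i = 0

/-- The `i`-th Taylor coefficient at `ε = 0` of the linearization
`ε ↦ G' [ε z̄₁ + ⋯ + εᵏ z̄ₖ / k!] ∈ L[B, B']`.  For `i ≤ k` it is a combination of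
`G''₀, …, G₀^(i+1)` evaluated at `z̄₁, …, z̄ᵢ`; for `i = 0` it is `G'[0]`. -/
noncomputable def linCoeff (G : B → B') (zbar : ℕ → B) (k i : ℕ) : B →L[K] B' :=
  ((i ! : K))⁻¹ • iteratedDeriv i (fun ε : K => fderiv K G (arc zbar k ε)) 0

/-- The data of the successive direct sum decompositions: `Nc i` is `Nᵢᶜ`, `Rc i` is `Rᵢᶜ`
(with `R₀ᶜ = B'`), `Q i` is the projection of `B'` onto `Rᵢᶜ` along `R₁ ⊕ ⋯ ⊕ Rᵢ`, and `E i` is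
`Sᵢ⁻¹ ∘ P_{Rᵢ}`, where `Sᵢ⁻¹ : Rᵢ → Nᵢᶜ`.  `Q` and `E` are determined by `Nc` and `Rc`, see
`Splitting.IsDecomposition`. -/
structure Splitting (K B B' : Type*) [RCLike K] [NormedAddCommGroup B] [NormedSpace K B]
    [NormedAddCommGroup B'] [NormedSpace K B'] where
  Nc : ℕ → Submodule K B
  Rc : ℕ → Submodule K B'
  Q : ℕ → B' →L[K] B'
  E : ℕ → B' →L[K] B

/-- The normalizing factor `(2 i)! / i!` of `S_{i+1}`: the coefficient with which `zᵢ` enters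
`T²ⁱ` in front of `linCoeff i`. -/
noncomputable def kappa (K : Type*) [RCLike K] (i : ℕ) : K := ((2 * i)! : K) / (i ! : K)

/-- `chain A E i 0 = id, chain A E i 1, …, chain A E i i` : for `n ∈ Nᵢ` the vectors
`v_b = chain A E i b n` continue `n = v₀` to a solution of the first `i` linearized equations
`∑_{a + b = m} A a v_b = 0`, `m < i`.  In passing from `i` to `i + 1`, the
`R_{j+1}`-component (`j ≤ i`) of the term `∑_{a = 1}^{i + 1} A a v_{i+1-a}` is removed by
means of `S_{j+1}⁻¹`. -/
noncomputable def chain (A : ℕ → B →L[K] B') (E : ℕ → B' →L[K] B) : ℕ → ℕ → (B →L[K] B)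
  | 0, b => if b = 0 then ContinuousLinearMap.id K B else 0
  | i + 1, b =>
      chain A E i b -
        ∑ j : Fin (i + 1),
          if i + 1 - j.1 ≤ b then
            (chain A E j.1 (b - (i + 1 - j.1))) ∘L (kappa K j.1 • E (j.1 + 1)) ∘L
              (∑ a ∈ Finset.Icc 1 (i + 1), (A a) ∘L (chain A E i (i + 1 - a)))
          else 0
  termination_by i _ => i
  decreasing_by all_goals omega

/-- The term of order `i` generated by the continuation of `n ∈ Nᵢ`, before projection. -/
noncomputable def chainTerm (A : ℕ → B →L[K] B') (E : ℕ → B' →L[K] B) : ℕ → (B →L[K] B')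
  | 0 => A 0
  | i + 1 => ∑ a ∈ Finset.Icc 1 (i + 1), (A a) ∘L (chain A E i (i + 1 - a))

namespace Splitting

variable (D : Splitting K B B') (A : ℕ → B →L[K] B')

/-- The operator `S_{i+1}`; it is used on `Nᵢ` only and maps `Nᵢ` to `Rᵢᶜ`.  With
`A = linCoeff G zbar k` this is
`S₁ = G'₀`, `S₂ = P_{R₁ᶜ} ∘ 2 G''₀ z̄₁`,
`S₃ = P_{R₂ᶜ} ∘ [6 G''₀ z̄₂ + 6 G'''₀ z̄₁² - 12 G''₀ z̄₁ ∘ S₁⁻¹ P_{R₁} ∘ G''₀ z̄₁]`, and so on. -/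
noncomputable def S (i : ℕ) : B →L[K] B' :=
  kappa K i • (D.Q i ∘L chainTerm A D.E i)

/-- The filtration `N₀ = B`, `N_{i+1} = N[S_{i+1}] ⊆ Nᵢ`. -/
noncomputable def N : ℕ → Submodule K B
  | 0 => ⊤
  | i + 1 => N i ⊓ LinearMap.ker (D.S A i : B →ₗ[K] B')

/-- `R (i + 1) = R_{i+1} = S_{i+1} Nᵢ` (and `R 0 = 0`). -/
noncomputable def R : ℕ → Submodule K B'
  | 0 => ⊥
  | i + 1 => (D.N A i).map (D.S A i : B →ₗ[K] B')

/-- The decomposition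
`B = N₁ᶜ ⊕ ⋯ ⊕ N_{k+1}ᶜ ⊕ N_{k+1}`, `B' = R₁ ⊕ ⋯ ⊕ R_{k+1} ⊕ R_{k+1}ᶜ` by closed subspaces,
together with the continuous projections and the continuous inverses of the bijections
`Sᵢ : Nᵢᶜ → Rᵢ`. -/
structure IsDecomposition (k : ℕ) : Prop where
  Rc_zero : D.Rc 0 = ⊤
  isClosed_Nc : ∀ i ≤ k, IsClosed (D.Nc (i + 1) : Set B)
  isClosed_R : ∀ i ≤ k, IsClosed (D.R A (i + 1) : Set B')
  isClosed_Rc : ∀ i ≤ k, IsClosed (D.Rc (i + 1) : Set B')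
  sup_N : ∀ i ≤ k, D.Nc (i + 1) ⊔ D.N A (i + 1) = D.N A i
  disjoint_N : ∀ i ≤ k, Disjoint (D.Nc (i + 1)) (D.N A (i + 1))
  sup_R : ∀ i ≤ k, D.R A (i + 1) ⊔ D.Rc (i + 1) = D.Rc i
  disjoint_R : ∀ i ≤ k, Disjoint (D.R A (i + 1)) (D.Rc (i + 1))
  Q_of_mem_Rc : ∀ i ≤ k + 1, ∀ w ∈ D.Rc i, D.Q i w = w
  Q_of_mem_R : ∀ i ≤ k + 1, ∀ j ≤ i, ∀ w ∈ D.R A j, D.Q i w = 0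
  E_S : ∀ i ≤ k, ∀ n ∈ D.Nc (i + 1), D.E (i + 1) (D.S A i n) = n
  E_of_mem_R : ∀ i ≤ k, ∀ j ≤ i, ∀ w ∈ D.R A j, D.E (i + 1) w = 0
  E_of_mem_Rc : ∀ i ≤ k, ∀ w ∈ D.Rc (i + 1), D.E (i + 1) w = 0

/-- Surjectivity of the sum operator `[S₁ ⋯ S_{k+1}] ∈ L[N₀ × ⋯ × Nₖ, B']`. -/
def SumSurjective (k : ℕ) : Prop :=
  ∀ w : B', ∃ n : Fin (k + 1) → B, (∀ i : Fin (k + 1), n i ∈ D.N A i) ∧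
    ∑ i : Fin (k + 1), D.S A i (n i) = w

/-- `N₁ × ⋯ × N_{k+1} ⊆ B^{k+1}`; the entry with index `i : Fin (k + 1)` is `n_{i+1}`. -/
noncomputable def kerProd (k : ℕ) : Submodule K (Fin (k + 1) → B) :=
  Submodule.pi Set.univ fun i : Fin (k + 1) => D.N A (i + 1)

/-- `N₁ᶜ × ⋯ × N_{k+1}ᶜ ⊆ B^{k+1}`. -/
def complProd (k : ℕ) : Submodule K (Fin (k + 1) → B) :=
  Submodule.pi Set.univ fun i : Fin (k + 1) => D.Nc (i + 1)

/-- The tuple `(0, …, 0, p) ∈ N₁ × ⋯ × N_{k+1}` for `p ∈ P ⊆ N_{k+1}`. -/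
noncomputable def lastTuple {k : ℕ} {P : Submodule K B} (hP : P ≤ D.N A (k + 1)) (p : P) :
    D.kerProd A k :=
  ⟨Pi.single (Fin.last k) (p : B), by
    intro i _
    by_cases h : i = Fin.last k
    · subst h
      simpa using hP p.2
    · simp [h]⟩

end Splitting

/-- The sequence `z̄₁, …, z̄ₖ, z_{k+1}, …, z_{2k+1}`, where `y = (z_{2k+1}, …, z_{k+1})`. -/
def coeffSeq (zbar : ℕ → B) (k : ℕ) (y : Fin (k + 1) → B) (j : ℕ) : B :=
  if j ≤ k then zbar j else
    if h : 2 * k + 1 - j < k + 1 then y ⟨2 * k + 1 - j, h⟩ else 0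

/-- A continuous linear automorphism of `B^{k+1}` is block upper triangular, with nonzero
multiples of the identity as diagonal blocks. -/
def IsTriangular {k : ℕ} (M : (Fin (k + 1) → B) ≃L[K] (Fin (k + 1) → B)) : Prop :=
  ∃ c : Fin (k + 1) → K, (∀ i, c i ≠ 0) ∧
    ∀ (i : Fin (k + 1)) (x : Fin (k + 1) → B), (∀ j, i < j → x j = 0) → M x i = c i • x i

/-- A parametrization `Î + M̂ [nᶜ + L̂ n]`, `nᶜ ∈ N₁ᶜ × ⋯ × N_{k+1}ᶜ`, `n ∈ N₁ × ⋯ × N_{k+1}`,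
of the coefficients `(z_{2k+1}, …, z_{k+1})`, adapted to the filtration, that stays in `X̄_{2k}`
and that lies in `X̄_{2k+1}` for `nᶜ = 0`. -/
structure Ansatz (G : B → B') (zbar : ℕ → B) (k : ℕ) (D : Splitting K B B') where
  I : Fin (k + 1) → B
  M : (Fin (k + 1) → B) ≃L[K] (Fin (k + 1) → B)
  L : (Fin (k + 1) → B) ≃L[K] (Fin (k + 1) → B)
  triangular_M : IsTriangular M
  triangular_L : IsTriangular L
  memX_two_mul : ∀ x ∈ D.complProd k, ∀ n ∈ D.kerProd (linCoeff G zbar k) k,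
    MemX K G (2 * k) (coeffSeq zbar k (I + M (x + L n)))
  memX_two_mul_add_one : ∀ n ∈ D.kerProd (linCoeff G zbar k) k,
    MemX K G (2 * k + 1) (coeffSeq zbar k (I + M (L n)))

namespace Ansatz

variable {G : B → B'} {zbar : ℕ → B} {k : ℕ} {D : Splitting K B B'}
variable (C : Ansatz G zbar k D)

/-- `ε z̄₁ + ⋯ + εᵏ z̄ₖ / k! + ε^{k+1} z_{k+1} / (k+1)! + ⋯ + ε^{2k+1} z_{2k+1} / (2k+1)!` with
`(z_{2k+1}, …, z_{k+1}) = Î + M̂ [x + L̂ n]`. -/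
noncomputable def point (ε : K) (x n : Fin (k + 1) → B) : B :=
  arc (coeffSeq zbar k (C.I + C.M (x + C.L n))) (2 * k + 1) ε

/-- The centre line `z₀(ε)`. -/
noncomputable def z0 (ε : K) : B := C.point ε 0 0

/-- The curves `z(ε, n₁, …, n_{k+1})` belonging to the function `nᶜ(ε, n₁, …, n_{k+1})`. -/
noncomputable def z (nc : K × D.kerProd (linCoeff G zbar k) k → D.complProd k)
    (q : K × D.kerProd (linCoeff G zbar k) k) : B :=
  C.point q.1 (nc q : Fin (k + 1) → B) (q.2 : Fin (k + 1) → B)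

/-- `nᶜ` defines a smooth family `z(ε, n₁, …, n_{k+1})` of solution curves of `G = 0`, for
`(n₁, …, n_{k+1})` bounded and `ε` small (depending on the bound). -/
structure IsSolutionFamily
    (nc : K × D.kerProd (linCoeff G zbar k) k → D.complProd k) : Prop where
  zero : ∀ n, nc (0, n) = 0
  solves : ∀ c > 0, ∃ ε₀ > 0,
    ContDiffOn K ∞ nc (Metric.ball (0 : K) ε₀ ×ˢ Metric.ball 0 c) ∧
    ∀ ε : K, ‖ε‖ < ε₀ → ∀ n, ‖n‖ < c → G (C.z nc (ε, n)) = 0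

/-- The reduced family `z_red(ε, p) = z(ε, 0, …, 0, p)`, `p ∈ P`. -/
noncomputable def zred (nc : K × D.kerProd (linCoeff G zbar k) k → D.complProd k)
    {P : Submodule K B} (hP : P ≤ D.N (linCoeff G zbar k) (k + 1)) (q : K × P) : B :=
  C.z nc (q.1, D.lastTuple (linCoeff G zbar k) hP q.2)

/-- The wedge along the centre line: the image of `0 < |ε| < ε₀`, `|nᶜ| < r`, `|p| < c` under
`(ε, nᶜ, p) ↦ z₀(ε) + [ε^{2k+1} / (2k+1)! ⋯ ε^{k+1} / (k+1)!] M̂ [nᶜ + L̂ (0, …, 0, p)]`. -/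
def wedge {P : Submodule K B} (hP : P ≤ D.N (linCoeff G zbar k) (k + 1)) (ε₀ r c : ℝ) : Set B :=
  {z | ∃ (ε : K) (x : D.complProd k) (p : P), 0 < ‖ε‖ ∧ ‖ε‖ < ε₀ ∧ ‖x‖ < r ∧ ‖p‖ < c ∧
    z = C.point ε (x : Fin (k + 1) → B)
      (D.lastTuple (linCoeff G zbar k) hP p : Fin (k + 1) → B)}

end Ansatz

/-- `f` is regular (an immersion) at `x`: it is differentiable there, and its derivative is
injective with closed complemented range. -/
def IsRegularAt {F : Type*} [NormedAddCommGroup F] [NormedSpace K F] (f : F → B) (x : F) : Prop :=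
  ∃ f' : F →L[K] B, HasFDerivAt f f' x ∧ Function.Injective f' ∧
    IsClosed (LinearMap.range (f' : F →ₗ[K] B) : Set B) ∧
    (LinearMap.range (f' : F →ₗ[K] B)).ClosedComplemented

end

end Undet

/-! Points near the arc have the form `arc zbar k ε + ε ^ (k + 1) • w`. If `w`, `w'` are bounded and
`w - w' = ev B k ε y`, the quadratic terms of `G` cost a factor ε^(2k+2), so the values of `G`
differ by ε^(k+1) ∑_{m ≤ k} ε^m c_m plus O(ε^(2k+2) ‖y‖). Here c_m = `conv A (relCoeff K y) m` are
the coefficients of (∑ ε^a A_a)(∑ ε^b v_b) (`exists_norm_expansion_le`). Everything is thereby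
reduced to this linear equation for power series.

The filtration `N` describes the leading coefficients of its approximate solutions: a leading
coefficient of a solution to order i lies in `N i` (`leading_mem`), and every element of `N i` has
such a continuation, built by `chain` (`conv_chainSeq`). Hence along ∏ N_i all orders up to k
vanish. Along ∏ N_iᶜ the orders below k vanish, and order k is an isomorphism Λ onto B' by
surjectivity of the sum operator (`Adapted.exists_equiv`).

Therefore ε^(-(2k+1)) G, written in the parameters (ε, n, nᶜ), extends analytically to ε = 0 with
value Λ nᶜ there (`contDiffAt_resid_zero`). It is uniformly close to Λ for bounded parameters and
small ε. A quantitative inverse function argument and the implicit function theorem give exactly one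
smooth bounded solution nᶜ(ε, n) (`exists_unique_solution`). By continuity from nᶜ(0, n) = 0, every
solution family agrees with it for small ε (`IsSolutionFamily.exists_norm_lt`).

The map (ε, nᶜ, p) ↦ z degenerates as ε → 0, but a rescaling repairs this. Replacing ε by ε +
ε^(k+2-l) β moves the arc by order ε^(k+1) in the direction z̄_l, and the entries of nᶜ are rescaled
by powers of ε. At the scale ε^(k+1) the limit is an affine isomorphism, because B = span{z̄_l} ⊕ ⨁
N_iᶜ ⊕ P (`exists_blowup_equiv`). So for small ε ≠ 0 the map is a local diffeomorphism, its image is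
open, and the reduced family is a graph in these coordinates; this is (i) and (ii). For (iii), a
solution near the surface nᶜ = 0 is expressed in the rescaled coordinates (`exists_point_eq`) and
identified with the reduced family by a uniqueness lemma that bounds only `w`, not nᶜ
(`exists_eq_zero_of_solves`). -/

namespace Undet

open Filter Topology Asymptotics

/-! ### Division of analytic functions by powers of a scalar variable. -/

section Division

variable {K : Type*} [RCLike K]
variable {V : Type*} [NormedAddCommGroup V] [NormedSpace K V]
variable {F : Type*} [NormedAddCommGroup F] [NormedSpace K F]

/-- The divided difference of a multilinear map with respect to the splitting
`v = θ v • e + π v`, see `multilinearDiv_apply`. -/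
noncomputable def multilinearDiv (F : Type*) [NormedAddCommGroup F] [NormedSpace K F]
    (e : V) (π : V →L[K] V) : (n : ℕ) → (V [×n + 1]→L[K] F) →L[K] (V [×n]→L[K] F)
  | 0 =>
    (ContinuousLinearMap.apply K (V [×0]→L[K] F) e) ∘L
      ((continuousMultilinearCurryLeftEquiv K (fun _ : Fin 1 => V) F).toContinuousLinearEquiv :
        (V [×1]→L[K] F) →L[K] (V →L[K] V [×0]→L[K] F))
  | n + 1 =>
    (ContinuousLinearMap.apply K (V [×n + 1]→L[K] F) e) ∘L
      ((continuousMultilinearCurryLeftEquiv K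
        (fun _ : Fin (n + 2) => V) F).toContinuousLinearEquiv :
        (V [×n + 2]→L[K] F) →L[K] (V →L[K] V [×n + 1]→L[K] F)) +
    ((continuousMultilinearCurryLeftEquiv K
        (fun _ : Fin (n + 1) => V) F).symm.toContinuousLinearEquiv :
        (V →L[K] V [×n]→L[K] F) →L[K] (V [×n + 1]→L[K] F)) ∘L
      ((ContinuousLinearMap.compL K V (V [×n + 1]→L[K] F) (V [×n]→L[K] F)
        (multilinearDiv F e π n)) ∘L
      ((ContinuousLinearMap.compL K V V (V [×n + 1]→L[K] F)).flip π) ∘L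
      ((continuousMultilinearCurryLeftEquiv K
        (fun _ : Fin (n + 2) => V) F).toContinuousLinearEquiv :
        (V [×n + 2]→L[K] F) →L[K] (V →L[K] V [×n + 1]→L[K] F)))

/-- Telescoping: one argument after the other is changed from v to π v. Each change produces θ v
times a term with e in that slot, by linearity and v = θ v • e + π v. -/
theorem multilinearDiv_apply (e : V) (π : V →L[K] V) (θ : V →L[K] K)
    (h : ∀ v, v = θ v • e + π v) (n : ℕ) (p : V [×n + 1]→L[K] F) (v : V) :
    θ v • multilinearDiv F e π n p (fun _ => v) = p (fun _ => v) - p (fun _ => π v) := by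
  have key : ∀ (m : ℕ) (p : V [×m + 1]→L[K] F) (v : V), p (fun _ => v) =
      θ v • p.curryLeft e (fun _ => v) + p.curryLeft (π v) (fun _ => v) := by
    intro m p v
    have : p (fun _ => v) = p.curryLeft v (fun _ => v) := by
      rw [ContinuousMultilinearMap.curryLeft_apply]
      congr 1
      ext i
      refine Fin.cases ?_ (fun j => ?_) i <;> simp
    rw [this]
    conv_lhs => rw [show p.curryLeft v = p.curryLeft (θ v • e + π v) by rw [← h v]]
    rw [map_add, map_smul]
    rfl
  have cst : ∀ (m : ℕ) (p : V [×m + 1]→L[K] F) (v : V),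
      p.curryLeft v (fun _ => v) = p (fun _ => v) := by
    intro m p v
    rw [ContinuousMultilinearMap.curryLeft_apply]
    congr 1
    ext i
    refine Fin.cases ?_ (fun j => ?_) i <;> simp
  induction n with
  | zero =>
    rw [key 0 p v, ← cst 0 p (π v)]
    have : (fun _ : Fin 0 => v) = fun _ => π v := Subsingleton.elim _ _
    rw [this]
    simp only [add_sub_cancel_right]
    rfl
  | succ n ih =>
    rw [key (n + 1) p v, ← cst (n + 1) p (π v), add_sub_assoc, ← ih]
    simp only [multilinearDiv]
    rw [← smul_add]
    congr 1

/-- The factor n + 1 counts the telescoping terms. Linear growth is harmless for the radius of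
convergence of the quotient series. -/
theorem norm_multilinearDiv_le (e : V) (π : V →L[K] V) (he : ‖e‖ ≤ 1) (hπ : ‖π‖ ≤ 1)
    (n : ℕ) (p : V [×n + 1]→L[K] F) : ‖multilinearDiv F e π n p‖ ≤ (n + 1) * ‖p‖ := by
  have h1 : ∀ (m : ℕ) (p : V [×m + 1]→L[K] F), ‖p.curryLeft e‖ ≤ ‖p‖ := by
    intro m p
    refine (p.curryLeft.le_opNorm e).trans ?_
    rw [ContinuousMultilinearMap.curryLeft_norm]
    exact mul_le_of_le_one_right (norm_nonneg _) he
  induction n with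
  | zero =>
    have : multilinearDiv F e π 0 p = p.curryLeft e := rfl
    simpa [this] using h1 0 p
  | succ n ih =>
    have : multilinearDiv F e π (n + 1) p = p.curryLeft e +
      (continuousMultilinearCurryLeftEquiv K (fun _ : Fin (n + 1) => V) F).symm
        ((multilinearDiv F e π n) ∘L (p.curryLeft ∘L π)) := rfl
    rw [this]
    refine (norm_add_le _ _).trans ?_
    rw [LinearIsometryEquiv.norm_map]
    have h2 : ‖(multilinearDiv F e π n) ∘L (p.curryLeft ∘L π)‖ ≤ (n + 1) * ‖p‖ := by
      refine ContinuousLinearMap.opNorm_le_bound _ (by positivity) fun v => ?_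
      refine (ih _).trans ?_
      rw [mul_assoc]
      refine mul_le_mul_of_nonneg_left ?_ (by positivity)
      refine (p.curryLeft.le_opNorm _).trans ?_
      rw [ContinuousMultilinearMap.curryLeft_norm]
      refine mul_le_mul_of_nonneg_left ?_ (norm_nonneg _)
      exact (π.le_opNorm v).trans (mul_le_of_le_one_left (norm_nonneg _) hπ)
    have := h1 (n + 1) p
    push_cast
    linarith

/-- Division with respect to a scalar variable, for analytic functions. -/
theorem exists_analyticAt_sub_eq_smul [CompleteSpace F] {f : V → F} {v₀ : V}
    (hf : AnalyticAt K f v₀)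
    (e : V) (π : V →L[K] V) (θ : V →L[K] K) (h : ∀ v, v = θ v • e + π v)
    (he : ‖e‖ ≤ 1) (hπ : ‖π‖ ≤ 1) :
    ∃ g : V → F, AnalyticAt K g v₀ ∧
      ∀ᶠ v in 𝓝 (0 : V), f (v₀ + v) = f (v₀ + π v) + θ v • g (v₀ + v) := by
  obtain ⟨p, r, hp⟩ := hf
  obtain ⟨C, a, hC, ha, hpC⟩ := p.le_mul_pow_of_radius_pos (hp.r_pos.trans_le hp.r_le)
  let q : FormalMultilinearSeries K V F := fun n => multilinearDiv F e π n (p (n + 1))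
  have hq : ∀ n, ‖q n‖ ≤ C * a * (2 * a) ^ n := by
    intro n
    refine (norm_multilinearDiv_le e π he hπ n _).trans ?_
    -- The factor n + 1 is absorbed by doubling the geometric ratio, which leaves a radius of at
    -- least 1 / (2a).
    have h1 : ((n : ℝ) + 1) ≤ 2 ^ n := by
      exact_mod_cast Nat.lt_two_pow_self
    calc ((n : ℝ) + 1) * ‖p (n + 1)‖ ≤ 2 ^ n * (C * a ^ (n + 1)) := by
          gcongr
          exact hpC _
      _ = C * a * (2 * a) ^ n := by rw [mul_pow]; ring
  have hrad : 0 < q.radius := by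
    have ha2 : 0 < 2 * a := by positivity
    let ρ : NNReal := ⟨(2 * a)⁻¹, by positivity⟩
    have : (ρ : ENNReal) ≤ q.radius := by
      refine q.le_radius_of_bound (C * a) fun n => ?_
      refine (mul_le_mul_of_nonneg_right (hq n) (by positivity)).trans ?_
      rw [mul_assoc, ← mul_pow]
      have : (2 * a) * (ρ : ℝ) = 1 := mul_inv_cancel₀ ha2.ne'
      simp [this]
    refine lt_of_lt_of_le ?_ this
    rw [ENNReal.coe_pos]
    exact_mod_cast (by positivity : 0 < (2 * a)⁻¹)
  have hqs := q.hasFPowerSeriesOnBall hrad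
  refine ⟨fun z => q.sum (z - v₀), ?_, ?_⟩
  · have := hqs.hasFPowerSeriesAt.analyticAt
    refine AnalyticAt.fun_comp (f := fun z => z - v₀) (x := v₀) (by simpa using this) (by fun_prop)
  · have hm : ∀ᶠ v in 𝓝 (0 : V), v ∈ Metric.eball (0 : V) r ∧ v ∈ Metric.eball (0 : V) q.radius :=
      Filter.Eventually.and (Metric.eball_mem_nhds 0 hp.r_pos) (Metric.eball_mem_nhds 0 hrad)
    filter_upwards [hm] with v hv
    have hπv : π v ∈ Metric.eball (0 : V) r := by
      have := hv.1
      simp only [Metric.mem_eball, edist_zero_right] at this ⊢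
      refine lt_of_le_of_lt ?_ this
      rw [← ofReal_norm, ← ofReal_norm]
      exact ENNReal.ofReal_le_ofReal
        ((π.le_opNorm v).trans (mul_le_of_le_one_left (norm_nonneg _) hπ))
    have s1 := hp.hasSum hv.1
    have s2 := hp.hasSum hπv
    have s3 := (hqs.hasSum hv.2).const_smul (θ v)
    have s4 := s1.sub s2
    rw [← hasSum_nat_add_iff' 1] at s4
    have h0 : p 0 (fun _ => v) - p 0 (fun _ => π v) = 0 := by
      rw [sub_eq_zero]
      congr 1
      exact Subsingleton.elim _ _
    simp only [Finset.range_one, Finset.sum_singleton, h0, sub_zero] at s4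
    have := s4.unique (s3.congr_fun ?_)
    · simp only [zero_add] at this
      simp only [add_sub_cancel_left]
      rw [← this]; abel
    · intro n
      exact (multilinearDiv_apply e π θ h n (p (n + 1)) v).symm

theorem exists_analyticAt_eq_fst_smul [CompleteSpace F] {f : K × V → F} {v₀ : V}
    (hf : AnalyticAt K f (0, v₀)) (h0 : ∀ᶠ v in 𝓝 v₀, f (0, v) = 0) :
    ∃ g : K × V → F, AnalyticAt K g (0, v₀) ∧ ∀ᶠ z in 𝓝 ((0 : K), v₀), f z = z.1 • g z := by
  obtain ⟨g, hg, hfg⟩ := exists_analyticAt_sub_eq_smul hf ((1 : K), (0 : V))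
    (ContinuousLinearMap.inr K K V ∘L ContinuousLinearMap.snd K K V)
    (ContinuousLinearMap.fst K K V) (by intro v; ext <;> simp) (by simp)
    (ContinuousLinearMap.opNorm_le_bound _ zero_le_one fun v => by
      simpa using norm_snd_le v)
  refine ⟨g, hg, ?_⟩
  have h1 : Tendsto (fun z : K × V => z - (0, v₀)) (𝓝 (0, v₀)) (𝓝 0) := by
    have : Continuous fun z : K × V => z - (0, v₀) := by fun_prop
    simpa using this.tendsto (0, v₀)
  have h2 : ∀ᶠ z in 𝓝 ((0 : K), v₀), f (0, z.2) = 0 :=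
    (continuous_snd.tendsto ((0 : K), v₀)).eventually h0
  filter_upwards [h1.eventually hfg, h2] with z hz hz2
  have e1 : ((0 : K), v₀) + (z - (0, v₀)) = z := by abel
  rw [e1] at hz
  rw [hz]
  have e2 : ((0 : K), v₀) + (ContinuousLinearMap.inr K K V ∘L ContinuousLinearMap.snd K K V)
      (z - (0, v₀)) = (0, z.2) := by
    ext <;> simp
  rw [e2, hz2]
  simp

/-- If `f (ε, v) = O(εᵐ)` for each `v`, then `f (ε, v) / εᵐ` is analytic. -/
theorem exists_analyticAt_eq_pow_smul [CompleteSpace F] {v₀ : V} (m : ℕ) :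
    ∀ {f : K × V → F}, AnalyticAt K f (0, v₀) →
    (∀ᶠ v in 𝓝 v₀, (fun ε : K => f (ε, v)) =O[𝓝[≠] 0] fun ε => ε ^ m) →
    ∃ g : K × V → F, AnalyticAt K g (0, v₀) ∧
      ∀ᶠ z in 𝓝 ((0 : K), v₀), f z = z.1 ^ m • g z := by
  induction m with
  | zero => exact fun {f} hf _ => ⟨f, hf, by simp⟩
  | succ m ih =>
    intro f hf hO
    have han : ∀ᶠ v in 𝓝 v₀, AnalyticAt K f (0, v) := by
      have : Tendsto (fun v : V => ((0 : K), v)) (𝓝 v₀) (𝓝 (0, v₀)) :=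
        (Continuous.prodMk_right (0 : K)).tendsto v₀
      exact this.eventually hf.eventually_analyticAt
    have hz : ∀ᶠ v in 𝓝 v₀, f (0, v) = 0 := by
      filter_upwards [hO, han] with v hv hav
      have c1 : Tendsto (fun ε : K => f (ε, v)) (𝓝[≠] 0) (𝓝 (f (0, v))) := by
        have : ContinuousAt (fun ε : K => f (ε, v)) 0 :=
          ContinuousAt.comp (f := fun ε : K => (ε, v)) hav.continuousAt (by fun_prop)
        exact this.tendsto.mono_left nhdsWithin_le_nhds
      have c2 : Tendsto (fun ε : K => f (ε, v)) (𝓝[≠] 0) (𝓝 0) := by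
        refine hv.trans_tendsto ?_
        have : Continuous fun ε : K => ε ^ (m + 1) := by fun_prop
        simpa using (this.tendsto 0).mono_left nhdsWithin_le_nhds
      exact tendsto_nhds_unique c1 c2
    obtain ⟨g, hg, hfg⟩ := exists_analyticAt_eq_fst_smul hf hz
    suffices hgO : ∀ᶠ v in 𝓝 v₀, (fun ε : K => g (ε, v)) =O[𝓝[≠] 0] fun ε => ε ^ m by
      obtain ⟨g', hg', hgg'⟩ := ih hg hgO
      refine ⟨g', hg', ?_⟩
      filter_upwards [hfg, hgg'] with z h1 h2
      rw [h1, h2, smul_smul, pow_succ']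
    -- The joint neighbourhood of (0, v₀) is split into: for v near v₀, for ε near 0. The order in ε
    -- can then be divided for each v separately.
    · have hsw : ∀ᶠ v in 𝓝 v₀, ∀ᶠ ε in 𝓝 (0 : K), f (ε, v) = ε • g (ε, v) := by
        have : Tendsto (fun z : V × K => (z.2, z.1)) (𝓝 (v₀, 0)) (𝓝 ((0 : K), v₀)) :=
          (by fun_prop : Continuous fun z : V × K => (z.2, z.1)).tendsto _
        exact (this.eventually hfg).curry_nhds
      filter_upwards [hO, hsw] with v h1 h2
      obtain ⟨C, hC⟩ := h1.bound
      refine IsBigO.of_bound C ?_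
      filter_upwards [hC, h2.filter_mono nhdsWithin_le_nhds, self_mem_nhdsWithin] with ε h3 h4 h5
      rw [h4, norm_smul, pow_succ', norm_mul] at h3
      have : 0 < ‖ε‖ := norm_pos_iff.2 h5
      have h6 : ‖ε‖ * ‖g (ε, v)‖ ≤ ‖ε‖ * (C * ‖ε ^ m‖) := by linarith
      exact le_of_mul_le_mul_left h6 this

end Division

/-! ### Order of vanishing at 0 for functions of one scalar variable. -/

section OneVariable

variable {K : Type*} [RCLike K]
variable {F : Type*} [NormedAddCommGroup F] [NormedSpace K F]

theorem coeff_eq_zero_of_isBigO (n : ℕ) : ∀ {c : ℕ → F},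
    (fun ε : K => ∑ i ∈ Finset.range n, ε ^ i • c i) =O[𝓝[≠] 0] (fun ε => ε ^ n) →
    ∀ i < n, c i = 0 := by
  induction n with
  | zero => intro c _ i hi; omega
  | succ n ih =>
    intro c h
    have h0 : c 0 = 0 := by
      have c1 : Tendsto (fun ε : K => ∑ i ∈ Finset.range (n + 1), ε ^ i • c i) (𝓝[≠] 0)
          (𝓝 (c 0)) := by
        have : Continuous fun ε : K => ∑ i ∈ Finset.range (n + 1), ε ^ i • c i := by fun_prop
        have h2 := (this.tendsto 0).mono_left (nhdsWithin_le_nhds (s := {0}ᶜ))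
        simpa [Finset.sum_range_succ'] using h2
      have c2 : Tendsto (fun ε : K => ∑ i ∈ Finset.range (n + 1), ε ^ i • c i) (𝓝[≠] 0)
          (𝓝 0) := by
        refine h.trans_tendsto ?_
        have : Continuous fun ε : K => ε ^ (n + 1) := by fun_prop
        simpa using (this.tendsto 0).mono_left nhdsWithin_le_nhds
      exact tendsto_nhds_unique c1 c2
    have h1 := ih (c := fun i => c (i + 1)) ?_
    · intro i hi
      cases i with
      | zero => exact h0
      | succ i => exact h1 i (by omega)
    · obtain ⟨C, hC⟩ := h.bound
      refine IsBigO.of_bound C ?_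
      filter_upwards [hC, self_mem_nhdsWithin] with ε h3 h5
      have e1 : ∑ i ∈ Finset.range (n + 1), ε ^ i • c i =
          ε • ∑ i ∈ Finset.range n, ε ^ i • c (i + 1) := by
        rw [Finset.sum_range_succ', h0, smul_zero, add_zero, Finset.smul_sum]
        exact Finset.sum_congr rfl fun i _ => by rw [smul_smul, pow_succ']
      rw [e1, norm_smul, pow_succ', norm_mul] at h3
      have : 0 < ‖ε‖ := norm_pos_iff.2 h5
      have h6 : ‖ε‖ * ‖∑ i ∈ Finset.range n, ε ^ i • c (i + 1)‖ ≤ ‖ε‖ * (C * ‖ε ^ n‖) := by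
        linarith
      exact le_of_mul_le_mul_left h6 this

theorem isBigO_pow_of_le {F : Type*} [NormedAddCommGroup F] {f : K → F} {l : Filter K}
    (hl : l ≤ 𝓝 0) {m n : ℕ} (hmn : m ≤ n)
    (h : f =O[l] fun ε => ε ^ n) : f =O[l] fun ε => ε ^ m := by
  refine h.trans (IsBigO.mono (IsBigO.of_bound 1 ?_) hl)
  filter_upwards [Metric.ball_mem_nhds (0 : K) one_pos] with ε hε
  rw [one_mul, norm_pow, norm_pow]
  exact pow_le_pow_of_le_one (norm_nonneg _) (by simpa using (mem_ball_zero_iff.1 hε).le) hmn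

/-- Translates vanishing derivatives into growth conditions, which can be added, compared and
divided by powers of ε. -/
theorem isBigO_pow_iff [CompleteSpace F] {f : K → F} (hf : AnalyticAt K f 0) (n : ℕ) :
    f =O[𝓝[≠] 0] (fun ε => ε ^ n) ↔ ∀ i < n, iteratedDeriv i f 0 = 0 := by
  obtain ⟨R, hR, hfR⟩ := hf.exists_eq_sum_add_pow_mul n
  have hRO : (fun ε : K => ε ^ n • R ε) =O[𝓝[≠] 0] (fun ε => ε ^ n) := by
    have h1 : R =O[𝓝[≠] 0] (fun _ => (1 : K)) :=
      (hR.continuousAt.tendsto.mono_left nhdsWithin_le_nhds).isBigO_one K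
    simpa using (isBigO_refl (fun ε : K => ε ^ n) (𝓝[≠] 0)).smul h1
  constructor
  · intro h i hi
    have h2 : (fun ε : K => ∑ i ∈ Finset.range n, ε ^ i • ((i ! : K)⁻¹ • iteratedDeriv i f 0))
        =O[𝓝[≠] 0] (fun ε => ε ^ n) := by
      refine (h.sub hRO).congr_left fun ε => ?_
      rw [hfR ε, add_sub_cancel_right]
      exact Finset.sum_congr rfl fun i _ => by rw [smul_smul, div_eq_mul_inv]
    have h3 := coeff_eq_zero_of_isBigO n h2 i hi
    rcases smul_eq_zero.1 h3 with h4 | h4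
    · exact absurd h4 (inv_ne_zero (by exact_mod_cast Nat.factorial_ne_zero i))
    · exact h4
  · intro h
    refine hRO.congr_left fun ε => ?_
    rw [hfR ε, Finset.sum_eq_zero, zero_add]
    intro i hi
    rw [h i (Finset.mem_range.1 hi), smul_zero]

end OneVariable

/-! ### The filtration, its complements and the projections. -/

section LinearAlgebra

variable {K : Type*} [RCLike K]
variable {B : Type*} [NormedAddCommGroup B] [NormedSpace K B]
variable {B' : Type*} [NormedAddCommGroup B'] [NormedSpace K B']

theorem kappa_ne_zero (i : ℕ) : kappa K i ≠ 0 :=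
  div_ne_zero (by exact_mod_cast Nat.factorial_ne_zero _)
    (by exact_mod_cast Nat.factorial_ne_zero _)

namespace Splitting

variable (D : Splitting K B B') (A : ℕ → B →L[K] B')

theorem N_succ_le (i : ℕ) : D.N A (i + 1) ≤ D.N A i := inf_le_left

theorem mem_N_succ {i : ℕ} {n : B} : n ∈ D.N A (i + 1) ↔ n ∈ D.N A i ∧ D.S A i n = 0 := by
  simp [N]

theorem isClosed_N (i : ℕ) : IsClosed (D.N A i : Set B) := by
  induction i with
  | zero => simp [N]
  | succ i ih =>
    have : (D.N A (i + 1) : Set B) = (D.N A i : Set B) ∩ (D.S A i) ⁻¹' {0} := by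
      ext x; simp [mem_N_succ]
    rw [this]
    exact ih.inter (isClosed_singleton.preimage (D.S A i).continuous)

/-- `R₁ ⊕ ⋯ ⊕ Rᵢ`. -/
noncomputable def Rsum (i : ℕ) : Submodule K B' := ⨆ j : Fin (i + 1), D.R A j

theorem R_le_Rsum {i j : ℕ} (h : j ≤ i) : D.R A j ≤ D.Rsum A i :=
  le_iSup (fun j : Fin (i + 1) => D.R A j) ⟨j, by omega⟩

theorem Rsum_mono {i j : ℕ} (h : i ≤ j) : D.Rsum A i ≤ D.Rsum A j :=
  iSup_le fun a => D.R_le_Rsum A (by omega)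

namespace IsDecomposition

variable {D A} {k : ℕ}

theorem Nc_le (hD : D.IsDecomposition A k) {i : ℕ} (hi : i ≤ k) : D.Nc (i + 1) ≤ D.N A i :=
  (hD.sup_N i hi) ▸ le_sup_left

theorem Q_of_mem_Rsum (hD : D.IsDecomposition A k) {i : ℕ} (hi : i ≤ k + 1) {w : B'}
    (hw : w ∈ D.Rsum A i) : D.Q i w = 0 := by
  have : D.Rsum A i ≤ LinearMap.ker (D.Q i : B' →ₗ[K] B') :=
    iSup_le fun j w hw => hD.Q_of_mem_R i hi j (by omega) w hw
  exact this hw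

theorem E_of_mem_Rsum (hD : D.IsDecomposition A k) {i : ℕ} (hi : i ≤ k) {w : B'}
    (hw : w ∈ D.Rsum A i) :
    D.E (i + 1) w = 0 := by
  have : D.Rsum A i ≤ LinearMap.ker (D.E (i + 1) : B' →ₗ[K] B) :=
    iSup_le fun j w hw => hD.E_of_mem_R i hi j (by omega) w hw
  exact this hw

theorem exists_of_mem_R (hD : D.IsDecomposition A k) {i : ℕ} (hi : i ≤ k) {w : B'}
    (hw : w ∈ D.R A (i + 1)) :
    ∃ n ∈ D.Nc (i + 1), D.S A i n = w := by
  obtain ⟨n, hn, rfl⟩ := hw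
  rw [SetLike.mem_coe, ← hD.sup_N i hi] at hn
  obtain ⟨a, ha, b, hb, rfl⟩ := Submodule.mem_sup.1 hn
  refine ⟨a, ha, ?_⟩
  simp [((D.mem_N_succ A).1 hb).2]

theorem exists_decomp (hD : D.IsDecomposition A k) {i : ℕ} (hi : i ≤ k) {w : B'} (hw : w ∈ D.Rc i) :
    ∃ n ∈ D.Nc (i + 1), ∃ r ∈ D.Rc (i + 1), w = D.S A i n + r := by
  rw [← hD.sup_R i hi] at hw
  obtain ⟨a, ha, b, hb, rfl⟩ := Submodule.mem_sup.1 hw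
  obtain ⟨n, hn, rfl⟩ := hD.exists_of_mem_R hi ha
  exact ⟨n, hn, b, hb, rfl⟩

/-- `Q` is specified only by its values on the summands. Splitting off one summand at a time shows
that these values determine it on all of B' as the projection. -/
theorem sub_Q_mem (hD : D.IsDecomposition A k) {i : ℕ} (hi : i ≤ k + 1) (t : B') :
    t - D.Q i t ∈ D.Rsum A i ∧ D.Q i t ∈ D.Rc i := by
  induction i with
  | zero =>
    have : D.Q 0 t = t := hD.Q_of_mem_Rc 0 hi t (by simp [hD.Rc_zero])
    simp [this, hD.Rc_zero]
  | succ i ih =>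
    obtain ⟨h1, h2⟩ := ih (by omega)
    obtain ⟨n, hn, r, hr, hw⟩ := hD.exists_decomp (by omega : i ≤ k) h2
    have hS : D.S A i n ∈ D.R A (i + 1) := ⟨n, hD.Nc_le (by omega) hn, rfl⟩
    have h3 : t - D.Q i t + D.S A i n ∈ D.Rsum A (i + 1) :=
      add_mem (D.Rsum_mono A (by omega) h1) (D.R_le_Rsum A le_rfl hS)
    have h4 : t = (t - D.Q i t + D.S A i n) + r := by
      rw [add_assoc, ← hw]; abel
    have h5 : D.Q (i + 1) t = r := by
      rw [h4, map_add, hD.Q_of_mem_Rsum hi h3, hD.Q_of_mem_Rc _ hi r hr, zero_add]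
    rw [h5]
    refine ⟨?_, hr⟩
    have : t - r = t - D.Q i t + D.S A i n := by
      nth_rewrite 1 [h4]; abel
    rwa [this]

/-- The difference Q_i t - Q_{i+1} t is the R_{i+1}-component of t, and `E (i + 1)` recovers its
unique preimage in the complement. -/
theorem E_mem (hD : D.IsDecomposition A k) {i : ℕ} (hi : i ≤ k) (t : B') :
    D.E (i + 1) t ∈ D.Nc (i + 1) ∧ D.S A i (D.E (i + 1) t) = D.Q i t - D.Q (i + 1) t := by
  obtain ⟨h1, h2⟩ := hD.sub_Q_mem (by omega : i ≤ k + 1) t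
  obtain ⟨n, hn, r, hr, hw⟩ := hD.exists_decomp hi h2
  have hS : D.S A i n ∈ D.R A (i + 1) := ⟨n, hD.Nc_le hi hn, rfl⟩
  have h4 : t = (t - D.Q i t) + (D.S A i n + r) := by
    rw [← hw]; abel
  have hE : D.E (i + 1) t = n := by
    rw [h4, map_add, hD.E_of_mem_Rsum hi h1, map_add, hD.E_S i hi n hn,
      hD.E_of_mem_Rc i hi r hr]
    simp
  have h3 : t - D.Q i t + D.S A i n ∈ D.Rsum A (i + 1) :=
    add_mem (D.Rsum_mono A (by omega) h1) (D.R_le_Rsum A le_rfl hS)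
  have h5 : D.Q (i + 1) t = r := by
    rw [h4, ← add_assoc, map_add, hD.Q_of_mem_Rsum (by omega) h3,
      hD.Q_of_mem_Rc _ (by omega) r hr, zero_add]
  rw [hE, h5, hw]
  exact ⟨hn, by abel⟩

theorem sum_S_E (hD : D.IsDecomposition A k) {i : ℕ} (hi : i ≤ k + 1) (t : B') :
    ∑ j ∈ Finset.range i, D.S A j (D.E (j + 1) t) = t - D.Q i t := by
  induction i with
  | zero =>
    have : D.Q 0 t = t := hD.Q_of_mem_Rc 0 hi t (by simp [hD.Rc_zero])
    simp [this]
  | succ i ih =>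
    rw [Finset.sum_range_succ, ih (by omega), (hD.E_mem (by omega) t).2]
    abel

theorem Q_S (hD : D.IsDecomposition A k) {i : ℕ} (hi : i ≤ k) (n : B) :
    D.Q i (D.S A i n) = D.S A i n := by
  have : D.S A i n ∈ D.Rc i := by
    simp only [S, _root_.smul_apply, ContinuousLinearMap.comp_apply]
    exact Submodule.smul_mem _ _ (hD.sub_Q_mem (by omega) _).2
  exact hD.Q_of_mem_Rc i (by omega) _ this

end IsDecomposition

end Splitting

/-- The coefficients of the product of the power series `∑ εᵃ A a` and `∑ εᵇ v b`. -/
def conv (A : ℕ → B →L[K] B') (v : ℕ → B) (m : ℕ) : B' :=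
  ∑ a ∈ Finset.range (m + 1), A a (v (m - a))

/-- The coefficients of `ε ^ s` times the power series `∑ εᵇ v b`. -/
def shift (s : ℕ) (v : ℕ → B) (b : ℕ) : B := if s ≤ b then v (b - s) else 0

section Conv

variable (A : ℕ → B →L[K] B')

theorem conv_add (v w : ℕ → B) (m : ℕ) : conv A (v + w) m = conv A v m + conv A w m := by
  simp [conv, Finset.sum_add_distrib]

theorem conv_sub (v w : ℕ → B) (m : ℕ) : conv A (v - w) m = conv A v m - conv A w m := by
  simp [conv, Finset.sum_sub_distrib]

theorem conv_sum {ι : Type*} (s : Finset ι) (v : ι → ℕ → B) (m : ℕ) :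
    conv A (∑ j ∈ s, v j) m = ∑ j ∈ s, conv A (v j) m := by
  simp only [conv, Finset.sum_apply, map_sum]
  exact Finset.sum_comm

theorem conv_shift (s : ℕ) (v : ℕ → B) (m : ℕ) :
    conv A (shift s v) m = if s ≤ m then conv A v (m - s) else 0 := by
  split_ifs with h
  · simp only [conv, shift]
    have e : m + 1 = (m - s + 1) + s := by omega
    rw [e, Finset.sum_range_add]
    rw [Finset.sum_eq_zero (s := Finset.range s), add_zero]
    · refine Finset.sum_congr rfl fun a ha => ?_
      have := Finset.mem_range.1 ha
      rw [if_pos (by omega)]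
      congr 2
      omega
    · intro a ha
      have := Finset.mem_range.1 ha
      rw [if_neg (by omega), map_zero]
  · refine Finset.sum_eq_zero fun a ha => ?_
    rw [shift, if_neg (by omega), map_zero]

end Conv

/-! ### Continuation of a kernel vector to an approximate solution of the linear equation. -/

section Chain

variable (A : ℕ → B →L[K] B') (E : ℕ → B' →L[K] B)

theorem chain_zero_right (i : ℕ) : chain A E i 0 = ContinuousLinearMap.id K B := by
  induction i with
  | zero => simp [chain]
  | succ i ih =>
    rw [chain, ih, Finset.sum_eq_zero, sub_zero]
    intro j _
    rw [if_neg (by omega)]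

theorem chain_of_lt (i : ℕ) : ∀ b, i < b → chain A E i b = 0 := by
  induction i using Nat.strong_induction_on with
  | _ i ih =>
    intro b hb
    cases i with
    | zero => simp [chain, show b ≠ 0 by omega]
    | succ i =>
      rw [chain, ih i (by omega) b (by omega), Finset.sum_eq_zero, sub_zero]
      intro j _
      have := j.2
      rw [ih j (by omega) _ (by omega)]
      simp

/-- The polynomial continuation `∑ εᵇ chain A E i b n` of `n`. -/
noncomputable def chainSeq (i : ℕ) (n : B) (b : ℕ) : B := chain A E i b n

theorem chainSeq_zero (i : ℕ) (n : B) : chainSeq A E i n 0 = n := by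
  simp [chainSeq, chain_zero_right]

theorem conv_chainSeq_succ (i : ℕ) (n : B) :
    conv A (chainSeq A E i n) (i + 1) = chainTerm A E (i + 1) n := by
  rw [conv, Finset.sum_range_succ', chainTerm]
  simp only [chainSeq, Nat.sub_zero, chain_of_lt A E i (i + 1) (by omega),
    _root_.zero_apply, map_zero, add_zero, _root_.sum_apply,
    ContinuousLinearMap.comp_apply]
  rw [← Finset.sum_image (s := Finset.range (i + 1)) (g := fun a => a + 1)
    (f := fun a => A a (chain A E i (i + 1 - a) n)) (by intro a _ b _ h; simpa using h)]
  congr 1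
  ext a
  simp only [Finset.mem_image, Finset.mem_range, Finset.mem_Icc]
  constructor
  · rintro ⟨b, hb, rfl⟩; omega
  · intro h; exact ⟨a - 1, by omega, by omega⟩

/-- The recursion of `chain` in terms of power series: the corrections are themselves shorter
continuations, shifted so that their first nontrivial contribution falls on order i + 1. -/
theorem chainSeq_succ (i : ℕ) (n : B) :
    chainSeq A E (i + 1) n = chainSeq A E i n - ∑ j : Fin (i + 1),
      shift (i + 1 - j) (chainSeq A E j
        (kappa K j • E (j + 1) (conv A (chainSeq A E i n) (i + 1)))) := by
  ext b
  rw [conv_chainSeq_succ]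
  simp only [chainSeq, Pi.sub_apply, Finset.sum_apply, shift]
  rw [chain, _root_.sub_apply, _root_.sum_apply]
  congr 1
  refine Finset.sum_congr rfl fun j _ => ?_
  split_ifs
  · simp [chainTerm]
  · rfl

end Chain

namespace Splitting.IsDecomposition

variable {D : Splitting K B B'} {A : ℕ → B →L[K] B'} {k : ℕ}

/-- Strong induction, since the corrections use the continuations of all lower lengths. A shifted
continuation of κ_j E_{j+1} t contributes nothing below order i + 1 and exactly the
R_{j+1}-component of t at that order. Subtracting all of them leaves Q_{i+1} t, which is S up to the
factor κ. -/
theorem conv_chainSeq (hD : D.IsDecomposition A k) (i : ℕ) : i ≤ k → ∀ n ∈ D.N A i,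
    (∀ m < i, conv A (chainSeq A D.E i n) m = 0) ∧
    conv A (chainSeq A D.E i n) i = (kappa K i)⁻¹ • D.S A i n := by
  induction i using Nat.strong_induction_on with
  | _ i ih =>
    intro hi n hn
    cases i with
    | zero =>
      refine ⟨by intro m hm; omega, ?_⟩
      have hQ : D.Q 0 (A 0 n) = A 0 n := hD.Q_of_mem_Rc 0 (by omega) _ (by simp [hD.Rc_zero])
      simp [conv, chainSeq_zero, S, chainTerm, hQ, smul_smul,
        inv_mul_cancel₀ (kappa_ne_zero (K := K) 0)]
    | succ i =>
      obtain ⟨hn1, hn2⟩ := (D.mem_N_succ A).1 hn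
      obtain ⟨h1, h2⟩ := ih i (by omega) (by omega) n hn1
      rw [hn2, smul_zero] at h2
      have h3 : ∀ m < i + 1, conv A (chainSeq A D.E i n) m = 0 := by
        intro m hm
        rcases Nat.lt_succ_iff_lt_or_eq.1 hm with h | h
        · exact h1 m h
        · rw [h, h2]
      -- Since S_i n = 0, the old continuation already solves order i, so t at order i + 1 is the
      -- first term left to correct.
      set t := conv A (chainSeq A D.E i n) (i + 1) with ht
      have hE : ∀ j : Fin (i + 1), kappa K j • D.E (j + 1) t ∈ D.N A j := fun j =>
        Submodule.smul_mem _ _ (hD.Nc_le (by omega) (hD.E_mem (by omega) t).1)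
      have hj := fun j : Fin (i + 1) => ih j (by omega) (by omega) _ (hE j)
      rw [chainSeq_succ]
      simp only [conv_sub, conv_sum, conv_shift]
      constructor
      · intro m hm
        rw [h3 m hm, Finset.sum_eq_zero, sub_zero]
        intro j _
        split_ifs with h
        · exact (hj j).1 _ (by omega)
        · rfl
      · have : ∀ j : Fin (i + 1), (if i + 1 - (j : ℕ) ≤ i + 1 then
            conv A (chainSeq A D.E j (kappa K j • D.E (j + 1) t)) (i + 1 - (i + 1 - j))
            else 0) = D.S A j (D.E (j + 1) t) := by
          intro j
          rw [if_pos (by omega), show i + 1 - (i + 1 - (j : ℕ)) = j by omega, (hj j).2,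
            map_smul, smul_smul, inv_mul_cancel₀ (kappa_ne_zero (K := K) _), one_smul]
        rw [Finset.sum_congr rfl fun j _ => this j,
          Fin.sum_univ_eq_sum_range (fun j => D.S A j (D.E (j + 1) t)) (i + 1),
          hD.sum_S_E (by omega), ← ht, sub_sub_cancel, ht, conv_chainSeq_succ]
        simp [S, smul_smul, inv_mul_cancel₀ (kappa_ne_zero (K := K) _)]

/-- The leading coefficient of an approximate solution of the linearized equation. -/
theorem leading_mem (hD : D.IsDecomposition A k) (i : ℕ) :
    i ≤ k + 1 → ∀ v : ℕ → B, (∀ m < i, conv A v m = 0) →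
    v 0 ∈ D.N A i ∧ (i ≤ k → D.Q i (conv A v i) = (kappa K i)⁻¹ • D.S A i (v 0)) := by
  induction i with
  | zero =>
    intro _ v _
    have hQ : D.Q 0 (A 0 (v 0)) = A 0 (v 0) :=
      hD.Q_of_mem_Rc 0 (by omega) _ (by simp [hD.Rc_zero])
    refine ⟨by simp [N], fun _ => ?_⟩
    simp [conv, S, chainTerm, hQ, smul_smul, inv_mul_cancel₀ (kappa_ne_zero (K := K) 0)]
  | succ i ih =>
    intro hi v hv
    obtain ⟨h1, h2⟩ := ih (by omega) v fun m hm => hv m (by omega)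
    have h3 := h2 (by omega)
    rw [hv i (by omega), map_zero] at h3
    have h4 : D.S A i (v 0) = 0 := by
      rcases smul_eq_zero.1 h3.symm with h | h
      · exact absurd h (inv_ne_zero (kappa_ne_zero i))
      · exact h
    have h5 : v 0 ∈ D.N A (i + 1) := (D.mem_N_succ A).2 ⟨h1, h4⟩
    refine ⟨h5, fun hik => ?_⟩
    obtain ⟨c1, c2⟩ := hD.conv_chainSeq (i + 1) hik (v 0) h5
    -- The canonical continuation has the same leading coefficient as v, so the difference is
    -- divisible by ε, with quotient w. This w is an approximate solution of one order less.
    let w : ℕ → B := fun b => v (b + 1) - chainSeq A D.E (i + 1) (v 0) (b + 1)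
    have hw : v = chainSeq A D.E (i + 1) (v 0) + shift 1 w := by
      ext b
      cases b with
      | zero => simp [chainSeq_zero, shift]
      | succ b => simp [shift, w]
    have hcw : ∀ m, conv A v (m + 1) =
        conv A (chainSeq A D.E (i + 1) (v 0)) (m + 1) + conv A w m := by
      intro m
      nth_rewrite 1 [hw]
      rw [conv_add, conv_shift, if_pos (by omega), Nat.add_sub_cancel]
    have hw0 : ∀ m < i, conv A w m = 0 := by
      intro m hm
      have := hcw m
      rwa [hv _ (by omega), c1 _ (by omega), zero_add, eq_comm] at this
    obtain ⟨d1, d2⟩ := ih (by omega) w hw0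
    have d3 := d2 (by omega)
    -- By induction the contribution of w lies in R₁ ⊕ ⋯ ⊕ R_{i+1}, so Q_{i+1} does not see how v₀
    -- was continued.
    have d4 : D.Q (i + 1) (conv A w i) = 0 := by
      refine hD.Q_of_mem_Rsum hi ?_
      have e : conv A w i = (conv A w i - D.Q i (conv A w i)) + D.Q i (conv A w i) := by abel
      rw [e]
      refine add_mem (D.Rsum_mono A (by omega) (hD.sub_Q_mem (by omega) _).1) ?_
      rw [d3]
      exact Submodule.smul_mem _ _ (D.R_le_Rsum A le_rfl ⟨w 0, d1, rfl⟩)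
    rw [hcw, map_add, d4, add_zero, c2, map_smul, hD.Q_S hik]

end Splitting.IsDecomposition

end LinearAlgebra

/-! ### The coefficient tuple (z_{2k+1}, …, z_{k+1}) read as a power series. -/

section Coordinates

variable {K : Type*} [RCLike K]
variable {B : Type*} [NormedAddCommGroup B] [NormedSpace K B]
variable {B' : Type*} [NormedAddCommGroup B'] [NormedSpace K B']

/-- The coefficients of `z_{k+1} / (k+1)! + ε z_{k+2} / (k+2)! + ⋯ + εᵏ z_{2k+1} / (2k+1)!` for
`y = (z_{2k+1}, …, z_{k+1})`. -/
noncomputable def relCoeff (K : Type*) [RCLike K] [NormedSpace K B] {k : ℕ}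
    (y : Fin (k + 1) → B) (b : ℕ) : B :=
  if b ≤ k then ((k + 1 + b)! : K)⁻¹ • y ⟨k - b, by omega⟩ else 0

theorem relCoeff_add {k : ℕ} (y y' : Fin (k + 1) → B) :
    relCoeff K (y + y') = relCoeff K y + relCoeff K y' := by
  ext b
  simp only [relCoeff, Pi.add_apply]
  split_ifs <;> simp

theorem relCoeff_sub {k : ℕ} (y y' : Fin (k + 1) → B) :
    relCoeff K (y - y') = relCoeff K y - relCoeff K y' := by
  ext b
  simp only [relCoeff, Pi.sub_apply]
  split_ifs <;> simp [smul_sub]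

theorem factorial_ne_zero' (n : ℕ) : (n ! : K) ≠ 0 := by exact_mod_cast Nat.factorial_ne_zero n

/-- The coefficient of order `m` of the linearized equation, as an operator on `B^{k+1}`. -/
noncomputable def convCLM (A : ℕ → B →L[K] B') (k m : ℕ) : (Fin (k + 1) → B) →L[K] B' :=
  ∑ a ∈ Finset.range (m + 1), (A a) ∘L
    (if h : m - a ≤ k then ((k + 1 + (m - a))! : K)⁻¹ •
      (ContinuousLinearMap.proj ⟨k - (m - a), by omega⟩ : (Fin (k + 1) → B) →L[K] B)
    else 0)

theorem convCLM_apply (A : ℕ → B →L[K] B') (k m : ℕ) (y : Fin (k + 1) → B) :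
    convCLM A k m y = conv A (relCoeff K y) m := by
  simp only [convCLM, _root_.sum_apply, ContinuousLinearMap.comp_apply, conv, relCoeff]
  refine Finset.sum_congr rfl fun a _ => ?_
  split_ifs <;> simp

theorem relCoeff_eq_shift {k : ℕ} (y : Fin (k + 1) → B) (i : Fin (k + 1))
    (h : ∀ j, i < j → y j = 0) :
    relCoeff K y = shift (k - i) (fun b => relCoeff K y (b + (k - i))) := by
  ext b
  simp only [shift]
  split_ifs with hb
  · congr 1; omega
  · simp only [relCoeff]
    split_ifs with hb'
    · rw [h, smul_zero]
      rw [Fin.lt_def]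
      simp only
      omega
    · rfl

/-- The last nonzero entry y_i is the leading coefficient of the series, which starts at order k -
i. Of the k + s vanishing orders, i + s remain after division by that power, and `leading_mem`
applies. The cases s = 0 and s = 1 correspond to X_{2k} and X_{2k+1}. -/
theorem apply_mem_N {D : Splitting K B B'} {A : ℕ → B →L[K] B'} {k : ℕ}
    (hD : D.IsDecomposition A k) {s : ℕ} (hs : s ≤ 1) {y : Fin (k + 1) → B}
    (hy : ∀ m < k + s, conv A (relCoeff K y) m = 0) (i : Fin (k + 1))
    (h : ∀ j, i < j → y j = 0) : y i ∈ D.N A (i + s) := by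
  have h1 : ∀ m < (i : ℕ) + s, conv A (fun b => relCoeff K y (b + (k - i))) m = 0 := by
    intro m hm
    have := hy (m + (k - i)) (by omega)
    rwa [relCoeff_eq_shift y i h, conv_shift, if_pos (by omega), Nat.add_sub_cancel] at this
  have h2 := (hD.leading_mem (i + s) (by omega) _ h1).1
  have h3 : relCoeff K y (0 + (k - i)) = ((k + 1 + (k - i))! : K)⁻¹ • y i := by
    rw [relCoeff, if_pos (by omega)]
    congr 2
    · congr 2; omega
    · ext; simp only; omega
  rw [h3] at h2
  have := Submodule.smul_mem _ ((k + 1 + (k - i))! : K) h2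
  rwa [smul_smul, mul_inv_cancel₀ (factorial_ne_zero' _), one_smul] at this

end Coordinates

/-! ### Block upper triangular operators and their inverses. -/

section Triangular

variable {K : Type*} [RCLike K]
variable {B : Type*} [NormedAddCommGroup B] [NormedSpace K B]

/-- Upper triangularity with given diagonal. -/
def UpperTriangular {k : ℕ} (c : Fin (k + 1) → K) (M : (Fin (k + 1) → B) →L[K] (Fin (k + 1) → B)) :
    Prop :=
  ∀ (i : Fin (k + 1)) (x : Fin (k + 1) → B), (∀ j, i < j → x j = 0) → M x i = c i • x i

namespace UpperTriangular

variable {k : ℕ} {c : Fin (k + 1) → K} {M : (Fin (k + 1) → B) →L[K] (Fin (k + 1) → B)}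

theorem apply_eq_zero (hM : UpperTriangular c M) {x : Fin (k + 1) → B} {i : Fin (k + 1)}
    (h : ∀ j, i < j → x j = 0) {j : Fin (k + 1)} (hj : i < j) : M x j = 0 := by
  rw [hM j x fun j' hj' => h j' (hj.trans hj'), h j hj, smul_zero]

theorem apply_single (hM : UpperTriangular c M) (i : Fin (k + 1)) (b : B) :
    M (Pi.single i b) i = c i • b := by
  rw [hM i _ fun j hj => by simp [hj.ne']]
  simp

theorem apply_single_of_lt (hM : UpperTriangular c M) {i j : Fin (k + 1)} (h : i < j) (b : B) :
    M (Pi.single i b) j = 0 :=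
  hM.apply_eq_zero (i := i) (fun j hj => by simp [hj.ne']) h

theorem eq_zero_of_apply_eq_zero (hM : UpperTriangular c M) (hc : ∀ i, c i ≠ 0)
    {x : Fin (k + 1) → B} (hx : M x = 0) : x = 0 := by
  ext i
  induction i using WellFoundedGT.induction with
  | _ i ih =>
    have := hM i x ih
    rw [hx] at this
    exact (smul_eq_zero.1 this.symm).resolve_left (hc i)

theorem exists_apply_eq (hM : UpperTriangular c M) (hc : ∀ i, c i ≠ 0) (s : ℕ) :
    ∀ y : Fin (k + 1) → B, (∀ j : Fin (k + 1), s ≤ j → y j = 0) → ∃ x, M x = y := by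
  induction s with
  | zero => exact fun y hy => ⟨0, by rw [map_zero]; ext j; exact (hy j (by omega)).symm⟩
  | succ s ih =>
    intro y hy
    by_cases hs : s < k + 1
    · let i : Fin (k + 1) := ⟨s, hs⟩
      obtain ⟨x, hx⟩ := ih (y - M (Pi.single i ((c i)⁻¹ • y i))) fun j hj => by
        rcases (show i ≤ j from hj).eq_or_lt with rfl | h
        · rw [Pi.sub_apply, hM.apply_single, smul_smul, mul_inv_cancel₀ (hc _), one_smul, sub_self]
        · rw [Pi.sub_apply, hM.apply_single_of_lt h, sub_zero]
          exact hy j (Fin.lt_def.1 h)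
      exact ⟨x + Pi.single i ((c i)⁻¹ • y i), by rw [map_add, hx]; abel⟩
    · exact ih y fun j hj => absurd j.2 (by omega)

/-- The inverse of an upper triangular operator, by the open mapping theorem. -/
noncomputable def equiv [CompleteSpace B] (hM : UpperTriangular c M) (hc : ∀ i, c i ≠ 0) :
    (Fin (k + 1) → B) ≃L[K] (Fin (k + 1) → B) :=
  ContinuousLinearEquiv.ofBijective M
    (LinearMap.ker_eq_bot'.2 fun _ hx => hM.eq_zero_of_apply_eq_zero hc hx)
    (LinearMap.range_eq_top.2 fun y => hM.exists_apply_eq hc (k + 1) y fun j hj =>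
      absurd j.2 (by omega))

theorem equiv_apply [CompleteSpace B] (hM : UpperTriangular c M) (hc : ∀ i, c i ≠ 0)
    (x : Fin (k + 1) → B) : hM.equiv hc x = M x := rfl

end UpperTriangular

end Triangular

/-! ### All continuations assembled into one triangular operator on B^{k+1}. -/

section Chain

variable {K : Type*} [RCLike K]
variable {B : Type*} [NormedAddCommGroup B] [NormedSpace K B]
variable {B' : Type*} [NormedAddCommGroup B'] [NormedSpace K B']

/-- The operator with `j`-th column given by the continuation `ε^{k-j} ∑ εᵇ chain A E j b`. -/
noncomputable def chainOp (A : ℕ → B →L[K] B') (E : ℕ → B' →L[K] B) (k : ℕ) :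
    (Fin (k + 1) → B) →L[K] (Fin (k + 1) → B) :=
  ContinuousLinearMap.pi fun i : Fin (k + 1) => ((2 * k + 1 - i)! : K) •
    ∑ j : Fin (k + 1), if i ≤ j then (chain A E j (j - i)) ∘L
      (ContinuousLinearMap.proj j : (Fin (k + 1) → B) →L[K] B) else 0

theorem chainOp_apply (A : ℕ → B →L[K] B') (E : ℕ → B' →L[K] B) (k : ℕ)
    (x : Fin (k + 1) → B) (i : Fin (k + 1)) : chainOp A E k x i = ((2 * k + 1 - i)! : K) •
      ∑ j : Fin (k + 1), if i ≤ j then chain A E j (j - i) (x j) else 0 := by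
  simp only [chainOp, ContinuousLinearMap.coe_pi', _root_.smul_apply, _root_.sum_apply]
  congr 1
  refine Finset.sum_congr rfl fun j _ => ?_
  split_ifs <;> simp

theorem upperTriangular_chainOp (A : ℕ → B →L[K] B') (E : ℕ → B' →L[K] B) (k : ℕ) :
    UpperTriangular (fun i : Fin (k + 1) => ((2 * k + 1 - i)! : K)) (chainOp A E k) := by
  intro i x hx
  rw [chainOp_apply, Finset.sum_eq_single i]
  · simp [chain_zero_right]
  · intro j _ hj
    split_ifs with h
    · rw [hx j (lt_of_le_of_ne h (Ne.symm hj)), map_zero]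
    · rfl
  · simp

/-- The factorials on the rows of `chainOp` cancel those of `relCoeff`. Column j then starts at
order k - j, so that its first uncorrected term falls on order k for every j. -/
theorem relCoeff_chainOp (A : ℕ → B →L[K] B') (E : ℕ → B' →L[K] B) (k : ℕ)
    (x : Fin (k + 1) → B) : relCoeff K (chainOp A E k x) =
      ∑ j : Fin (k + 1), shift (k - j) (chainSeq A E j (x j)) := by
  ext b
  rw [Finset.sum_apply, relCoeff]
  split_ifs with hb
  · rw [chainOp_apply]
    simp only
    rw [show 2 * k + 1 - (k - b) = k + 1 + b by omega, smul_smul,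
      inv_mul_cancel₀ (factorial_ne_zero' _), one_smul]
    refine Finset.sum_congr rfl fun j _ => ?_
    simp only [shift, chainSeq, Fin.le_def]
    by_cases h : k - b ≤ j
    · rw [if_pos h, if_pos (by omega)]
      congr 2; omega
    · rw [if_neg h, if_neg (by omega)]
  · symm
    refine Finset.sum_eq_zero fun j _ => ?_
    rw [shift, if_pos (by omega), chainSeq, chain_of_lt _ _ _ _ (by omega)]
    rfl

variable {D : Splitting K B B'} {A : ℕ → B →L[K] B'} {k : ℕ}

theorem conv_chainOp_of_lt (hD : D.IsDecomposition A k) {x : Fin (k + 1) → B}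
    (hx : ∀ j : Fin (k + 1), x j ∈ D.N A j) {m : ℕ} (hm : m < k) :
    conv A (relCoeff K (chainOp A D.E k x)) m = 0 := by
  rw [relCoeff_chainOp, conv_sum]
  refine Finset.sum_eq_zero fun j _ => ?_
  rw [conv_shift]
  split_ifs with h
  · exact (hD.conv_chainSeq j (by omega) _ (hx j)).1 _ (by omega)
  · rfl

theorem conv_chainOp (hD : D.IsDecomposition A k) {x : Fin (k + 1) → B}
    (hx : ∀ j : Fin (k + 1), x j ∈ D.N A j) :
    conv A (relCoeff K (chainOp A D.E k x)) k =
      ∑ j : Fin (k + 1), (kappa K j)⁻¹ • D.S A j (x j) := by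
  rw [relCoeff_chainOp, conv_sum]
  refine Finset.sum_congr rfl fun j _ => ?_
  rw [conv_shift, if_pos (by omega), show k - (k - (j : ℕ)) = j by omega]
  exact (hD.conv_chainSeq j (by omega) _ (hx j)).2

/-- Multiplying the j-th entry by κ_j cancels the factor in `conv_chainOp`, so the order k term
becomes the sum operator itself, which is onto by hypothesis. -/
theorem exists_conv_eq (hD : D.IsDecomposition A k) (hS : D.SumSurjective A k) (w : B') :
    ∃ y : Fin (k + 1) → B, (∀ m < k, conv A (relCoeff K y) m = 0) ∧
      conv A (relCoeff K y) k = w := by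
  obtain ⟨n, hn, hw⟩ := hS w
  have hx : ∀ j : Fin (k + 1), kappa K j • n j ∈ D.N A j := fun j =>
    Submodule.smul_mem _ _ (hn j)
  refine ⟨chainOp A D.E k fun j => kappa K j • n j, fun m hm => conv_chainOp_of_lt hD hx hm, ?_⟩
  rw [conv_chainOp hD hx, ← hw]
  refine Finset.sum_congr rfl fun j _ => ?_
  rw [map_smul, smul_smul, inv_mul_cancel₀ (kappa_ne_zero (K := K) _), one_smul]

end Chain

/-! ### Isomorphism property of the order k term on the product of the complements. -/

section Adapted

variable {K : Type*} [RCLike K]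
variable {B : Type*} [NormedAddCommGroup B] [NormedSpace K B]
variable {B' : Type*} [NormedAddCommGroup B'] [NormedSpace K B']
variable {D : Splitting K B B'} {A : ℕ → B →L[K] B'} {k : ℕ}

theorem Splitting.mem_complProd {x : Fin (k + 1) → B} :
    x ∈ D.complProd k ↔ ∀ i : Fin (k + 1), x i ∈ D.Nc (i + 1) := by
  simp [complProd, Submodule.mem_pi]

theorem Splitting.mem_kerProd {x : Fin (k + 1) → B} :
    x ∈ D.kerProd A k ↔ ∀ i : Fin (k + 1), x i ∈ D.N A (i + 1) := by
  simp [kerProd, Submodule.mem_pi]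

/-- `M` and `M L` map `∏ Nᵢᶜ` and `∏ Nᵢ` to approximate solutions of the linearized equation. -/
structure Adapted (D : Splitting K B B') (A : ℕ → B →L[K] B') (k : ℕ)
    (M L : (Fin (k + 1) → B) ≃L[K] (Fin (k + 1) → B)) : Prop where
  triangular_M : IsTriangular M
  triangular_L : IsTriangular L
  conv_compl : ∀ x ∈ D.complProd k, ∀ m < k, conv A (relCoeff K (M x)) m = 0
  conv_ker : ∀ n ∈ D.kerProd A k, ∀ m < k + 1, conv A (relCoeff K (M (L n))) m = 0

namespace Adapted

variable {M L : (Fin (k + 1) → B) ≃L[K] (Fin (k + 1) → B)}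

/-- Adapted parametrizations exhaust the approximate solutions. The top entry lies in N_i = N_{i+1}ᶜ
⊕ N_{i+1} by `apply_mem_N`. Its two parts prescribe one entry of x and one of n, and subtracting
their images leaves an approximate solution with one entry less. -/
theorem exists_eq (h : Adapted D A k M L) (hD : D.IsDecomposition A k) (s : ℕ) :
    ∀ y : Fin (k + 1) → B, (∀ m < k, conv A (relCoeff K y) m = 0) →
    (∀ j : Fin (k + 1), s ≤ j → y j = 0) →
    ∃ x ∈ D.complProd k, ∃ n ∈ D.kerProd A k, y = M (x + L n) := by
  obtain ⟨c, hc, hM⟩ := h.triangular_M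
  obtain ⟨d, hd, hL⟩ := h.triangular_L
  have hM' : UpperTriangular c (M : (Fin (k + 1) → B) →L[K] (Fin (k + 1) → B)) := hM
  have hL' : UpperTriangular d (L : (Fin (k + 1) → B) →L[K] (Fin (k + 1) → B)) := hL
  induction s with
  | zero =>
    intro y _ hy
    refine ⟨0, zero_mem _, 0, zero_mem _, ?_⟩
    ext j
    simp [hy j (by omega)]
  | succ s ih =>
    intro y hy0 hy
    by_cases hs : s < k + 1
    · let i : Fin (k + 1) := ⟨s, hs⟩
      have hi : y i ∈ D.N A (i + 0) := apply_mem_N hD (s := 0) (by omega)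
        (by simpa using hy0) i fun j hj => hy j (Fin.lt_def.1 hj)
      have hi' := Submodule.smul_mem _ (c i)⁻¹ hi
      rw [add_zero, ← hD.sup_N i (by omega)] at hi'
      obtain ⟨a, ha, b, hb, hab⟩ := Submodule.mem_sup.1 hi'
      have hx1 : Pi.single i a ∈ D.complProd k := Splitting.mem_complProd.2 fun j => by
        by_cases hj : j = i
        · subst hj; simpa using ha
        · simp [hj]
      have hn1 : Pi.single i ((d i)⁻¹ • b) ∈ D.kerProd A k := Splitting.mem_kerProd.2 fun j => by
        by_cases hj : j = i
        · subst hj; simpa using Submodule.smul_mem _ _ hb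
        · simp [hj]
      -- The factors (c i)⁻¹ and (d i)⁻¹ compensate the diagonals of M and L, so that M v has the
      -- same i-th entry as y and zeros above it.
      set v := Pi.single i a + L (Pi.single i ((d i)⁻¹ • b)) with hv
      have hvj : ∀ j, i < j → v j = 0 := fun j hj => by
        rw [hv, Pi.add_apply]
        erw [hL'.apply_single_of_lt hj]
        simp [hj.ne']
      have hvi : v i = (c i)⁻¹ • y i := by
        rw [hv, Pi.add_apply]
        erw [hL'.apply_single i]
        rw [smul_smul, mul_inv_cancel₀ (hd _), one_smul, Pi.single_eq_same, hab]
      obtain ⟨x, hx, n, hn, hxn⟩ := ih (y - M v) (fun m hm => by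
          rw [relCoeff_sub, conv_sub, hy0 m hm, hv, map_add, relCoeff_add, conv_add,
            h.conv_compl _ hx1 m hm, h.conv_ker _ hn1 m (by omega)]
          simp) fun j hj => by
        rcases (show i ≤ j from hj).eq_or_lt with rfl | hlt
        · rw [Pi.sub_apply, hM i v hvj, hvi, smul_smul, mul_inv_cancel₀ (hc _), one_smul,
            sub_self]
        · have : M v j = 0 := hM'.apply_eq_zero hvj hlt
          rw [Pi.sub_apply, this, sub_zero]
          exact hy j (Fin.lt_def.1 hlt)
      refine ⟨x + Pi.single i a, add_mem hx hx1, n + Pi.single i ((d i)⁻¹ • b),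
        add_mem hn hn1, ?_⟩
      rw [sub_eq_iff_eq_add, hv, ← map_add] at hxn
      rw [hxn, map_add L]
      congr 1
      abel
    · exact ih y hy0 fun j hj => absurd j.2 (by omega)

/-- From the top entry downwards: once the higher entries vanish, (M x)_i = c_i x_i lies in N_{i+1}
by one more vanishing order, while x_i lies in the complement of N_{i+1}. -/
theorem eq_zero_of_conv (h : Adapted D A k M L) (hD : D.IsDecomposition A k)
    {x : Fin (k + 1) → B} (hx : x ∈ D.complProd k)
    (hk : conv A (relCoeff K (M x)) k = 0) : x = 0 := by
  obtain ⟨c, hc, hM⟩ := h.triangular_M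
  have hM' : UpperTriangular c (M : (Fin (k + 1) → B) →L[K] (Fin (k + 1) → B)) := hM
  have h0 : ∀ m < k + 1, conv A (relCoeff K (M x)) m = 0 := fun m hm => by
    rcases Nat.lt_succ_iff_lt_or_eq.1 hm with h' | rfl
    · exact h.conv_compl x hx m h'
    · exact hk
  ext i
  induction i using WellFoundedGT.induction with
  | _ i ih =>
    have h1 : M x i ∈ D.N A (i + 1) := apply_mem_N hD le_rfl h0 i fun j hj =>
      hM'.apply_eq_zero ih hj
    rw [hM i x ih] at h1
    have h2 := Submodule.smul_mem _ (c i)⁻¹ h1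
    rw [smul_smul, inv_mul_cancel₀ (hc i), one_smul] at h2
    exact Submodule.disjoint_def.1 (hD.disjoint_N i (by omega)) _
      (Splitting.mem_complProd.1 hx i) h2

theorem isClosed_complProd (hD : D.IsDecomposition A k) :
    IsClosed (D.complProd k : Set (Fin (k + 1) → B)) := by
  have : (D.complProd k : Set (Fin (k + 1) → B)) =
      Set.univ.pi fun i : Fin (k + 1) => (D.Nc (i + 1) : Set B) := by
    ext x; simp [Splitting.mem_complProd]
  rw [this]
  exact isClosed_set_pi fun i _ => hD.isClosed_Nc i (by omega)

theorem isClosed_kerProd (D : Splitting K B B') (A : ℕ → B →L[K] B') (k : ℕ) :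
    IsClosed (D.kerProd A k : Set (Fin (k + 1) → B)) := by
  have : (D.kerProd A k : Set (Fin (k + 1) → B)) =
      Set.univ.pi fun i : Fin (k + 1) => (D.N A (i + 1) : Set B) := by
    ext x; simp [Splitting.mem_kerProd]
  rw [this]
  exact isClosed_set_pi fun i _ => D.isClosed_N A _

/-- The leading part of the remaining equation, as an isomorphism `∏ Nᵢᶜ ≃ B'`. -/
theorem exists_equiv [CompleteSpace B] [CompleteSpace B'] (h : Adapted D A k M L)
    (hD : D.IsDecomposition A k)
    (hS : D.SumSurjective A k) : ∃ Λ : D.complProd k ≃L[K] B',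
      ∀ x : D.complProd k, Λ x = conv A (relCoeff K (M x)) k := by
  have : CompleteSpace (D.complProd k) := (isClosed_complProd hD).completeSpace_coe
  let f : D.complProd k →L[K] B' := (convCLM A k k) ∘L
    (M : (Fin (k + 1) → B) →L[K] (Fin (k + 1) → B)) ∘L (D.complProd k).subtypeL
  have hf : ∀ x, f x = conv A (relCoeff K (M x)) k := fun x => convCLM_apply A k k _
  refine ⟨ContinuousLinearEquiv.ofBijective f (LinearMap.ker_eq_bot'.2 fun x hx => ?_)
    (LinearMap.range_eq_top.2 fun w => ?_), hf⟩
  · exact Subtype.ext (h.eq_zero_of_conv hD x.2 ((hf x).symm.trans hx))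
  -- Any preimage of w has the form M (x + L n), and the part M (L n) contributes nothing at order
  -- k.
  · obtain ⟨y, hy0, hyk⟩ := exists_conv_eq hD hS w
    obtain ⟨x, hx, n, hn, rfl⟩ := h.exists_eq hD (k + 1) y hy0 fun j hj => absurd j.2 (by omega)
    refine ⟨⟨x, hx⟩, (hf _).trans ?_⟩
    rw [map_add, relCoeff_add, conv_add, h.conv_ker n hn k (by omega), add_zero] at hyk
    exact hyk

end Adapted

end Adapted

/-! ### Polynomial arcs and membership in X_n as an order of vanishing. -/

section Expansion

variable {K : Type*} [RCLike K]
variable {B : Type*} [NormedAddCommGroup B] [NormedSpace K B]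
variable {B' : Type*} [NormedAddCommGroup B'] [NormedSpace K B']

/-- `y ↦ relCoeff K y b` as an operator. -/
noncomputable def relCLM (K B : Type*) [RCLike K] [NormedAddCommGroup B] [NormedSpace K B]
    (k b : ℕ) : (Fin (k + 1) → B) →L[K] B :=
  if b ≤ k then ((k + 1 + b)! : K)⁻¹ •
    (ContinuousLinearMap.proj ⟨k - b, by omega⟩ : (Fin (k + 1) → B) →L[K] B) else 0

theorem relCLM_apply (k b : ℕ) (y : Fin (k + 1) → B) : relCLM K B k b y = relCoeff K y b := by
  simp only [relCLM, relCoeff]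
  split_ifs <;> simp

/-- `y ↦ z_{k+1} / (k+1)! + ε z_{k+2} / (k+2)! + ⋯ + εᵏ z_{2k+1} / (2k+1)!`. -/
noncomputable def ev (B : Type*) [NormedAddCommGroup B] [NormedSpace K B] (k : ℕ) (ε : K) :
    (Fin (k + 1) → B) →L[K] B :=
  ∑ b ∈ Finset.range (k + 1), ε ^ b • relCLM K B k b

theorem ev_apply (k : ℕ) (ε : K) (y : Fin (k + 1) → B) :
    ev B k ε y = ∑ b ∈ Finset.range (k + 1), ε ^ b • relCoeff K y b := by
  simp [ev, relCLM_apply]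

theorem contDiff_ev (k : ℕ) {n : WithTop ℕ∞} : ContDiff K n (fun ε : K => ev B k ε) := by
  unfold ev; fun_prop

theorem norm_ev_le (k : ℕ) : ∃ C ≥ 0, ∀ ε : K, ‖ε‖ ≤ 1 → ‖ev B k ε‖ ≤ C := by
  refine ⟨∑ b ∈ Finset.range (k + 1), ‖relCLM K B k b‖, by positivity, fun ε hε => ?_⟩
  refine (norm_sum_le _ _).trans (Finset.sum_le_sum fun b _ => ?_)
  rw [norm_smul, norm_pow]
  exact mul_le_of_le_one_left (norm_nonneg _) (pow_le_one₀ (norm_nonneg _) hε)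

theorem analyticAt_arc (z : ℕ → B) (n : ℕ) (ε : K) : AnalyticAt K (arc (K := K) z n) ε := by
  unfold arc
  refine Finset.analyticAt_fun_sum _ fun i _ => ?_
  fun_prop

theorem arc_zero (z : ℕ → B) (n : ℕ) : arc z n (0 : K) = 0 := by
  refine Finset.sum_eq_zero fun j hj => ?_
  have := (Finset.mem_Icc.1 hj).1
  simp [show j ≠ 0 by omega]

theorem arc_congr {z z' : ℕ → B} {n : ℕ} (h : ∀ j ∈ Finset.Icc 1 n, z j = z' j) (ε : K) :
    arc z n ε = arc z' n ε :=
  Finset.sum_congr rfl fun j hj => by rw [h j hj]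

theorem arc_coeffSeq (zbar : ℕ → B) (k : ℕ) (y : Fin (k + 1) → B) (ε : K) :
    arc (coeffSeq zbar k y) (2 * k + 1) ε = arc zbar k ε + ε ^ (k + 1) • ev B k ε y := by
  have hI : ∀ n, Finset.Icc 1 n = Finset.Ico 1 (n + 1) := fun n => by ext; simp
  rw [arc, hI, ← Finset.sum_Ico_consecutive _ (by omega : 1 ≤ k + 1) (by omega), ← hI]
  congr 1
  · refine Finset.sum_congr rfl fun j hj => ?_
    rw [coeffSeq, if_pos (Finset.mem_Icc.1 hj).2]
  · rw [Finset.sum_Ico_eq_sum_range, ev_apply, Finset.smul_sum,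
      show 2 * k + 1 + 1 - (k + 1) = k + 1 by omega]
    refine Finset.sum_congr rfl fun b hb => ?_
    have := Finset.mem_range.1 hb
    rw [coeffSeq, if_neg (by omega), dif_pos (by omega), relCoeff, if_pos (by omega),
      smul_smul, smul_smul, pow_add, div_eq_mul_inv]
    congr 2
    ext; simp only; omega

theorem analyticAt_comp_arc {G : B → B'} (hG : AnalyticAt K G 0) (z : ℕ → B) (n : ℕ) :
    AnalyticAt K (fun ε : K => G (arc z n ε)) 0 := by
  refine AnalyticAt.fun_comp (g := G) (f := arc z n) ?_ (analyticAt_arc z n 0)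
  rwa [arc_zero]

theorem isBigO_arc_sub (z : ℕ → B) {i n : ℕ} (h : i ≤ n) :
    (fun ε : K => arc z n ε - arc z i ε) =O[𝓝[≠] 0] (fun ε => ε ^ (i + 1)) := by
  have : ∀ ε : K, arc z n ε - arc z i ε =
      ∑ j ∈ Finset.Icc 1 n \ Finset.Icc 1 i, (ε ^ j / (j ! : K)) • z j := fun ε => by
    rw [sub_eq_iff_eq_add, arc, arc]
    exact (Finset.sum_sdiff (Finset.Icc_subset_Icc_right h)).symm
  simp_rw [this]
  refine IsBigO.fun_sum fun j hj => ?_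
  simp only [Finset.mem_sdiff, Finset.mem_Icc] at hj
  refine isBigO_pow_of_le nhdsWithin_le_nhds (n := j) (by omega) ?_
  refine IsBigO.of_bound (‖((j ! : K))⁻¹‖ * ‖z j‖) (Eventually.of_forall fun ε => ?_)
  rw [norm_smul, div_eq_mul_inv, norm_mul]
  exact le_of_eq (by ring)

variable [CompleteSpace B']

/-- Terms of the arc beyond order i change G only by O(ε^(i+1)), since G is Lipschitz near 0. Thus
all coefficients can be read off from a single arc. -/
theorem T_eq_iteratedDeriv {G : B → B'} (hG : AnalyticAt K G 0) (z : ℕ → B) {i n : ℕ}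
    (h : i ≤ n) : T (K := K) G z i = iteratedDeriv i (fun ε : K => G (arc z n ε)) 0 := by
  have a1 := analyticAt_comp_arc hG z n
  have a2 := analyticAt_comp_arc hG z i
  have hO : (fun ε : K => G (arc z n ε) - G (arc z i ε)) =O[𝓝[≠] 0] (fun ε => ε ^ (i + 1)) := by
    have h1 := (hG.contDiffAt (n := 1)).hasStrictFDerivAt one_ne_zero |>.isBigO_sub
    have h2 : Tendsto (fun ε : K => (arc z n ε, arc z i ε)) (𝓝[≠] 0) (𝓝 ((0 : B), (0 : B))) := by
      have c1 := (analyticAt_arc z n (0 : K)).continuousAt.tendsto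
      have c2 := (analyticAt_arc z i (0 : K)).continuousAt.tendsto
      rw [arc_zero] at c1 c2
      exact (c1.prodMk_nhds c2).mono_left nhdsWithin_le_nhds
    exact (h1.comp_tendsto h2).trans (isBigO_arc_sub z h)
  have := (isBigO_pow_iff (a1.fun_sub a2) (i + 1)).1 hO i (by omega)
  rw [iteratedDeriv_fun_sub a1.contDiffAt a2.contDiffAt, sub_eq_zero] at this
  exact this.symm

theorem memX_iff {G : B → B'} (hG : AnalyticAt K G 0) (hG0 : G 0 = 0) (z : ℕ → B) {n N : ℕ}
    (h : n ≤ N) : MemX K G n z ↔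
      (fun ε : K => G (arc z N ε)) =O[𝓝[≠] 0] (fun ε => ε ^ (n + 1)) := by
  rw [isBigO_pow_iff (analyticAt_comp_arc hG z N)]
  constructor
  · intro hX i hi
    rcases Nat.eq_zero_or_pos i with rfl | hi0
    · simp [arc_zero, hG0]
    · rw [← T_eq_iteratedDeriv hG z (by omega)]
      exact hX i (Finset.mem_Icc.2 ⟨hi0, by omega⟩)
  · intro hX i hi
    have := Finset.mem_Icc.1 hi
    rw [T_eq_iteratedDeriv hG z (by omega : i ≤ N)]
    exact hX i (by omega)

end Expansion

/-! ### Uniform first order expansion of G along the arc. -/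

section Estimate

variable {K : Type*} [RCLike K]
variable {B : Type*} [NormedAddCommGroup B] [NormedSpace K B]
variable {B' : Type*} [NormedAddCommGroup B'] [NormedSpace K B']

/-- The Cauchy product of two polynomials of degree k differs from its truncation at order k only by
products with a + b > k. -/
theorem norm_sum_ev_sub_le (A : ℕ → B →L[K] B') (k : ℕ) : ∃ C ≥ 0, ∀ ε : K, ‖ε‖ ≤ 1 →
    ∀ y : Fin (k + 1) → B,
      ‖∑ a ∈ Finset.range (k + 1), ε ^ a • A a (ev B k ε y) -
        ∑ m ∈ Finset.range (k + 1), ε ^ m • conv A (relCoeff K y) m‖ ≤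
      C * ‖ε‖ ^ (k + 1) * ‖y‖ := by
  refine ⟨∑ a ∈ Finset.range (k + 1), ∑ b ∈ Finset.range (k + 1), ‖A a‖ * ‖relCLM K B k b‖,
    by positivity, fun ε hε y => ?_⟩
  set u := relCoeff K y with hu
  have e1 : ∀ m ∈ Finset.range (k + 1), ε ^ m • conv A u m =
      ∑ a ∈ Finset.range (k + 1), if a ≤ m then ε ^ m • A a (u (m - a)) else 0 := by
    intro m hm
    have hm := Finset.mem_range.1 hm
    rw [conv, Finset.smul_sum, ← Finset.sum_filter]
    refine Finset.sum_congr ?_ fun _ _ => rfl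
    ext a
    simp only [Finset.mem_range, Finset.mem_filter]
    omega
  rw [Finset.sum_congr rfl e1, Finset.sum_comm, ← Finset.sum_sub_distrib, Finset.sum_mul,
    Finset.sum_mul]
  refine (norm_sum_le _ _).trans (Finset.sum_le_sum fun a ha => ?_)
  have ha := Finset.mem_range.1 ha
  have e2 : ∑ m ∈ Finset.range (k + 1), (if a ≤ m then ε ^ m • A a (u (m - a)) else 0) =
      ∑ b ∈ Finset.range (k + 1), if b + a ≤ k then ε ^ (a + b) • A a (u b) else 0 := by
    rw [← Finset.sum_filter, ← Finset.sum_filter]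
    refine Finset.sum_nbij' (fun m => m - a) (fun b => b + a) ?_ ?_ ?_ ?_ ?_
    · intro m hm; simp only [Finset.mem_filter, Finset.mem_range] at hm ⊢; omega
    · intro m hm; simp only [Finset.mem_filter, Finset.mem_range] at hm ⊢; omega
    · intro m hm; simp only [Finset.mem_filter, Finset.mem_range] at hm; omega
    · intro m hm; omega
    · intro m hm
      simp only [Finset.mem_filter, Finset.mem_range] at hm
      rw [show a + (m - a) = m by omega]
  rw [e2, ev_apply, map_sum, Finset.smul_sum, ← Finset.sum_sub_distrib, Finset.sum_mul,
    Finset.sum_mul]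
  refine (norm_sum_le _ _).trans (Finset.sum_le_sum fun b hb => ?_)
  rw [map_smul, smul_smul, ← pow_add]
  split_ifs with h
  · rw [sub_self, norm_zero]; positivity
  · rw [sub_zero, norm_smul, norm_pow]
    have h1 : ‖A a (u b)‖ ≤ ‖A a‖ * (‖relCLM K B k b‖ * ‖y‖) := by
      refine ((A a).le_opNorm _).trans (mul_le_mul_of_nonneg_left ?_ (norm_nonneg _))
      rw [hu, ← relCLM_apply]
      exact (relCLM K B k b).le_opNorm y
    have h2 : ‖ε‖ ^ (a + b) ≤ ‖ε‖ ^ (k + 1) :=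
      pow_le_pow_of_le_one (norm_nonneg _) hε (by omega)
    calc ‖ε‖ ^ (a + b) * ‖A a (u b)‖
        ≤ ‖ε‖ ^ (k + 1) * (‖A a‖ * (‖relCLM K B k b‖ * ‖y‖)) := by gcongr
      _ = ‖A a‖ * ‖relCLM K B k b‖ * ‖ε‖ ^ (k + 1) * ‖y‖ := by ring

/-- Uniform Taylor expansion with respect to the increment of an analytic map. -/
theorem exists_norm_sub_sub_fderiv_le {G : B → B'} (hG : AnalyticAt K G 0) [CompleteSpace B'] :
    ∃ δ > 0, ∃ C ≥ 0, (∀ x : B, ‖x‖ < δ → AnalyticAt K G x) ∧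
      ∀ ρ ≥ 0, ∀ a x y : B, ‖a‖ + ρ < δ → ‖x - a‖ ≤ ρ → ‖y - a‖ ≤ ρ →
        ‖G x - G y - fderiv K G a (x - y)‖ ≤ C * ρ * ‖x - y‖ := by
  have hG' : AnalyticAt K (fderiv K G) 0 := hG.fderiv
  obtain ⟨C, t, ht, hC⟩ := (hG'.contDiffAt (n := 1)).exists_lipschitzOnWith
  obtain ⟨δ, hδ, hδt⟩ := Metric.eventually_nhds_iff_ball.1
    (hG.eventually_analyticAt.and (eventually_mem_set.2 ht))
  refine ⟨δ, hδ, C, C.2, fun x hx => (hδt x (by simpa using hx)).1, ?_⟩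
  intro ρ hρ a x y ha hx hy
  -- The mean value inequality on the ball needs convexity, which is a real notion.
  let _ : NormedSpace ℝ B := NormedSpace.restrictScalars ℝ K B
  have hball : ∀ v ∈ Metric.closedBall a ρ, v ∈ Metric.ball (0 : B) δ := by
    intro v hv
    rw [mem_closedBall_iff_norm] at hv
    rw [mem_ball_zero_iff]
    have : ‖v‖ ≤ ‖v - a‖ + ‖a‖ := by simpa using norm_add_le (v - a) a
    linarith
  have hconv : Convex ℝ (Metric.closedBall a ρ) := convex_closedBall a ρ
  refine hconv.norm_image_sub_le_of_norm_hasFDerivWithin_le' (f' := fderiv K G) (𝕜 := K)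
    (fun v hv => ((hδt v (hball v hv)).1.differentiableAt.hasFDerivAt).hasFDerivWithinAt)
    (fun v hv => ?_) (mem_closedBall_iff_norm.2 hy) (mem_closedBall_iff_norm.2 hx)
  have ha' : a ∈ Metric.closedBall a ρ := Metric.mem_closedBall_self hρ
  refine (hC.norm_sub_le (hδt v (hball v hv)).2 (hδt a (hball a ha')).2).trans ?_
  exact mul_le_mul_of_nonneg_left (mem_closedBall_iff_norm.1 hv) C.2

variable [CompleteSpace B']

theorem exists_norm_fderiv_sub_le {G : B → B'} (hG : AnalyticAt K G 0) (zbar : ℕ → B) (k : ℕ) :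
    ∃ ε₀ > 0, ∃ C ≥ 0, ∀ ε : K, ‖ε‖ < ε₀ →
      ‖fderiv K G (arc zbar k ε) - ∑ i ∈ Finset.range (k + 1), ε ^ i • linCoeff G zbar k i‖ ≤
        C * ‖ε‖ ^ (k + 1) := by
  have hG' : AnalyticAt K (fun ε : K => fderiv K G (arc zbar k ε)) 0 := by
    refine AnalyticAt.fun_comp (g := fderiv K G) (f := arc zbar k) ?_ (analyticAt_arc zbar k 0)
    rw [arc_zero]
    exact hG.fderiv
  obtain ⟨R, hR, hfR⟩ := hG'.exists_eq_sum_add_pow_mul (k + 1)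
  have hb : ∀ᶠ ε in 𝓝 (0 : K), ‖R ε‖ ≤ ‖R 0‖ + 1 :=
    (hR.continuousAt.norm.eventually_le_const (by simp))
  obtain ⟨ε₀, hε₀, hε⟩ := Metric.eventually_nhds_iff_ball.1 hb
  refine ⟨ε₀, hε₀, ‖R 0‖ + 1, by positivity, fun ε h => ?_⟩
  have : fderiv K G (arc zbar k ε) - ∑ i ∈ Finset.range (k + 1), ε ^ i • linCoeff G zbar k i =
      ε ^ (k + 1) • R ε := by
    rw [hfR ε, sub_eq_iff_eq_add']
    congr 1
    refine Finset.sum_congr rfl fun i _ => ?_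
    rw [linCoeff, smul_smul, div_eq_mul_inv]
  rw [this, norm_smul, norm_pow, mul_comm]
  exact mul_le_mul_of_nonneg_right (hε ε (by simpa using h)) (by positivity)

/-- Expansion of `G` along `arc zbar k ε + ε ^ (k + 1) w`, uniformly for bounded `w`. -/
theorem exists_norm_expansion_le {G : B → B'} (hG : AnalyticAt K G 0) (zbar : ℕ → B) (k : ℕ)
    {C : ℝ} (hC : 0 ≤ C) : ∃ ε₀ > 0, ∃ C' ≥ 0, ∀ ε : K, ‖ε‖ < ε₀ →
      ∀ (w w' : B) (y : Fin (k + 1) → B), ‖w‖ ≤ C → ‖w'‖ ≤ C → w - w' = ev B k ε y →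
        AnalyticAt K G (arc zbar k ε + ε ^ (k + 1) • w) ∧
        ‖G (arc zbar k ε + ε ^ (k + 1) • w) - G (arc zbar k ε + ε ^ (k + 1) • w') -
          ε ^ (k + 1) • ∑ m ∈ Finset.range (k + 1),
            ε ^ m • conv (linCoeff (K := K) G zbar k) (relCoeff K y) m‖ ≤
        C' * ‖ε‖ ^ (2 * k + 2) * ‖y‖ := by
  obtain ⟨δ, hδ, C₁, hC₁, han, h₁⟩ := exists_norm_sub_sub_fderiv_le hG
  obtain ⟨ε₂, hε₂, C₂, hC₂, h₂⟩ := exists_norm_fderiv_sub_le hG zbar k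
  obtain ⟨C₃, hC₃, h₃⟩ := norm_sum_ev_sub_le (linCoeff (K := K) G zbar k) k
  obtain ⟨C₄, hC₄, h₄⟩ := norm_ev_le (K := K) (B := B) k
  have hcont : ∀ᶠ ε in 𝓝 (0 : K), ‖arc zbar k ε‖ + C * ‖ε‖ ^ (k + 1) < δ := by
    have hc : ContinuousAt (fun ε : K => ‖arc zbar k ε‖ + C * ‖ε‖ ^ (k + 1)) 0 := by
      have := (analyticAt_arc (K := K) zbar k 0).continuousAt
      fun_prop
    refine hc.eventually_lt_const ?_
    simpa [arc_zero] using hδ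
  obtain ⟨ε₁, hε₁, h₅⟩ := Metric.eventually_nhds_iff_ball.1 hcont
  refine ⟨min 1 (min ε₁ ε₂), by positivity, C₁ * C * C₄ + C₂ * C₄ + C₃, by positivity, ?_⟩
  intro ε hε w w' y hw hw' hy
  have hε1 : ‖ε‖ ≤ 1 := hε.le.trans (min_le_left _ _)
  have hεδ := h₅ ε (by
    simpa using hε.trans_le ((min_le_right _ _).trans (min_le_left _ _)))
  have hε2 := h₂ ε (hε.trans_le ((min_le_right _ _).trans (min_le_right _ _)))
  have hn : ∀ w : B, ‖w‖ ≤ C → ‖ε ^ (k + 1) • w‖ ≤ C * ‖ε‖ ^ (k + 1) := fun w hw => by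
    rw [norm_smul, norm_pow, mul_comm]; gcongr
  have hev : ‖ev B k ε y‖ ≤ C₄ * ‖y‖ := ((ev B k ε).le_opNorm y).trans (by gcongr; exact h₄ ε hε1)
  constructor
  · exact han _ ((norm_add_le _ _).trans_lt (lt_of_le_of_lt (by gcongr; exact hn w hw) hεδ))
  set a := arc zbar k ε with ha
  set A := linCoeff (K := K) G zbar k with hA
  have k1 := h₁ (C * ‖ε‖ ^ (k + 1)) (by positivity) a (a + ε ^ (k + 1) • w)
    (a + ε ^ (k + 1) • w') hεδ (by simpa using hn w hw) (by simpa using hn w' hw')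
  have ediff : a + ε ^ (k + 1) • w - (a + ε ^ (k + 1) • w') = ε ^ (k + 1) • ev B k ε y := by
    rw [← hy, smul_sub]; abel
  rw [ediff] at k1
  have k2 : ‖(fderiv K G a - ∑ i ∈ Finset.range (k + 1), ε ^ i • A i)
      (ε ^ (k + 1) • ev B k ε y)‖ ≤ C₂ * ‖ε‖ ^ (k + 1) * (‖ε‖ ^ (k + 1) * (C₄ * ‖y‖)) := by
    refine (ContinuousLinearMap.le_opNorm _ _).trans ?_
    rw [norm_smul, norm_pow]
    gcongr
  have k3 := h₃ ε hε1 y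
  have k3' : ‖ε ^ (k + 1) • (∑ a ∈ Finset.range (k + 1), ε ^ a • A a (ev B k ε y) -
        ∑ m ∈ Finset.range (k + 1), ε ^ m • conv A (relCoeff K y) m)‖ ≤
      ‖ε‖ ^ (k + 1) * (C₃ * ‖ε‖ ^ (k + 1) * ‖y‖) := by
    rw [norm_smul, norm_pow]; gcongr
  -- Three errors, each of order ε^(2k+2) ‖y‖: the nonlinearity of G around a, the Taylor remainder
  -- of G' along the arc, and the truncation of the product of the two series.
  have esum : G (a + ε ^ (k + 1) • w) - G (a + ε ^ (k + 1) • w') -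
      ε ^ (k + 1) • ∑ m ∈ Finset.range (k + 1), ε ^ m • conv A (relCoeff K y) m =
      (G (a + ε ^ (k + 1) • w) - G (a + ε ^ (k + 1) • w') -
        fderiv K G a (ε ^ (k + 1) • ev B k ε y)) +
      (fderiv K G a - ∑ i ∈ Finset.range (k + 1), ε ^ i • A i) (ε ^ (k + 1) • ev B k ε y) +
      ε ^ (k + 1) • (∑ a ∈ Finset.range (k + 1), ε ^ a • A a (ev B k ε y) -
        ∑ m ∈ Finset.range (k + 1), ε ^ m • conv A (relCoeff K y) m) := by
    have : (∑ i ∈ Finset.range (k + 1), ε ^ i • A i) (ε ^ (k + 1) • ev B k ε y) =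
        ε ^ (k + 1) • ∑ a ∈ Finset.range (k + 1), ε ^ a • A a (ev B k ε y) := by
      rw [map_smul]; simp
    rw [_root_.sub_apply, this, smul_sub]
    abel
  rw [esum]
  refine (norm_add₃_le).trans ?_
  have k1' : C₁ * (C * ‖ε‖ ^ (k + 1)) * ‖ε ^ (k + 1) • ev B k ε y‖ ≤
      C₁ * (C * ‖ε‖ ^ (k + 1)) * (‖ε‖ ^ (k + 1) * (C₄ * ‖y‖)) := by
    rw [norm_smul, norm_pow]; gcongr
  calc _ ≤ C₁ * (C * ‖ε‖ ^ (k + 1)) * (‖ε‖ ^ (k + 1) * (C₄ * ‖y‖)) +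
        C₂ * ‖ε‖ ^ (k + 1) * (‖ε‖ ^ (k + 1) * (C₄ * ‖y‖)) +
        ‖ε‖ ^ (k + 1) * (C₃ * ‖ε‖ ^ (k + 1) * ‖y‖) := by
        linarith
    _ = _ := by
        rw [show 2 * k + 2 = (k + 1) + (k + 1) by ring, pow_add]
        ring

end Estimate

section Orders

variable {K : Type*} [RCLike K]
variable {F : Type*} [NormedAddCommGroup F] [NormedSpace K F]

theorem isBigO_of_pow_smul {f : K → F} {m n : ℕ}
    (h : (fun ε : K => ε ^ m • f ε) =O[𝓝[≠] 0] (fun ε => ε ^ (m + n))) :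
    f =O[𝓝[≠] 0] (fun ε => ε ^ n) := by
  obtain ⟨C, hC⟩ := h.bound
  refine IsBigO.of_bound C ?_
  filter_upwards [hC, self_mem_nhdsWithin] with ε h1 h2
  have h3 : 0 < ‖ε ^ m‖ := norm_pos_iff.2 (pow_ne_zero m h2)
  rw [norm_smul, pow_add, norm_mul] at h1
  exact le_of_mul_le_mul_left (by linarith) h3

theorem isBigO_pow_smul (c : F) (m : ℕ) :
    (fun ε : K => ε ^ m • c) =O[𝓝[≠] 0] (fun ε => ε ^ m) :=
  IsBigO.of_bound ‖c‖ (Eventually.of_forall fun ε => by rw [norm_smul, mul_comm])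

theorem coeff_eq_zero_of_isBigO_of_le {n N : ℕ} (hn : n ≤ N) {c : ℕ → F}
    (h : (fun ε : K => ∑ i ∈ Finset.range N, ε ^ i • c i) =O[𝓝[≠] 0] (fun ε => ε ^ n)) :
    ∀ i < n, c i = 0 := by
  refine coeff_eq_zero_of_isBigO n (K := K) ?_
  have h1 : (fun ε : K => ∑ i ∈ Finset.Ico n N, ε ^ i • c i) =O[𝓝[≠] 0] (fun ε => ε ^ n) :=
    IsBigO.fun_sum fun i hi =>
      isBigO_pow_of_le nhdsWithin_le_nhds (Finset.mem_Ico.1 hi).1 (isBigO_pow_smul (c i) i)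
  refine (h.sub h1).congr_left fun ε => ?_
  rw [← Finset.sum_range_add_sum_Ico _ hn, add_sub_cancel_right]

end Orders

theorem Ansatz.point_eq {K : Type*} [RCLike K]
    {B : Type*} [NormedAddCommGroup B] [NormedSpace K B]
    {B' : Type*} [NormedAddCommGroup B'] [NormedSpace K B']
    {G : B → B'} {zbar : ℕ → B} {k : ℕ} {D : Splitting K B B'} (C : Ansatz G zbar k D)
    (ε : K) (x n : Fin (k + 1) → B) :
    C.point ε x n = arc zbar k ε + ε ^ (k + 1) • ev B k ε (C.I + C.M (x + C.L n)) :=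
  arc_coeffSeq _ _ _ _

/-! ### Construction of the parametrization and its linear properties. -/

section MemX

variable {K : Type*} [RCLike K]
variable {B : Type*} [NormedAddCommGroup B] [NormedSpace K B]
variable {B' : Type*} [NormedAddCommGroup B'] [NormedSpace K B'] [CompleteSpace B']
variable {G : B → B'} (zbar : ℕ → B) (k : ℕ)

theorem memX_coeffSeq_iff (hG : AnalyticAt K G 0) (hG0 : G 0 = 0) {s : ℕ} (hs : s ≤ 1)
    (y : Fin (k + 1) → B) : MemX K G (2 * k + s) (coeffSeq zbar k y) ↔
      (fun ε : K => G (arc zbar k ε + ε ^ (k + 1) • ev B k ε y)) =O[𝓝[≠] 0]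
        (fun ε => ε ^ (k + 1 + (k + s))) := by
  rw [memX_iff hG hG0 _ (by omega : 2 * k + s ≤ 2 * k + 1)]
  simp only [arc_coeffSeq]
  rw [show 2 * k + s + 1 = k + 1 + (k + s) by ring]

theorem isBigO_expansion (hG : AnalyticAt K G 0) (y y' : Fin (k + 1) → B) :
    (fun ε : K => G (arc zbar k ε + ε ^ (k + 1) • ev B k ε y) -
      G (arc zbar k ε + ε ^ (k + 1) • ev B k ε y') - ε ^ (k + 1) • ∑ m ∈ Finset.range (k + 1),
        ε ^ m • conv (linCoeff (K := K) G zbar k) (relCoeff K (y - y')) m) =O[𝓝[≠] 0]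
      (fun ε => ε ^ (2 * k + 2)) := by
  obtain ⟨C, hC, hev⟩ := norm_ev_le (K := K) (B := B) k
  obtain ⟨ε₀, hε₀, C', hC', h⟩ := exists_norm_expansion_le hG zbar k
    (by positivity : 0 ≤ C * (‖y‖ + ‖y'‖))
  refine IsBigO.of_bound (C' * ‖y - y'‖) ?_
  have : ∀ᶠ ε in 𝓝[≠] (0 : K), ε ∈ Metric.ball (0 : K) (min ε₀ 1) :=
    nhdsWithin_le_nhds (Metric.ball_mem_nhds _ (by positivity))
  filter_upwards [this] with ε hε
  rw [mem_ball_zero_iff] at hε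
  have hb : ∀ v : Fin (k + 1) → B, ‖v‖ ≤ ‖y‖ + ‖y'‖ → ‖ev B k ε v‖ ≤ C * (‖y‖ + ‖y'‖) :=
    fun v hv => ((ev B k ε).le_opNorm v).trans
      (by gcongr; exact hev ε (hε.le.trans (min_le_right _ _)))
  have := (h ε (hε.trans_le (min_le_left _ _)) (ev B k ε y) (ev B k ε y') (y - y')
    (hb y (by simp)) (hb y' (by simp)) (map_sub _ _ _).symm).2
  rw [norm_pow]
  linarith

variable {zbar k}

/-- The difference of two arcs in the same X_n solves the linear equation to the matching order,
because the expansion error O(ε^(2k+2)) lies beyond it. -/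
theorem conv_eq_zero_of_isBigO (hG : AnalyticAt K G 0) {s : ℕ} (hs : s ≤ 1)
    {y y' : Fin (k + 1) → B}
    (h : (fun ε : K => G (arc zbar k ε + ε ^ (k + 1) • ev B k ε y)) =O[𝓝[≠] 0]
        (fun ε => ε ^ (k + 1 + (k + s))))
    (h' : (fun ε : K => G (arc zbar k ε + ε ^ (k + 1) • ev B k ε y')) =O[𝓝[≠] 0]
        (fun ε => ε ^ (k + 1 + (k + s)))) :
    ∀ m < k + s, conv (linCoeff (K := K) G zbar k) (relCoeff K (y - y')) m = 0 := by
  have h1 := isBigO_pow_of_le nhdsWithin_le_nhds (by omega : k + 1 + (k + s) ≤ 2 * k + 2)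
    (isBigO_expansion zbar k hG y y')
  refine coeff_eq_zero_of_isBigO_of_le (K := K) (by omega : k + s ≤ k + 1)
    (isBigO_of_pow_smul (m := k + 1) ?_)
  exact ((h.sub h').sub h1).congr_left fun ε => by abel

theorem isBigO_of_conv_eq_zero (hG : AnalyticAt K G 0) {s : ℕ} (hs : s ≤ 1)
    {y y' : Fin (k + 1) → B}
    (h' : (fun ε : K => G (arc zbar k ε + ε ^ (k + 1) • ev B k ε y')) =O[𝓝[≠] 0]
        (fun ε => ε ^ (k + 1 + (k + s))))
    (h : ∀ m < k + s, conv (linCoeff (K := K) G zbar k) (relCoeff K (y - y')) m = 0) :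
    (fun ε : K => G (arc zbar k ε + ε ^ (k + 1) • ev B k ε y)) =O[𝓝[≠] 0]
        (fun ε => ε ^ (k + 1 + (k + s))) := by
  have h1 := isBigO_pow_of_le nhdsWithin_le_nhds (by omega : k + 1 + (k + s) ≤ 2 * k + 2)
    (isBigO_expansion zbar k hG y y')
  have h2 : (fun ε : K => ε ^ (k + 1) • ∑ m ∈ Finset.range (k + 1),
      ε ^ m • conv (linCoeff (K := K) G zbar k) (relCoeff K (y - y')) m) =O[𝓝[≠] 0]
      (fun ε => ε ^ (k + 1 + (k + s))) := by
    simp_rw [Finset.smul_sum, smul_smul, ← pow_add]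
    refine IsBigO.fun_sum fun m _ => ?_
    by_cases hm : m < k + s
    · simp only [h m hm, smul_zero]
      exact isBigO_zero _ _
    · exact isBigO_pow_of_le nhdsWithin_le_nhds (by omega) (isBigO_pow_smul _ _)
  exact ((h1.add h2).add h').congr_left fun ε => by abel

/-- Going from X_{2k} to X_{2k+1}: the obstruction is the coefficient of ε^(2k+1), an element of B'.
By surjectivity of the sum operator it is cancelled by a change of the coefficients that leaves the
lower orders untouched. -/
theorem exists_isBigO (hG : AnalyticAt K G 0) (hG0 : G 0 = 0) {D : Splitting K B B'}
    (hD : D.IsDecomposition (linCoeff G zbar k) k) (hS : D.SumSurjective (linCoeff G zbar k) k)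
    (hX : ∃ z : ℕ → B, (∀ j ∈ Finset.Icc 1 k, z j = zbar j) ∧ MemX K G (2 * k) z) :
    ∃ y : Fin (k + 1) → B, (fun ε : K => G (arc zbar k ε + ε ^ (k + 1) • ev B k ε y)) =O[𝓝[≠] 0]
        (fun ε => ε ^ (k + 1 + (k + 1))) := by
  obtain ⟨z, hz, hzX⟩ := hX
  -- The entry with index 0 is z_{2k+1}, which X_{2k} leaves free; any value will do.
  let y₀ : Fin (k + 1) → B := fun i => z (2 * k + 1 - i)
  have hy₀ : (fun ε : K => G (arc zbar k ε + ε ^ (k + 1) • ev B k ε y₀)) =O[𝓝[≠] 0]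
      (fun ε => ε ^ (k + 1 + (k + 0))) := by
    rw [← memX_coeffSeq_iff zbar k hG hG0 (by omega)]
    rw [memX_iff hG hG0 _ (by omega : 2 * k + 0 ≤ 2 * k + 1)]
    refine ((memX_iff hG hG0 z (by omega : 2 * k ≤ 2 * k + 1)).1 hzX).congr_left fun ε => ?_
    congr 1
    refine arc_congr (fun j hj => ?_) ε
    have := Finset.mem_Icc.1 hj
    rw [coeffSeq]
    split_ifs with h1 h2
    · exact hz j (Finset.mem_Icc.2 ⟨this.1, h1⟩)
    · simp only [y₀]
      congr 1
      omega
    · omega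
  have han : AnalyticAt K (fun ε : K => G (arc zbar k ε + ε ^ (k + 1) • ev B k ε y₀)) 0 := by
    have := analyticAt_comp_arc hG (coeffSeq zbar k y₀) (2 * k + 1)
    simpa only [arc_coeffSeq] using this
  obtain ⟨R, hR, hfR⟩ := han.exists_eq_sum_add_pow_mul (2 * k + 2)
  have hder := (isBigO_pow_iff han _).1 hy₀
  set d := iteratedDeriv (2 * k + 1)
    (fun ε : K => G (arc zbar k ε + ε ^ (k + 1) • ev B k ε y₀)) 0
  obtain ⟨y, hy, hyk⟩ := exists_conv_eq hD hS (-(((2 * k + 1)! : K)⁻¹ • d))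
  refine ⟨y₀ + y, ?_⟩
  have h1 := isBigO_expansion zbar k hG (y₀ + y) y₀
  have hRO : (fun ε : K => ε ^ (2 * k + 2) • R ε) =O[𝓝[≠] 0] (fun ε => ε ^ (2 * k + 2)) := by
    have h1 : R =O[𝓝[≠] 0] (fun _ => (1 : K)) :=
      (hR.continuousAt.tendsto.mono_left nhdsWithin_le_nhds).isBigO_one K
    simpa using (isBigO_refl (fun ε : K => ε ^ (2 * k + 2)) (𝓝[≠] 0)).smul h1
  rw [show k + 1 + (k + 1) = 2 * k + 2 by ring]
  refine (h1.add hRO).congr_left fun ε => ?_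
  rw [add_sub_cancel_left, Finset.sum_range_succ, hyk, Finset.sum_eq_zero (s := Finset.range k)
    fun m hm => by rw [hy m (Finset.mem_range.1 hm), smul_zero], zero_add]
  have h2 := hfR ε
  rw [Finset.sum_range_succ, Finset.sum_eq_zero fun i hi => by
    rw [hder i (by have := Finset.mem_range.1 hi; omega), smul_zero], zero_add] at h2
  rw [h2, smul_smul, ← pow_add, smul_neg, smul_smul, div_eq_mul_inv,
    show k + 1 + k = 2 * k + 1 by ring]
  abel

theorem isTriangular_refl : IsTriangular (ContinuousLinearEquiv.refl K (Fin (k + 1) → B)) :=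
  ⟨fun _ => 1, fun _ => one_ne_zero, fun i x _ => by simp⟩

/-- With M = `chainOp` and L the identity, entries in N_jᶜ ⊆ N_j affect G only from order 2k+1 on.
Entries in N_{j+1} do not affect that order either, since S vanishes on them. -/
theorem nonempty_ansatz [CompleteSpace B] (hG : AnalyticAt K G 0) (hG0 : G 0 = 0)
    {D : Splitting K B B'}
    (hD : D.IsDecomposition (linCoeff G zbar k) k) (hS : D.SumSurjective (linCoeff G zbar k) k)
    (hX : ∃ z : ℕ → B, (∀ j ∈ Finset.Icc 1 k, z j = zbar j) ∧ MemX K G (2 * k) z) :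
    Nonempty (Ansatz G zbar k D) := by
  obtain ⟨y, hy⟩ := exists_isBigO hG hG0 hD hS hX
  have hM := upperTriangular_chainOp (linCoeff (K := K) G zbar k) D.E k
  refine ⟨⟨y, hM.equiv fun i => factorial_ne_zero' _, ContinuousLinearEquiv.refl K _,
    ⟨_, fun i => factorial_ne_zero' _, hM⟩, isTriangular_refl, ?_, ?_⟩⟩
  · intro x hx n hn
    refine (memX_coeffSeq_iff zbar k hG hG0 zero_le_one _).2
      (isBigO_of_conv_eq_zero hG zero_le_one (y' := y)
        (isBigO_pow_of_le nhdsWithin_le_nhds (by omega) hy) fun m hm => ?_)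
    rw [add_sub_cancel_left, UpperTriangular.equiv_apply]
    refine conv_chainOp_of_lt hD (fun j => add_mem ?_ ?_) hm
    · exact hD.Nc_le (by omega) (Splitting.mem_complProd.1 hx j)
    · exact D.N_succ_le _ _ (Splitting.mem_kerProd.1 hn j)
  · intro n hn
    refine (memX_coeffSeq_iff zbar k hG hG0 le_rfl _).2
      (isBigO_of_conv_eq_zero hG le_rfl (y' := y) hy fun m hm => ?_)
    rw [add_sub_cancel_left, UpperTriangular.equiv_apply]
    have hn' := Splitting.mem_kerProd.1 hn
    rcases Nat.lt_succ_iff_lt_or_eq.1 hm with h | rfl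
    · exact conv_chainOp_of_lt hD (fun j => D.N_succ_le _ _ (hn' j)) h
    · refine (conv_chainOp hD fun j => D.N_succ_le _ _ (hn' j)).trans ?_
      refine Finset.sum_eq_zero fun j _ => ?_
      have := ((D.mem_N_succ _).1 (hn' j)).2
      simp [this]

namespace Ansatz

variable {D : Splitting K B B'} (C : Ansatz G zbar k D)

theorem isBigO_point (hG : AnalyticAt K G 0) (hG0 : G 0 = 0) {x n : Fin (k + 1) → B}
    (hx : x ∈ D.complProd k) (hn : n ∈ D.kerProd (linCoeff G zbar k) k) :
    (fun ε : K => G (C.point ε x n)) =O[𝓝[≠] 0] (fun ε => ε ^ (2 * k + 1)) := by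
  simp_rw [point_eq]
  have := (memX_coeffSeq_iff zbar k hG hG0 zero_le_one _).1 (C.memX_two_mul x hx n hn)
  rwa [show k + 1 + (k + 0) = 2 * k + 1 by ring] at this

theorem isBigO_point_zero (hG : AnalyticAt K G 0) (hG0 : G 0 = 0) {n : Fin (k + 1) → B}
    (hn : n ∈ D.kerProd (linCoeff G zbar k) k) :
    (fun ε : K => G (C.point ε 0 n)) =O[𝓝[≠] 0] (fun ε => ε ^ (2 * k + 2)) := by
  simp_rw [point_eq]
  have := (memX_coeffSeq_iff zbar k hG hG0 le_rfl _).1 (C.memX_two_mul_add_one n hn)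
  simpa only [show k + 1 + (k + 1) = 2 * k + 2 by ring, zero_add] using this

/-- Comparing each member of the parametrization with the one at nᶜ = 0, n = 0 turns the nonlinear
membership conditions into linear ones. Hence the rest applies to every choice of Î, M̂, L̂. -/
theorem adapted (hG : AnalyticAt K G 0) (hG0 : G 0 = 0) :
    Adapted D (linCoeff G zbar k) k C.M C.L where
  triangular_M := C.triangular_M
  triangular_L := C.triangular_L
  conv_compl x hx m hm := by
    have h1 := (memX_coeffSeq_iff zbar k hG hG0 zero_le_one _).1
      (C.memX_two_mul x hx 0 (zero_mem _))
    have h2 := (memX_coeffSeq_iff zbar k hG hG0 zero_le_one _).1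
      (C.memX_two_mul 0 (zero_mem _) 0 (zero_mem _))
    have := conv_eq_zero_of_isBigO hG zero_le_one h1 h2 m hm
    simpa using this
  conv_ker n hn m hm := by
    have h1 := (memX_coeffSeq_iff zbar k hG hG0 le_rfl _).1 (C.memX_two_mul_add_one n hn)
    have h2 := (memX_coeffSeq_iff zbar k hG hG0 le_rfl _).1
      (C.memX_two_mul_add_one 0 (zero_mem _))
    have := conv_eq_zero_of_isBigO hG le_rfl h1 h2 m hm
    simpa using this

end Ansatz

end MemX

/-! ### Quantitative perturbation of isomorphisms. -/

section Perturbation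

variable {K : Type*} [RCLike K]
variable {E : Type*} [NormedAddCommGroup E] [NormedSpace K E] [CompleteSpace E]
variable {F : Type*} [NormedAddCommGroup F] [NormedSpace K F]

theorem isInvertible_of_norm_sub_lt (Λ : E ≃L[K] F) {f' : E →L[K] F} {κ c : ℝ}
    (hκ : ‖(Λ.symm : F →L[K] E)‖ ≤ κ) (hc : ‖f' - Λ‖ ≤ c) (h : κ * c < 1) :
    f'.IsInvertible := by
  have h1 : ‖(1 : E →L[K] E) - (Λ.symm : F →L[K] E) ∘L f'‖ < 1 := by
    have : (1 : E →L[K] E) - (Λ.symm : F →L[K] E) ∘L f' =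
        -((Λ.symm : F →L[K] E) ∘L (f' - (Λ : E →L[K] F))) := by
      ext v; simp
    rw [this, norm_neg]
    exact ((ContinuousLinearMap.opNorm_comp_le _ _).trans
      (mul_le_mul hκ hc (norm_nonneg _) ((norm_nonneg _).trans hκ))).trans_lt h
  let u : (E →L[K] E)ˣ := Units.oneSub _ h1
  have hu : (u : E →L[K] E) = (Λ.symm : F →L[K] E) ∘L f' := by simp [u]
  refine ⟨(ContinuousLinearEquiv.unitsEquiv K E u).trans Λ, ?_⟩
  ext v
  have : (u : E →L[K] E) v = Λ.symm (f' v) := by rw [hu]; rfl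
  simp [this]

/-- Closeness to Λ in the Lipschitz sense bounds the distance of the derivative from Λ, and then the
Neumann series inverts it. -/
theorem isInvertible_of_approximatesLinearOn (Λ : E ≃L[K] F) {f : E → F} {f' : E →L[K] F}
    {s : Set E} {x : E} {κ : ℝ} {c : NNReal}
    (hf : ApproximatesLinearOn f (Λ : E →L[K] F) s c) (hs : s ∈ 𝓝 x)
    (hf' : HasFDerivAt f f' x) (hκ : ‖(Λ.symm : F →L[K] E)‖ ≤ κ) (h : κ * c < 1) :
    f'.IsInvertible := by
  refine isInvertible_of_norm_sub_lt Λ hκ (c := c) ?_ h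
  refine (hf'.sub (Λ : E →L[K] F).hasFDerivAt).le_of_lip' c.2 ?_
  filter_upwards [hs] with y hy
  have := hf y hy x (mem_of_mem_nhds hs)
  rw [map_sub] at this
  simp only [Pi.sub_apply]
  convert this using 2
  abel

theorem exists_eq_of_approximatesLinearOn (Λ : E ≃L[K] F) {f : E → F} {b : E} {ρ κ : ℝ}
    {c : NNReal} (hρ : 0 ≤ ρ)
    (hf : ApproximatesLinearOn f (Λ : E →L[K] F) (Metric.closedBall b ρ) c)
    (hκ : ‖(Λ.symm : F →L[K] E)‖ ≤ κ) (hκ0 : 0 < κ) (h : κ * c ≤ 1 / 2) {y : F}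
    (hy : ‖y - f b‖ ≤ ρ / (2 * κ)) : ∃ x, ‖x - b‖ ≤ ρ ∧ f x = y := by
  let fsymm : (Λ : E →L[K] F).NonlinearRightInverse :=
    { toFun := Λ.symm
      nnnorm := ⟨κ, hκ0.le⟩
      bound' := fun v => ((Λ.symm : F →L[K] E).le_opNorm v).trans
        (mul_le_mul_of_nonneg_right hκ (norm_nonneg _))
      right_inv' := fun v => by simp }
  have hsurj := hf.surjOn_closedBall_of_nonlinearRightInverse fsymm hρ subset_rfl
  have hmem : y ∈ Metric.closedBall (f b) (((fsymm.nnnorm : ℝ)⁻¹ - c) * ρ) := by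
    rw [mem_closedBall_iff_norm]
    refine hy.trans ?_
    have e : ((fsymm.nnnorm : NNReal) : ℝ) = κ := rfl
    rw [e]
    have h2 : (c : ℝ) ≤ 1 / (2 * κ) := by
      rw [le_div_iff₀ (by positivity)]; linarith
    -- The image of the ball of radius ρ contains the ball of radius (κ⁻¹ - c) ρ around f b, and
    -- this radius is at least ρ / (2κ).
    have h3 : 1 / (2 * κ) ≤ κ⁻¹ - c := by
      have : κ⁻¹ = 1 / (2 * κ) + 1 / (2 * κ) := by field_simp; norm_num
      linarith
    calc ρ / (2 * κ) = 1 / (2 * κ) * ρ := by ring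
      _ ≤ _ := mul_le_mul_of_nonneg_right h3 hρ
  obtain ⟨x, hx, hxy⟩ := hsurj hmem
  exact ⟨x, mem_closedBall_iff_norm.1 hx, hxy⟩

end Perturbation

/-! ### Estimates of G along the parametrization. -/

namespace Ansatz

variable {K : Type*} [RCLike K]
variable {B : Type*} [NormedAddCommGroup B] [NormedSpace K B]
variable {B' : Type*} [NormedAddCommGroup B'] [NormedSpace K B']
variable {G : B → B'} {zbar : ℕ → B} {k : ℕ} {D : Splitting K B B'} (C : Ansatz G zbar k D)

theorem exists_norm_ev_le (r c : ℝ) : ∃ ρ ≥ 0, ∀ ε : K, ‖ε‖ ≤ 1 →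
    ∀ x n : Fin (k + 1) → B, ‖x‖ ≤ r → ‖n‖ ≤ c → ‖ev B k ε (C.I + C.M (x + C.L n))‖ ≤ ρ := by
  obtain ⟨W, hW, hev⟩ := norm_ev_le (K := K) (B := B) k
  set M : (Fin (k + 1) → B) →L[K] (Fin (k + 1) → B) := C.M.toContinuousLinearMap
  set L : (Fin (k + 1) → B) →L[K] (Fin (k + 1) → B) := C.L.toContinuousLinearMap
  refine ⟨W * (‖C.I‖ + ‖M‖ * (max r 0 + ‖L‖ * max c 0)), by positivity, fun ε hε x n hx hn => ?_⟩
  refine ((ev B k ε).le_opNorm _).trans (mul_le_mul (hev ε hε) ?_ (norm_nonneg _) hW)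
  refine (norm_add_le _ _).trans (add_le_add_right ?_ _)
  refine (M.le_opNorm _).trans (mul_le_mul_of_nonneg_left ?_ (norm_nonneg _))
  refine (norm_add_le _ _).trans (add_le_add (hx.trans (le_max_left _ _)) ?_)
  exact (L.le_opNorm _).trans
    (mul_le_mul_of_nonneg_left (hn.trans (le_max_left _ _)) (norm_nonneg _))

theorem ev_sub_ev (ε : K) (x x' n : Fin (k + 1) → B) :
    ev B k ε (C.I + C.M (x + C.L n)) - ev B k ε (C.I + C.M (x' + C.L n)) =
      ev B k ε (C.M (x - x')) := by
  rw [← map_sub]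
  congr 1
  rw [add_sub_add_left_eq_sub, ← map_sub, add_sub_add_right_eq_sub]

theorem point_zero_left (x n : Fin (k + 1) → B) : C.point 0 x n = 0 := arc_zero _ _

theorem analyticAt_point {E : Type*} [NormedAddCommGroup E] [NormedSpace K E]
    {f : E → K} {g h : E → Fin (k + 1) → B} {e : E} (hf : AnalyticAt K f e)
    (hg : AnalyticAt K g e) (hh : AnalyticAt K h e) :
    AnalyticAt K (fun v => C.point (f v) (g v) (h v)) e := by
  have h1 : AnalyticAt K (fun v => arc zbar k (f v)) e :=
    AnalyticAt.fun_comp (analyticAt_arc _ _ _) hf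
  have h2 : AnalyticAt K (fun v => C.I + C.M (g v + C.L (h v))) e := by
    have e1 : AnalyticAt K (fun v => C.L (h v)) e :=
      ((C.L : (Fin (k + 1) → B) →L[K] (Fin (k + 1) → B)).analyticAt _).fun_comp hh
    have e2 : AnalyticAt K (fun v => C.M (g v + C.L (h v))) e :=
      ((C.M : (Fin (k + 1) → B) →L[K] (Fin (k + 1) → B)).analyticAt _).fun_comp (hg.add e1)
    exact analyticAt_const.add e2
  have h3 : AnalyticAt K (fun v => ev B k (f v) (C.I + C.M (g v + C.L (h v)))) e := by
    simp only [ev, _root_.sum_apply, _root_.smul_apply]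
    refine Finset.analyticAt_fun_sum _ fun b _ => (hf.pow b).smul ?_
    exact ((relCLM K B k b).analyticAt _).fun_comp h2
  simp only [point_eq]
  exact h1.add ((hf.pow (k + 1)).smul h3)

variable [CompleteSpace B']

/-- The main estimate: `G` at two points that differ only in the direction of `∏ Nᵢᶜ`. -/
theorem exists_norm_sub_le (hG : AnalyticAt K G 0) (hG0 : G 0 = 0)
    {Λ : D.complProd k ≃L[K] B'}
    (hΛ : ∀ x : D.complProd k, Λ x = conv (linCoeff (K := K) G zbar k) (relCoeff K (C.M x)) k)
    {ρ : ℝ} (hρ : 0 ≤ ρ) : ∃ ε₀ > 0, ∃ c ≥ 0, ∀ ε : K, ‖ε‖ < ε₀ →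
      ∀ (w w' : B) (x : D.complProd k), ‖w‖ ≤ ρ → ‖w'‖ ≤ ρ → w - w' = ev B k ε (C.M x) →
        AnalyticAt K G (arc zbar k ε + ε ^ (k + 1) • w) ∧
        ‖G (arc zbar k ε + ε ^ (k + 1) • w) - G (arc zbar k ε + ε ^ (k + 1) • w') -
          ε ^ (2 * k + 1) • Λ x‖ ≤ c * ‖ε‖ ^ (2 * k + 2) * ‖x‖ := by
  obtain ⟨ε₀, hε₀, c, hc, h⟩ := exists_norm_expansion_le hG zbar k hρ
  set M : (Fin (k + 1) → B) →L[K] (Fin (k + 1) → B) := C.M.toContinuousLinearMap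
  refine ⟨ε₀, hε₀, c * ‖M‖, by positivity, fun ε hε w w' x hw hw' hx => ?_⟩
  obtain ⟨h1, h2⟩ := h ε hε w w' (C.M x) hw hw' hx
  refine ⟨h1, ?_⟩
  have h3 : ε ^ (k + 1) • ∑ m ∈ Finset.range (k + 1),
      ε ^ m • conv (linCoeff (K := K) G zbar k) (relCoeff K (C.M x)) m =
      ε ^ (2 * k + 1) • Λ x := by
    rw [Finset.sum_range_succ, Finset.sum_eq_zero fun m hm => by
      rw [(C.adapted hG hG0).conv_compl x x.2 m (Finset.mem_range.1 hm), smul_zero], zero_add,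
      ← hΛ, smul_smul, ← pow_add, show k + 1 + k = 2 * k + 1 by ring]
  rw [h3] at h2
  refine h2.trans ?_
  have h4 : ‖C.M x‖ ≤ ‖M‖ * ‖x‖ := M.le_opNorm _
  calc c * ‖ε‖ ^ (2 * k + 2) * ‖C.M x‖ ≤ c * ‖ε‖ ^ (2 * k + 2) * (‖M‖ * ‖x‖) := by gcongr
    _ = _ := by ring

/-- Uniqueness of the `∏ Nᵢᶜ`-component of a solution. -/
theorem exists_eq_zero_of_solves (hG : AnalyticAt K G 0) (hG0 : G 0 = 0)
    {Λ : D.complProd k ≃L[K] B'}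
    (hΛ : ∀ x : D.complProd k, Λ x = conv (linCoeff (K := K) G zbar k) (relCoeff K (C.M x)) k)
    {ρ : ℝ} (hρ : 0 ≤ ρ) : ∃ ε₀ > 0, ∀ ε : K, 0 < ‖ε‖ → ‖ε‖ < ε₀ →
      ∀ (w w' : B) (x : D.complProd k), ‖w‖ ≤ ρ → ‖w'‖ ≤ ρ → w - w' = ev B k ε (C.M x) →
        G (arc zbar k ε + ε ^ (k + 1) • w) = 0 → G (arc zbar k ε + ε ^ (k + 1) • w') = 0 →
        x = 0 := by
  obtain ⟨ε₀, hε₀, c, hc, h⟩ := C.exists_norm_sub_le hG hG0 hΛ hρ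
  set N : B' →L[K] D.complProd k := Λ.symm.toContinuousLinearMap
  -- This choice makes ‖N‖ c ‖ε‖ < 1, so ‖x‖ ≤ ‖N‖ c ‖ε‖ ‖x‖ forces x = 0. Only w and w' are
  -- bounded; x may be arbitrarily large.
  refine ⟨min ε₀ ((‖N‖ * c + 1)⁻¹), by positivity, fun ε hε0 hε w w' x hw hw' hx h1 h2 => ?_⟩
  have h3 := (h ε (hε.trans_le (min_le_left _ _)) w w' x hw hw' hx).2
  rw [h1, h2, sub_zero, zero_sub, norm_neg, norm_smul, norm_pow,
    show 2 * k + 2 = (2 * k + 1) + 1 by ring, pow_succ ‖ε‖ (2 * k + 1)] at h3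
  have h4 : ‖Λ x‖ ≤ c * ‖ε‖ * ‖x‖ :=
    le_of_mul_le_mul_left (by linarith) (pow_pos hε0 (2 * k + 1))
  have h5 : ‖x‖ ≤ ‖N‖ * ‖Λ x‖ := by simpa [N] using N.le_opNorm (Λ x)
  have h6 : ‖ε‖ * (‖N‖ * c + 1) < 1 := by
    have := hε.trans_le (min_le_right _ _)
    rwa [lt_inv_comm₀ hε0 (by positivity), ← one_div, lt_div_iff₀ hε0, mul_comm] at this
  by_contra hx0
  have hx1 : 0 < ‖x‖ := norm_pos_iff.2 hx0
  have h7 : ‖x‖ ≤ ‖N‖ * (c * ‖ε‖ * ‖x‖) := h5.trans (by gcongr)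
  nlinarith

/-- The previous results in terms of the parametrization. -/
theorem exists_point_estimate (hG : AnalyticAt K G 0) (hG0 : G 0 = 0)
    {Λ : D.complProd k ≃L[K] B'}
    (hΛ : ∀ x : D.complProd k, Λ x = conv (linCoeff (K := K) G zbar k) (relCoeff K (C.M x)) k)
    (r c : ℝ) : ∃ ε₀ > 0, ∃ c' ≥ 0, ∀ ε : K, ‖ε‖ < ε₀ →
      ∀ n : D.kerProd (linCoeff G zbar k) k, ‖n‖ ≤ c →
        (∀ x : D.complProd k, ‖x‖ ≤ r → AnalyticAt K G (C.point ε x n)) ∧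
        (∀ x x' : D.complProd k, ‖x‖ ≤ r → ‖x'‖ ≤ r →
          ‖G (C.point ε x n) - G (C.point ε x' n) - ε ^ (2 * k + 1) • Λ (x - x')‖ ≤
            c' * ‖ε‖ ^ (2 * k + 2) * ‖x - x'‖) ∧
        ‖G (C.point ε 0 n)‖ ≤ c' * ‖ε‖ ^ (2 * k + 2) := by
  obtain ⟨ρ, hρ, hρb⟩ := C.exists_norm_ev_le (max r 0) (max c 0)
  obtain ⟨ε₁, hε₁, c₁, hc₁, h₁⟩ := C.exists_norm_sub_le hG hG0 hΛ hρ
  obtain ⟨ε₂, hε₂, c₂, hc₂, h₂⟩ := exists_norm_expansion_le hG zbar k hρ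
  -- Membership in X_{2k+1} for each n separately gives no uniform constant. The order is taken at n
  -- = 0 only and carried to all bounded n by the uniform expansion, in which M L n contributes
  -- nothing.
  obtain ⟨c₃, h₃⟩ := (C.isBigO_point_zero hG hG0
    (zero_mem (D.kerProd (linCoeff G zbar k) k))).bound
  rw [eventually_nhdsWithin_iff] at h₃
  obtain ⟨ε₃, hε₃, h₃⟩ := Metric.eventually_nhds_iff_ball.1 h₃
  set ML : (Fin (k + 1) → B) →L[K] (Fin (k + 1) → B) :=
    (C.M : (Fin (k + 1) → B) →L[K] (Fin (k + 1) → B)) ∘L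
    (C.L : (Fin (k + 1) → B) →L[K] (Fin (k + 1) → B))
  refine ⟨min (min 1 ε₁) (min ε₂ ε₃), by positivity,
    max c₁ (max c₃ 0 + c₂ * (‖ML‖ * max c 0)), by positivity, fun ε hε n hn => ?_⟩
  simp only [lt_min_iff] at hε
  obtain ⟨⟨hε1, hε₁'⟩, hε₂', hε₃'⟩ := hε
  have hb : ∀ x : D.complProd k, ‖x‖ ≤ r →
      ‖ev B k ε (C.I + C.M (x + C.L n))‖ ≤ ρ := fun x hx =>
    hρb ε hε1.le x n (hx.trans (le_max_left _ _)) (hn.trans (le_max_left _ _))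
  have hb0 : ‖ev B k ε (C.I + C.M (0 + C.L n))‖ ≤ ρ :=
    hρb ε hε1.le 0 n (by simp) (hn.trans (le_max_left _ _))
  have hb00 : ‖ev B k ε (C.I + C.M (0 + C.L 0))‖ ≤ ρ :=
    hρb ε hε1.le 0 0 (by simp) (by simp)
  refine ⟨fun x hx => ?_, fun x x' hx hx' => ?_, ?_⟩
  · rw [point_eq]
    exact (h₁ ε hε₁' _ _ 0 (hb x hx) (hb x hx) (by simp)).1
  · rw [point_eq, point_eq]
    refine (h₁ ε hε₁' _ _ (x - x') (hb x hx) (hb x' hx') (C.ev_sub_ev ε x x' n)).2.trans ?_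
    gcongr
    exact le_max_left _ _
  · have e1 : ‖G (C.point ε 0 0)‖ ≤ max c₃ 0 * ‖ε‖ ^ (2 * k + 2) := by
      by_cases h0 : ε = 0
      · rw [h0, point_zero_left, hG0, norm_zero]; positivity
      · refine (h₃ ε (by simpa using hε₃') h0).trans ?_
        rw [norm_pow]
        gcongr
        exact le_max_left _ _
    have e2 := (h₂ ε hε₂' _ _ (C.M (C.L n)) hb0 hb00 (by
      rw [← map_sub]; simp)).2
    rw [← point_eq, ← point_eq, Finset.sum_eq_zero fun m hm => by
      rw [(C.adapted hG hG0).conv_ker n n.2 m (Finset.mem_range.1 hm), smul_zero], smul_zero,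
      sub_zero] at e2
    have e3 : ‖C.M (C.L n)‖ ≤ ‖ML‖ * max c 0 :=
      (ML.le_opNorm _).trans (by gcongr; exact hn.trans (le_max_left _ _))
    calc ‖G (C.point ε 0 n)‖
        ≤ ‖G (C.point ε 0 0)‖ + ‖G (C.point ε 0 n) - G (C.point ε 0 0)‖ := by
          simpa using norm_add_le (G (C.point ε 0 0)) (G (C.point ε 0 n) - G (C.point ε 0 0))
      _ ≤ max c₃ 0 * ‖ε‖ ^ (2 * k + 2) + c₂ * ‖ε‖ ^ (2 * k + 2) * (‖ML‖ * max c 0) :=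
          add_le_add e1 (e2.trans (by gcongr))
      _ = (max c₃ 0 + c₂ * (‖ML‖ * max c 0)) * ‖ε‖ ^ (2 * k + 2) := by ring
      _ ≤ _ := by gcongr; exact le_max_right _ _

end Ansatz

theorem _root_.ApproximatesLinearOn.eq_of_eq {K : Type*} [RCLike K]
    {E : Type*} [NormedAddCommGroup E] [NormedSpace K E]
    {F : Type*} [NormedAddCommGroup F] [NormedSpace K F] {Λ : E ≃L[K] F} {f : E → F} {s : Set E}
    {κ : ℝ} {c : NNReal} (hf : ApproximatesLinearOn f (Λ : E →L[K] F) s c)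
    (hκ : ‖(Λ.symm : F →L[K] E)‖ ≤ κ) (h : κ * c < 1) {x y : E} (hx : x ∈ s) (hy : y ∈ s)
    (hxy : f x = f y) : x = y := by
  have h1 := hf x hx y hy
  rw [hxy, sub_self, zero_sub, norm_neg] at h1
  have h2 : ‖x - y‖ ≤ κ * ‖Λ (x - y)‖ := by
    refine le_trans ?_ (mul_le_mul_of_nonneg_right hκ (norm_nonneg _))
    simpa using (Λ.symm : F →L[K] E).le_opNorm (Λ (x - y))
  by_contra hne
  have h3 : 0 < ‖x - y‖ := norm_pos_iff.2 (sub_ne_zero.2 hne)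
  have h4 : κ * ‖Λ (x - y)‖ ≤ κ * (c * ‖x - y‖) :=
    mul_le_mul_of_nonneg_left h1 ((norm_nonneg _).trans hκ)
  nlinarith

/-- The quotient supplied by division agrees with R for ε ≠ 0. The limit hypothesis identifies both
on ε = 0, so R needs no continuity in v to begin with. -/
theorem analyticAt_of_eq_pow_inv_smul {K : Type*} [RCLike K]
    {V : Type*} [NormedAddCommGroup V] [NormedSpace K V]
    {F : Type*} [NormedAddCommGroup F] [NormedSpace K F] [CompleteSpace F] {v₀ : V} (m : ℕ)
    {f R : K × V → F} (hf : AnalyticAt K f (0, v₀))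
    (hO : ∀ v, (fun ε : K => f (ε, v)) =O[𝓝[≠] 0] fun ε => ε ^ m)
    (hR : ∀ ε v, ε ≠ 0 → R (ε, v) = (ε ^ m)⁻¹ • f (ε, v))
    (hR0 : ∀ v, Tendsto (fun ε : K => R (ε, v)) (𝓝[≠] 0) (𝓝 (R (0, v)))) :
    AnalyticAt K R (0, v₀) := by
  obtain ⟨g, hg, hfg⟩ := exists_analyticAt_eq_pow_smul m hf (Eventually.of_forall hO)
  have hsw : ∀ᶠ v in 𝓝 v₀, ∀ᶠ ε in 𝓝 (0 : K), f (ε, v) = ε ^ m • g (ε, v) := by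
    have : Tendsto (fun z : V × K => (z.2, z.1)) (𝓝 (v₀, 0)) (𝓝 ((0 : K), v₀)) :=
      (by fun_prop : Continuous fun z : V × K => (z.2, z.1)).tendsto _
    exact (this.eventually hfg).curry_nhds
  have han : ∀ᶠ v in 𝓝 v₀, AnalyticAt K g (0, v) := by
    have : Tendsto (fun v : V => ((0 : K), v)) (𝓝 v₀) (𝓝 (0, v₀)) :=
      (Continuous.prodMk_right (0 : K)).tendsto _
    exact this.eventually hg.eventually_analyticAt
  have hg0 : ∀ᶠ v : V in 𝓝 v₀, g (0, v) = R (0, v) := by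
    filter_upwards [hsw, han] with v h1 h2
    have c1 : Tendsto (fun ε : K => g (ε, v)) (𝓝[≠] 0) (𝓝 (g (0, v))) := by
      have : ContinuousAt (fun ε : K => g (ε, v)) 0 :=
        ContinuousAt.comp (f := fun ε : K => (ε, v)) h2.continuousAt (by fun_prop)
      exact this.tendsto.mono_left nhdsWithin_le_nhds
    refine tendsto_nhds_unique (c1.congr' ?_) (hR0 v)
    filter_upwards [nhdsWithin_le_nhds h1, self_mem_nhdsWithin] with ε e1 e3
    rw [hR ε v e3, e1, smul_smul, inv_mul_cancel₀ (pow_ne_zero _ e3), one_smul]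
  refine hg.congr ?_
  filter_upwards [hfg, (continuous_snd.tendsto ((0 : K), v₀)).eventually hg0] with z h1 h2
  obtain ⟨ε, v⟩ := z
  by_cases h0 : ε = 0
  · rw [h0]; exact h2
  · rw [hR ε v h0, h1, smul_smul, inv_mul_cancel₀ (pow_ne_zero _ h0), one_smul]

/-! ### The rescaled equation and its unique solvability. -/

namespace Ansatz

variable {K : Type*} [RCLike K]
variable {B : Type*} [NormedAddCommGroup B] [NormedSpace K B]
variable {B' : Type*} [NormedAddCommGroup B'] [NormedSpace K B']
variable {G : B → B'} {zbar : ℕ → B} {k : ℕ} {D : Splitting K B B'} (C : Ansatz G zbar k D)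

open Classical in
/-- `ε^{-(2k+1)} G` in terms of the parametrization, continued to `ε = 0`. -/
noncomputable def resid (Λ : D.complProd k ≃L[K] B')
    (q : (K × D.kerProd (linCoeff G zbar k) k) × D.complProd k) : B' :=
  if q.1.1 = 0 then Λ q.2 else (q.1.1 ^ (2 * k + 1))⁻¹ • G (C.point q.1.1 q.2 q.1.2)

variable {Λ : D.complProd k ≃L[K] B'}

theorem resid_zero (n : D.kerProd (linCoeff G zbar k) k) (x : D.complProd k) :
    C.resid Λ ((0, n), x) = Λ x := if_pos rfl

theorem resid_of_ne {ε : K} (hε : ε ≠ 0) (n : D.kerProd (linCoeff G zbar k) k)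
    (x : D.complProd k) :
    C.resid Λ ((ε, n), x) = (ε ^ (2 * k + 1))⁻¹ • G (C.point ε x n) := if_neg hε

theorem resid_eq_zero_iff {ε : K} (hε : ε ≠ 0) (n : D.kerProd (linCoeff G zbar k) k)
    (x : D.complProd k) : C.resid Λ ((ε, n), x) = 0 ↔ G (C.point ε x n) = 0 := by
  rw [resid_of_ne C hε, smul_eq_zero, or_iff_right (inv_ne_zero (pow_ne_zero _ hε))]

variable [CompleteSpace B']

/-- Dividing the estimates of G by ε^(2k+1) leaves one factor ε, which is made smaller than any
given τ. -/
theorem exists_resid_estimate (hG : AnalyticAt K G 0) (hG0 : G 0 = 0)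
    (hΛ : ∀ x : D.complProd k, Λ x = conv (linCoeff (K := K) G zbar k) (relCoeff K (C.M x)) k)
    (r c : ℝ) {τ : NNReal} (hτ : 0 < τ) : ∃ ε₀ > 0, ∀ ε : K, ‖ε‖ < ε₀ →
      ∀ n : D.kerProd (linCoeff G zbar k) k, ‖n‖ ≤ c →
        (∀ x : D.complProd k, ‖x‖ ≤ r → AnalyticAt K G (C.point ε x n)) ∧
        ApproximatesLinearOn (fun x => C.resid Λ ((ε, n), x)) (Λ : D.complProd k →L[K] B')
          (Metric.closedBall 0 r) τ ∧
        ‖C.resid Λ ((ε, n), 0)‖ ≤ τ := by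
  obtain ⟨ε₁, hε₁, c', hc', h⟩ := C.exists_point_estimate hG hG0 hΛ r c
  refine ⟨min ε₁ (τ / (c' + 1)), by positivity, fun ε hε n hn => ?_⟩
  obtain ⟨h1, h2, h3⟩ := h ε (hε.trans_le (min_le_left _ _)) n hn
  have hετ : c' * ‖ε‖ ≤ τ := by
    have := hε.trans_le (min_le_right _ _)
    rw [lt_div_iff₀ (by positivity)] at this
    have := norm_nonneg ε
    nlinarith
  refine ⟨h1, ?_, ?_⟩
  · intro x hx y hy
    rw [mem_closedBall_zero_iff] at hx hy
    by_cases h0 : ε = 0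
    · subst h0
      simp only [resid_zero, ContinuousLinearEquiv.coe_coe, map_sub, sub_self, norm_zero]
      positivity
    · have hp : 0 < ‖ε‖ := norm_pos_iff.2 h0
      have e : C.resid Λ ((ε, n), x) - C.resid Λ ((ε, n), y) - Λ (x - y) =
          (ε ^ (2 * k + 1))⁻¹ • (G (C.point ε x n) - G (C.point ε y n) -
            ε ^ (2 * k + 1) • Λ (x - y)) := by
        rw [resid_of_ne C h0, resid_of_ne C h0, smul_sub, smul_sub, smul_smul,
          inv_mul_cancel₀ (pow_ne_zero _ h0), one_smul]
      simp only [ContinuousLinearEquiv.coe_coe]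
      rw [e, norm_smul, norm_inv, norm_pow, inv_mul_le_iff₀ (by positivity)]
      refine (h2 x y hx hy).trans ?_
      calc c' * ‖ε‖ ^ (2 * k + 2) * ‖x - y‖ = ‖ε‖ ^ (2 * k + 1) * (c' * ‖ε‖ * ‖x - y‖) := by ring
        _ ≤ _ := by gcongr
  · by_cases h0 : ε = 0
    · subst h0
      rw [resid_zero, map_zero, norm_zero]; positivity
    · have hp : 0 < ‖ε‖ := norm_pos_iff.2 h0
      rw [resid_of_ne C h0, norm_smul, norm_inv, norm_pow, inv_mul_le_iff₀ (by positivity)]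
      refine (show ‖G (C.point ε ((0 : D.complProd k) : Fin (k + 1) → B) n)‖ ≤ _ from h3).trans ?_
      calc c' * ‖ε‖ ^ (2 * k + 2) = ‖ε‖ ^ (2 * k + 1) * (c' * ‖ε‖) := by ring
        _ ≤ _ := by gcongr

theorem contDiffAt_resid_of_ne {ε : K} (hε : ε ≠ 0) {n : D.kerProd (linCoeff G zbar k) k}
    {x : D.complProd k} (h : AnalyticAt K G (C.point ε x n)) :
    ContDiffAt K ∞ (C.resid Λ) ((ε, n), x) := by
  have h1 : AnalyticAt K (fun q : (K × D.kerProd (linCoeff G zbar k) k) × D.complProd k =>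
      (q.1.1 ^ (2 * k + 1))⁻¹ • G (C.point q.1.1 q.2 q.1.2)) ((ε, n), x) := by
    have e1 : AnalyticAt K (fun q : (K × D.kerProd (linCoeff G zbar k) k) × D.complProd k =>
        q.1.1) ((ε, n), x) := analyticAt_fst.fun_comp analyticAt_fst
    refine ((e1.pow _).inv (pow_ne_zero _ hε)).smul (AnalyticAt.fun_comp (g := G) h ?_)
    refine C.analyticAt_point e1 ?_ ?_
    · exact ((D.complProd k).subtypeL.analyticAt _).fun_comp analyticAt_snd
    · exact ((D.kerProd (linCoeff G zbar k) k).subtypeL.analyticAt _).fun_comp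
        (analyticAt_snd.fun_comp analyticAt_fst)
  refine h1.contDiffAt.congr_of_eventuallyEq ?_
  have : ∀ᶠ q : (K × D.kerProd (linCoeff G zbar k) k) × D.complProd k in 𝓝 ((ε, n), x),
      q.1.1 ≠ 0 := by
    have : Continuous fun q : (K × D.kerProd (linCoeff G zbar k) k) × D.complProd k => q.1.1 := by
      fun_prop
    exact this.continuousAt.eventually_ne hε
  filter_upwards [this] with q hq
  exact if_neg hq

theorem tendsto_resid (hG : AnalyticAt K G 0) (hG0 : G 0 = 0)
    (hΛ : ∀ x : D.complProd k, Λ x = conv (linCoeff (K := K) G zbar k) (relCoeff K (C.M x)) k)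
    (n : D.kerProd (linCoeff G zbar k) k) (x : D.complProd k) :
    Tendsto (fun ε : K => C.resid Λ ((ε, n), x)) (𝓝[≠] 0) (𝓝 (C.resid Λ ((0, n), x))) := by
  rw [Metric.tendsto_nhds]
  intro η hη
  -- The distance to Λ x is at most τ ‖x‖ (deviation from Λ) plus τ (value at x = 0), strictly below
  -- τ (‖x‖ + 2) = η.
  let τ : NNReal := ⟨η / (‖x‖ + 2), by positivity⟩
  have hτ' : 0 < (τ : ℝ) := (by positivity : 0 < η / (‖x‖ + 2))
  obtain ⟨ε₀, hε₀, hb⟩ := C.exists_resid_estimate hG hG0 hΛ ‖x‖ ‖n‖ (NNReal.coe_pos.1 hτ')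
  have hball : ∀ᶠ ε in 𝓝 (0 : K), ε ∈ Metric.ball (0 : K) ε₀ := Metric.ball_mem_nhds _ hε₀
  filter_upwards [nhdsWithin_le_nhds hball] with ε e2
  obtain ⟨-, b2, b3⟩ := hb ε (mem_ball_zero_iff.1 e2) n le_rfl
  have b4 := b2 x (by simp) 0 (by simp)
  simp only [sub_zero, ContinuousLinearEquiv.coe_coe] at b4
  rw [dist_eq_norm, resid_zero]
  have e4 : C.resid Λ ((ε, n), x) - Λ x =
      (C.resid Λ ((ε, n), x) - C.resid Λ ((ε, n), 0) - Λ x) + C.resid Λ ((ε, n), 0) := by abel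
  have hτη : (τ : ℝ) * (‖x‖ + 2) = η := div_mul_cancel₀ _ (by positivity)
  rw [e4]
  refine (norm_add_le _ _).trans_lt ?_
  nlinarith

theorem contDiffAt_resid_zero (hG : AnalyticAt K G 0) (hG0 : G 0 = 0)
    (hΛ : ∀ x : D.complProd k, Λ x = conv (linCoeff (K := K) G zbar k) (relCoeff K (C.M x)) k)
    (n : D.kerProd (linCoeff G zbar k) k) (x : D.complProd k) :
    ContDiffAt K ∞ (C.resid Λ) ((0, n), x) := by
  have hf : AnalyticAt K
      (fun z : K × D.kerProd (linCoeff (K := K) G zbar k) k × D.complProd k =>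
        G (C.point z.1 z.2.2 z.2.1)) (0, (n, x)) := by
    refine AnalyticAt.fun_comp (g := G) (by simpa [point_zero_left] using hG) ?_
    refine C.analyticAt_point analyticAt_fst ?_ ?_
    · exact ((D.complProd k).subtypeL.analyticAt _).fun_comp
        (analyticAt_snd.fun_comp analyticAt_snd)
    · exact ((D.kerProd (linCoeff G zbar k) k).subtypeL.analyticAt _).fun_comp
        (analyticAt_fst.fun_comp analyticAt_snd)
  have hR : AnalyticAt K (fun z : K × D.kerProd (linCoeff (K := K) G zbar k) k × D.complProd k =>
      C.resid Λ ((z.1, z.2.1), z.2.2)) (0, (n, x)) := by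
    refine analyticAt_of_eq_pow_inv_smul (2 * k + 1) hf ?_ ?_ ?_
    · intro v
      have := C.isBigO_point hG hG0 (x := v.2) (n := v.1) v.2.2 v.1.2
      exact this
    · exact fun ε v hε => C.resid_of_ne hε v.1 v.2
    · exact fun v => C.tendsto_resid hG hG0 hΛ v.1 v.2
  have hσ : AnalyticAt K (fun q : (K × D.kerProd (linCoeff (K := K) G zbar k) k) ×
      D.complProd k => (q.1.1, (q.1.2, q.2))) ((0, n), x) :=
    (analyticAt_fst.fun_comp analyticAt_fst).prod
      ((analyticAt_snd.fun_comp analyticAt_fst).prod analyticAt_snd)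
  have hcomp := AnalyticAt.fun_comp (x := (((0 : K), n), x)) hR hσ
  exact hcomp.contDiffAt

/-- Uniform solvability of the remaining equation. -/
theorem exists_unique_solution [CompleteSpace B] (hD : D.IsDecomposition (linCoeff G zbar k) k)
    (hG : AnalyticAt K G 0) (hG0 : G 0 = 0)
    (hΛ : ∀ x : D.complProd k, Λ x = conv (linCoeff (K := K) G zbar k) (relCoeff K (C.M x)) k)
    {r : ℝ} (hr : 0 < r) (c : ℝ) : ∃ ε₀ > 0, ∀ ε : K, ‖ε‖ < ε₀ →
      ∀ n : D.kerProd (linCoeff G zbar k) k, ‖n‖ ≤ c →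
        ∃ x : D.complProd k, ‖x‖ ≤ r / 2 ∧ C.resid Λ ((ε, n), x) = 0 ∧
          (∀ x', ‖x'‖ ≤ r → C.resid Λ ((ε, n), x') = 0 → x' = x) ∧
          ContDiffAt K ∞ (C.resid Λ) ((ε, n), x) ∧
          (fderiv K (C.resid Λ) ((ε, n), x) ∘L
            ContinuousLinearMap.inr K (K × D.kerProd (linCoeff G zbar k) k)
              (D.complProd k)).IsInvertible := by
  have : CompleteSpace (D.complProd k) := (Adapted.isClosed_complProd hD).completeSpace_coe
  set κ : ℝ := ‖(Λ.symm : B' →L[K] D.complProd k)‖ + 1 with hκ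
  have hκ0 : 0 < κ := by positivity
  -- The first bound gives injectivity and invertibility. The second makes the value at x = 0 small
  -- enough for a zero with ‖x‖ ≤ r / 2. The gap between r / 2 (existence) and r (uniqueness) is
  -- needed later for continuity arguments.
  let τ : NNReal := ⟨min (1 / (2 * κ)) (r / 2 / (2 * κ)), by positivity⟩
  have hτ : 0 < τ :=
    NNReal.coe_pos.1 (by positivity : 0 < min (1 / (2 * κ)) (r / 2 / (2 * κ)))
  have hκτ : κ * τ ≤ 1 / 2 := by
    calc κ * τ ≤ κ * (1 / (2 * κ)) := by
          gcongr
          exact min_le_left _ _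
      _ = 1 / 2 := by field_simp
  obtain ⟨ε₀, hε₀, h⟩ := C.exists_resid_estimate hG hG0 hΛ r c hτ
  refine ⟨ε₀, hε₀, fun ε hε n hn => ?_⟩
  obtain ⟨h1, h2, h3⟩ := h ε hε n hn
  obtain ⟨x, hx, hx0⟩ := exists_eq_of_approximatesLinearOn Λ (b := 0) (ρ := r / 2) (κ := κ)
    (by positivity) (h2.mono_set (Metric.closedBall_subset_closedBall (by linarith)))
    (by linarith) hκ0 hκτ (y := 0) (by
      rw [zero_sub, norm_neg]; exact h3.trans (min_le_right _ _))
  rw [sub_zero] at hx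
  have hcd : ContDiffAt K ∞ (C.resid Λ) ((ε, n), x) := by
    by_cases h0 : ε = 0
    · subst h0
      exact C.contDiffAt_resid_zero hG hG0 hΛ n x
    · exact C.contDiffAt_resid_of_ne h0 (h1 x (by linarith))
  refine ⟨x, hx, hx0, fun x' hx' hx'0 => ?_, hcd, ?_⟩
  · exact h2.eq_of_eq (κ := κ) (by linarith) (by linarith) (by simpa using hx')
      (by rw [mem_closedBall_zero_iff]; linarith) (hx'0.trans hx0.symm)
  · refine isInvertible_of_approximatesLinearOn Λ (x := x) h2 ?_ ?_ (κ := κ) (by linarith)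
      (by linarith)
    · refine Filter.mem_of_superset (Metric.ball_mem_nhds x (by linarith : 0 < r / 2))
        fun v hv => ?_
      rw [mem_closedBall_zero_iff]
      rw [mem_ball_iff_norm] at hv
      have : ‖v‖ ≤ ‖v - x‖ + ‖x‖ := by simpa using norm_add_le (v - x) x
      linarith
    · have d1 := (hcd.differentiableAt (by simp)).hasFDerivAt
      exact HasFDerivAt.comp x d1 (hasFDerivAt_prodMk_right _ _)

end Ansatz

/-! ### Existence and rigidity of solution families. -/

namespace Ansatz

variable {K : Type*} [RCLike K]
variable {B : Type*} [NormedAddCommGroup B] [NormedSpace K B] [CompleteSpace B]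
variable {B' : Type*} [NormedAddCommGroup B'] [NormedSpace K B'] [CompleteSpace B']
variable {G : B → B'} {zbar : ℕ → B} {k : ℕ} {D : Splitting K B B'} (C : Ansatz G zbar k D)
variable {Λ : D.complProd k ≃L[K] B'}

open Classical in
/-- The solution `nᶜ(ε, n)` of the remaining equation in the unit ball. -/
noncomputable def solution (Λ : D.complProd k ≃L[K] B')
    (q : K × D.kerProd (linCoeff G zbar k) k) : D.complProd k :=
  if h : ∃ x : D.complProd k, ‖x‖ ≤ 1 ∧ C.resid Λ (q, x) = 0 then h.choose else 0

/-- One function serves all bounds c: for ε small depending on c, the chosen zero is the only one in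
the unit ball, hence coincides locally with the implicit function. -/
theorem isSolutionFamily_solution (hD : D.IsDecomposition (linCoeff G zbar k) k)
    (hG : AnalyticAt K G 0) (hG0 : G 0 = 0)
    (hΛ : ∀ x : D.complProd k, Λ x = conv (linCoeff (K := K) G zbar k) (relCoeff K (C.M x)) k) :
    C.IsSolutionFamily (C.solution Λ) := by
  have i1 : CompleteSpace (D.complProd k) := (Adapted.isClosed_complProd hD).completeSpace_coe
  have i2 : CompleteSpace (D.kerProd (linCoeff (K := K) G zbar k) k) :=
    (Adapted.isClosed_kerProd D _ k).completeSpace_coe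
  refine ⟨fun n => ?_, fun c hc => ?_⟩
  · rw [solution]
    split_ifs with h
    · have := h.choose_spec.2
      rwa [resid_zero, map_eq_zero_iff Λ Λ.injective] at this
    · rfl
  · obtain ⟨ε₀, hε₀, h⟩ := C.exists_unique_solution hD hG hG0 hΛ one_pos c
    have huniq : ∀ ε : K, ‖ε‖ < ε₀ → ∀ n : D.kerProd (linCoeff (K := K) G zbar k) k, ‖n‖ ≤ c →
        ∀ x : D.complProd k, ‖x‖ ≤ 1 → C.resid Λ ((ε, n), x) = 0 → C.solution Λ (ε, n) = x := by
      intro ε hε n hn x hx hx0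
      have hex : ∃ x : D.complProd k, ‖x‖ ≤ 1 ∧ C.resid Λ ((ε, n), x) = 0 := ⟨x, hx, hx0⟩
      obtain ⟨x₁, -, -, hx₁, -⟩ := h ε hε n hn
      rw [solution, dif_pos hex, hx₁ _ hex.choose_spec.1 hex.choose_spec.2, hx₁ x hx hx0]
    refine ⟨ε₀, hε₀, ?_, ?_⟩
    · rintro ⟨ε, n⟩ ⟨hε, hn⟩
      rw [mem_ball_zero_iff] at hε hn
      obtain ⟨x, hx, hx0, -, hcd, hinv⟩ := h ε hε n hn.le
      have hn0 : (∞ : WithTop ℕ∞) ≠ 0 := by simp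
      have c1 := hcd.contDiffAt_implicitFunction hn0 hinv
      have c2 := hcd.implicitFunction_apply_self hn0 hinv
      have c3 := hcd.eventually_apply_implicitFunction hn0 hinv
      set φ' := hcd.implicitFunction hn0 hinv
      simp only at c1 c2 c3
      refine (c1.congr_of_eventuallyEq ?_).contDiffWithinAt
      -- The zero has norm at most 1/2, so nearby values of the implicit function remain in the unit
      -- ball, where uniqueness applies.
      have c4 : ∀ᶠ q in 𝓝 (ε, n), ‖φ' q‖ < 1 := by
        refine c1.continuousAt.norm.eventually_lt_const ?_
        change ‖φ' (ε, n)‖ < 1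
        rw [c2]; linarith
      have c5 : ∀ᶠ q : K × D.kerProd (linCoeff (K := K) G zbar k) k in 𝓝 (ε, n),
          ‖q.1‖ < ε₀ := by
        have : ContinuousAt (fun q : K × D.kerProd (linCoeff (K := K) G zbar k) k => ‖q.1‖)
          (ε, n) := by fun_prop
        exact this.eventually_lt_const hε
      have c6 : ∀ᶠ q : K × D.kerProd (linCoeff (K := K) G zbar k) k in 𝓝 (ε, n),
          ‖q.2‖ < c := by
        have : ContinuousAt (fun q : K × D.kerProd (linCoeff (K := K) G zbar k) k => ‖q.2‖)
          (ε, n) := by fun_prop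
        exact this.eventually_lt_const hn
      filter_upwards [c3, c4, c5, c6] with q h3 h4 h5 h6
      exact huniq q.1 h5 q.2 h6.le _ h4.le (h3.trans hx0)
    · intro ε hε n hn
      obtain ⟨x, hx, hx0, -⟩ := h ε hε n hn.le
      rw [z, huniq ε hε n hn.le x (by linarith) hx0]
      by_cases h0 : ε = 0
      · rw [h0]
        simp only [point_zero_left, hG0]
      · exact (C.resid_eq_zero_iff h0 n x).1 hx0

/-- Every solution family is uniformly small as `ε → 0`, and it contains all solutions with a
bounded `∏ Nᵢᶜ`-component. -/
theorem IsSolutionFamily.exists_norm_lt (hD : D.IsDecomposition (linCoeff G zbar k) k)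
    (hG : AnalyticAt K G 0) (hG0 : G 0 = 0)
    (hΛ : ∀ x : D.complProd k, Λ x = conv (linCoeff (K := K) G zbar k) (relCoeff K (C.M x)) k)
    {nc : K × D.kerProd (linCoeff G zbar k) k → D.complProd k} (hnc : C.IsSolutionFamily nc)
    {r c : ℝ} (hr : 0 < r) (hc : 0 < c) : ∃ ε₀ > 0,
      ContDiffOn K ∞ nc (Metric.ball (0 : K) ε₀ ×ˢ Metric.ball 0 c) ∧
      ∀ ε : K, ‖ε‖ < ε₀ → ∀ n, ‖n‖ < c → G (C.z nc (ε, n)) = 0 ∧ ‖nc (ε, n)‖ < r ∧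
        (ε ≠ 0 → ∀ x : D.complProd k, ‖x‖ ≤ r → G (C.point ε x n) = 0 → x = nc (ε, n)) := by
  obtain ⟨ε₁, hε₁, h₁⟩ := C.exists_unique_solution hD hG hG0 hΛ hr c
  obtain ⟨ε₂, hε₂, hcd, h₂⟩ := hnc.solves c hc
  have hsm : ∀ ε : K, ‖ε‖ < min ε₁ ε₂ → ∀ n, ‖n‖ < c → ‖nc (ε, n)‖ ≤ r →
      ‖nc (ε, n)‖ ≤ r / 2 := by
    intro ε hε n hn hle
    by_cases h0 : ε = 0
    · rw [h0, hnc.zero, norm_zero]; positivity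
    · obtain ⟨x, hx, -, hu, -⟩ := h₁ ε (hε.trans_le (min_le_left _ _)) n hn.le
      have := h₂ ε (hε.trans_le (min_le_right _ _)) n hn
      rwa [hu (nc (ε, n)) hle ((C.resid_eq_zero_iff h0 n _).2 this)]
  have hlt : ∀ ε : K, ‖ε‖ < min ε₁ ε₂ → ∀ n, ‖n‖ < c → ‖nc (ε, n)‖ < r := by
    intro ε hε n hn
    -- On the segment from 0 to ε the norm of nᶜ starts at 0 and would reach r. It would then take
    -- the value 3r/4, but by `hsm` values up to r are at most r/2.
    by_contra hcon
    push Not at hcon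
    have hte : ∀ t ∈ Set.Icc (0 : ℝ) 1, ‖((t : K) * ε)‖ < min ε₁ ε₂ := by
      intro t ht
      refine lt_of_le_of_lt ?_ hε
      rw [norm_mul, RCLike.norm_ofReal, abs_of_nonneg ht.1]
      exact mul_le_of_le_one_left (norm_nonneg _) ht.2
    have hcont : ContinuousOn (fun t : ℝ => ‖nc ((t : K) * ε, n)‖) (Set.Icc 0 1) := by
      refine ContinuousOn.norm ?_
      refine hcd.continuousOn.comp (f := fun t : ℝ => ((t : K) * ε, n)) ?_ ?_
      · have : Continuous fun t : ℝ => ((t : K) * ε, n) := by fun_prop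
        exact this.continuousOn
      · intro t ht
        exact ⟨mem_ball_zero_iff.2 ((hte t ht).trans_le (min_le_right _ _)),
          mem_ball_zero_iff.2 hn⟩
    have hiv := intermediate_value_Icc zero_le_one hcont
    obtain ⟨t, ht, hte'⟩ := hiv (show 3 * r / 4 ∈ _ by
      constructor
      · simp only [RCLike.ofReal_zero, zero_mul, hnc.zero, norm_zero]; positivity
      · simp only [RCLike.ofReal_one, one_mul]; linarith)
    have := hsm _ (hte t ht) n hn (by simp only at hte'; linarith)
    simp only at hte'
    linarith
  refine ⟨min ε₁ ε₂, by positivity, hcd.mono (Set.prod_mono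
    (Metric.ball_subset_ball (min_le_right _ _)) subset_rfl), fun ε hε n hn => ⟨?_, ?_, ?_⟩⟩
  · exact h₂ ε (hε.trans_le (min_le_right _ _)) n hn
  · exact hlt ε hε n hn
  · intro h0 x hx hx0
    obtain ⟨x₁, -, -, hu, -⟩ := h₁ ε (hε.trans_le (min_le_left _ _)) n hn.le
    rw [hu x hx ((C.resid_eq_zero_iff h0 n _).2 hx0),
      hu (nc (ε, n)) (hlt ε hε n hn).le ((C.resid_eq_zero_iff h0 n _).2
        (h₂ ε (hε.trans_le (min_le_right _ _)) n hn))]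

end Ansatz

/-! ### Families of maps close to a linear limit. -/

section Family

variable {K : Type*} [RCLike K]
variable {E : Type*} [NormedAddCommGroup E] [NormedSpace K E]
variable {F : Type*} [NormedAddCommGroup F] [NormedSpace K F]

/-- Strict differentiability at the origin, used for increments in β alone: the partial derivative
there is determined by the affine function g (0, ·). -/
theorem exists_ball_approximatesLinearOn {g : K × K → F} (hg : ContDiff K 1 g) {v w : F}
    (h : ∀ β, g (0, β) = β • v + w) {τ : ℝ} (hτ : 0 < τ) : ∃ η > 0, ∀ ε β β' : K,
      ‖ε‖ < η → ‖β‖ < η → ‖β'‖ < η → ‖g (ε, β) - g (ε, β') - (β - β') • v‖ ≤ τ * ‖β - β'‖ := by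
  have h1 : HasStrictFDerivAt g (fderiv K g 0) 0 :=
    hg.contDiffAt.hasStrictFDerivAt one_ne_zero
  obtain ⟨s, hs, hs'⟩ := h1.approximates_deriv_on_nhds (c := ⟨τ, hτ.le⟩)
    (Or.inr (NNReal.coe_pos.1 hτ))
  obtain ⟨η, hη, hηs⟩ := Metric.mem_nhds_iff.1 hs
  have h2 : ∀ β : K, fderiv K g 0 (0, β) = β • v := by
    have e1 : HasFDerivAt (fun β : K => g (0, β))
        (fderiv K g 0 ∘L ContinuousLinearMap.inr K K K) 0 :=
      HasFDerivAt.comp (f := fun β : K => ((0 : K), β)) (0 : K) h1.hasFDerivAt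
        (hasFDerivAt_prodMk_right _ _)
    have e2 : HasFDerivAt (fun β : K => g (0, β))
        (ContinuousLinearMap.smulRight (1 : K →L[K] K) v) 0 := by
      simp_rw [h]
      exact (ContinuousLinearMap.hasFDerivAt
        (ContinuousLinearMap.smulRight (1 : K →L[K] K) v)).add_const w
    intro β
    simpa using congrArg (fun T => T β) (e1.unique e2)
  refine ⟨η, hη, fun ε β β' hε hβ hβ' => ?_⟩
  have hmem : ∀ β : K, ‖β‖ < η → (ε, β) ∈ s := fun β hβ => hηs (by
    rw [mem_ball_zero_iff]; exact max_lt hε hβ)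
  have := hs' _ (hmem β hβ) _ (hmem β' hβ')
  rw [Prod.mk_sub_mk, sub_self, h2] at this
  simp only [Prod.norm_def, norm_zero, max_eq_right (norm_nonneg (β - β'))] at this
  exact this

/-- A family of maps, affine in the second variable, close to its linear limit. -/
theorem exists_approximatesLinearOn_family {g₀ : K × K → F} {g₁ : K × K → E →L[K] F}
    (h₀ : ContDiff K 1 g₀) (h₁ : ContDiff K 1 g₁) {v w : F} {T : E →L[K] F}
    (e₀ : ∀ β, g₀ (0, β) = β • v + w) (e₁ : ∀ β, g₁ (0, β) = T) {Λ : K × E →L[K] F}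
    (hΛ : ∀ β u, Λ (β, u) = β • v + T u) (ρ : ℝ) {τ : NNReal} (hτ : 0 < τ) :
    ∃ η > 0, ∀ ε : K, ‖ε‖ < η →
      ApproximatesLinearOn (fun q : K × E => g₀ (ε, q.1) + g₁ (ε, q.1) q.2) Λ
        {q | ‖q.1‖ < η ∧ ‖q.2‖ ≤ ρ} τ := by
  -- The three errors below are bounded by σ, σ |ρ| and σ times the increment, which add up to τ.
  let σ : ℝ := τ / (2 + |ρ|)
  have hτ' : 0 < (τ : ℝ) := hτ
  have hσ : 0 < σ := by positivity
  obtain ⟨η₀, hη₀, b₀⟩ := exists_ball_approximatesLinearOn h₀ e₀ hσ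
  obtain ⟨η₁, hη₁, b₁⟩ := exists_ball_approximatesLinearOn (v := 0) (w := T) h₁
    (by simpa using e₁) hσ
  have hc : ∀ᶠ q in 𝓝 (0 : K × K), ‖g₁ q - T‖ < σ := by
    have : ContinuousAt (fun q => ‖g₁ q - T‖) 0 := by
      have := h₁.continuous
      fun_prop
    refine this.eventually_lt_const ?_
    simpa [show g₁ 0 = T from e₁ 0] using hσ
  obtain ⟨η₂, hη₂, b₂⟩ := Metric.eventually_nhds_iff_ball.1 hc
  refine ⟨min η₀ (min η₁ η₂), by positivity, fun ε hε => ?_⟩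
  rintro ⟨β, u⟩ ⟨hβ, hu⟩ ⟨β', u'⟩ ⟨hβ', hu'⟩
  simp only [lt_min_iff] at hε hβ hβ' hu hu'
  have a₀ := b₀ ε β β' hε.1 hβ.1 hβ'.1
  have a₁ := b₁ ε β β' hε.2.1 hβ.2.1 hβ'.2.1
  have a₂ := b₂ (ε, β') (by rw [mem_ball_zero_iff]; exact max_lt hε.2.2 hβ'.2.2)
  rw [smul_zero, sub_zero] at a₁
  have e : g₀ (ε, β) + g₁ (ε, β) u - (g₀ (ε, β') + g₁ (ε, β') u') - Λ (β - β', u - u') =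
      (g₀ (ε, β) - g₀ (ε, β') - (β - β') • v) + (g₁ (ε, β) - g₁ (ε, β')) u +
        (g₁ (ε, β') - T) (u - u') := by
    rw [hΛ]
    simp only [_root_.sub_apply, map_sub]
    abel
  simp only [Prod.mk_sub_mk]
  rw [e]
  have n₁ : ‖β - β'‖ ≤ ‖(β - β', u - u')‖ := norm_fst_le (β - β', u - u')
  have n₂ : ‖u - u'‖ ≤ ‖(β - β', u - u')‖ := norm_snd_le (β - β', u - u')
  set n := ‖(β - β', u - u')‖
  calc _ ≤ σ * n + σ * n * |ρ| + σ * n := by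
        refine norm_add₃_le.trans (add_le_add_three ?_ ?_ ?_)
        · exact a₀.trans (by gcongr)
        · refine (ContinuousLinearMap.le_opNorm _ _).trans ?_
          have : ‖u‖ ≤ |ρ| := hu.trans (le_abs_self ρ)
          gcongr
          exact a₁.trans (by gcongr)
        · refine (ContinuousLinearMap.le_opNorm _ _).trans ?_
          gcongr
    _ = σ * (2 + |ρ|) * n := by ring
    _ = τ * n := by rw [div_mul_cancel₀ _ (by positivity)]

end Family

/-! ### The direct sum decomposition of B as an isomorphism. -/

section DirectSum

variable {K : Type*} [RCLike K]
variable {B : Type*} [NormedAddCommGroup B] [NormedSpace K B]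
variable {B' : Type*} [NormedAddCommGroup B'] [NormedSpace K B']
variable {D : Splitting K B B'} {A : ℕ → B →L[K] B'} {k : ℕ}

namespace Splitting.IsDecomposition

theorem exists_sum_eq (hD : D.IsDecomposition A k) (v : B) {i : ℕ} (hi : i ≤ k + 1) :
    ∃ y : ℕ → B, (∀ j < i, y j ∈ D.Nc (j + 1)) ∧ ∃ n ∈ D.N A i,
      v = ∑ j ∈ Finset.range i, y j + n := by
  induction i with
  | zero => exact ⟨0, by simp, v, by simp [N], by simp⟩
  | succ i ih =>
    obtain ⟨y, hy, n, hn, hv⟩ := ih (by omega)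
    rw [← hD.sup_N i (by omega)] at hn
    obtain ⟨a, ha, b, hb, rfl⟩ := Submodule.mem_sup.1 hn
    refine ⟨Function.update y i a, fun j hj => ?_, b, hb, ?_⟩
    · rcases Nat.lt_succ_iff_lt_or_eq.1 hj with h | rfl
      · rw [Function.update_of_ne h.ne]; exact hy j h
      · simpa using ha
    · rw [hv, Finset.sum_range_succ, Function.update_self, add_assoc]
      congr 1
      refine Finset.sum_congr rfl fun j hj => ?_
      rw [Function.update_of_ne (Finset.mem_range.1 hj).ne]

theorem eq_zero_of_sum_eq_zero (hD : D.IsDecomposition A k) {y : ℕ → B} {i : ℕ} :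
    i ≤ k + 1 → ∀ n ∈ D.N A i, (∀ j < i, y j ∈ D.Nc (j + 1)) →
      ∑ j ∈ Finset.range i, y j + n = 0 → n = 0 ∧ ∀ j < i, y j = 0 := by
  induction i with
  | zero => intro _ n _ _ h; simpa using h
  | succ i ih =>
    intro hi n hn hy h
    rw [Finset.sum_range_succ, add_assoc] at h
    obtain ⟨h1, h2⟩ := ih (by omega) (y i + n)
      (add_mem (hD.Nc_le (by omega) (hy i (by omega))) (D.N_succ_le A i hn))
      (fun j hj => hy j (by omega)) h
    have h3 : n = 0 := by
      refine Submodule.disjoint_def.1 (hD.disjoint_N i (by omega)) n ?_ hn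
      rw [eq_neg_of_add_eq_zero_right h1]
      exact neg_mem (hy i (by omega))
    refine ⟨h3, fun j hj => ?_⟩
    rcases Nat.lt_succ_iff_lt_or_eq.1 hj with h' | rfl
    · exact h2 j h'
    · rwa [h3, add_zero] at h1

/-- `B = span {zₗ} ⊕ N₁ᶜ ⊕ ⋯ ⊕ N_{k+1}ᶜ ⊕ P`. -/
theorem exists_sum_equiv [CompleteSpace B] (hD : D.IsDecomposition A k) {P : Submodule K B}
    (hPc : IsClosed (P : Set B)) {v : B} (hv : v ≠ 0) (hPsup : P ⊔ Submodule.span K {v} =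
      D.N A (k + 1)) (hPdisj : Disjoint P (Submodule.span K {v}))
    {a b : K} {e : Fin (k + 1) → K} (ha : a ≠ 0) (hb : b ≠ 0) (he : ∀ i, e i ≠ 0)
    {f : K × (D.complProd k × P) →L[K] B}
    (hf : ∀ β (y : D.complProd k) (p : P), f (β, (y, p)) =
      β • (a • v) + ((∑ i, e i • (y : Fin (k + 1) → B) i) + b • (p : B))) :
    ∃ Λ : (K × (D.complProd k × P)) ≃L[K] B, (Λ : K × (D.complProd k × P) →L[K] B) = f := by
  have i1 : CompleteSpace (D.complProd k) := (Adapted.isClosed_complProd hD).completeSpace_coe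
  have i2 : CompleteSpace P := hPc.completeSpace_coe
  refine ⟨ContinuousLinearEquiv.ofBijective f (LinearMap.ker_eq_bot'.2 ?_)
    (LinearMap.range_eq_top.2 fun w => ?_), ?_⟩
  · rintro ⟨β, y, p⟩ h
    have h' : f (β, (y, p)) = 0 := h
    rw [hf] at h'
    let Y : ℕ → B := fun j => if h : j < k + 1 then e ⟨j, h⟩ • (y : Fin (k + 1) → B) ⟨j, h⟩ else 0
    have hY : ∑ i, e i • (y : Fin (k + 1) → B) i = ∑ j ∈ Finset.range (k + 1), Y j := by
      rw [Finset.sum_range]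
      exact Finset.sum_congr rfl fun i _ => by simp only [Y, dif_pos i.2, Fin.eta]
    have hn : β • (a • v) + b • (p : B) ∈ D.N A (k + 1) := by
      rw [← hPsup]
      exact add_mem ((le_sup_right : _ ≤ P ⊔ Submodule.span K {v})
        (Submodule.smul_mem _ _ (Submodule.smul_mem _ _ (Submodule.mem_span_singleton_self v))))
        ((le_sup_left : P ≤ P ⊔ Submodule.span K {v}) (Submodule.smul_mem _ _ p.2))
    obtain ⟨h1, h2⟩ := hD.eq_zero_of_sum_eq_zero (y := Y) le_rfl _ hn (fun j hj => by
        simp only [Y, dif_pos hj]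
        exact Submodule.smul_mem _ _ (Splitting.mem_complProd.1 y.2 ⟨j, hj⟩)) (by
        rw [← hY, ← h']; abel)
    have hp : b • (p : B) = 0 := by
      refine Submodule.disjoint_def.1 hPdisj _ (Submodule.smul_mem _ _ p.2) ?_
      rw [eq_neg_of_add_eq_zero_right h1]
      exact neg_mem (Submodule.smul_mem _ _
        (Submodule.smul_mem _ _ (Submodule.mem_span_singleton_self v)))
    rw [hp, add_zero] at h1
    have e1 : β = 0 := by
      rcases smul_eq_zero.1 h1 with h | h
      · exact h
      · exact absurd h (smul_ne_zero ha hv)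
    have e2 : p = 0 := Subtype.ext ((smul_eq_zero.1 hp).resolve_left hb)
    have e3 : y = 0 := by
      refine Subtype.ext (funext fun i => ?_)
      have := h2 i i.2
      simp only [Y, dif_pos i.2] at this
      exact (smul_eq_zero.1 this).resolve_left (he i)
    rw [e1, e2, e3]; rfl
  · obtain ⟨Y, hY, n, hn, hw⟩ := hD.exists_sum_eq w le_rfl
    rw [← hPsup] at hn
    obtain ⟨p, hp, q, hq, rfl⟩ := Submodule.mem_sup.1 hn
    obtain ⟨t, rfl⟩ := Submodule.mem_span_singleton.1 hq
    refine ⟨(t * a⁻¹, (⟨fun i => (e i)⁻¹ • Y i, Splitting.mem_complProd.2 fun i =>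
      Submodule.smul_mem _ _ (hY i i.2)⟩, ⟨b⁻¹ • p, Submodule.smul_mem _ _ hp⟩)), ?_⟩
    change f _ = w
    rw [hf, hw, Finset.sum_range, smul_smul, mul_assoc, inv_mul_cancel₀ ha, mul_one, smul_smul,
      mul_inv_cancel₀ hb, one_smul]
    have : ∀ i : Fin (k + 1), e i • (e i)⁻¹ • Y i = Y i := fun i => by
      rw [smul_smul, mul_inv_cancel₀ (he i), one_smul]
    simp only [this]
    abel
  · ext q <;> rfl

end Splitting.IsDecomposition

end DirectSum

/-! ### Rescaling of the complement coordinates by powers of ε. -/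

section Scaling

variable {K : Type*} [RCLike K]
variable {B : Type*} [NormedAddCommGroup B] [NormedSpace K B]
variable {B' : Type*} [NormedAddCommGroup B'] [NormedSpace K B']
variable {k : ℕ}

theorem ev_eq_sum (ε : K) (y : Fin (k + 1) → B) :
    ev B k ε y = ∑ i : Fin (k + 1), (ε ^ (k - (i : ℕ)) * ((2 * k + 1 - i)! : K)⁻¹) • y i := by
  rw [ev_apply, Finset.sum_range, ← Equiv.sum_comp Fin.revPerm]
  refine Finset.sum_congr rfl fun i _ => ?_
  have h : ((Fin.revPerm i : Fin (k + 1)) : ℕ) = k - i := by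
    simp only [Fin.revPerm_apply, Fin.val_rev]; omega
  rw [h, relCoeff, if_pos (by omega), smul_smul]
  congr 3
  · congr 2; omega
  · omega

theorem ev_zero (y : Fin (k + 1) → B) :
    ev B k (0 : K) y = ((k + 1)! : K)⁻¹ • y (Fin.last k) := by
  rw [ev_eq_sum, Finset.sum_eq_single (Fin.last k)]
  · simp only [Fin.val_last, Nat.sub_self, pow_zero, one_mul]
    congr 4; omega
  · intro i _ hi
    have : k - (i : ℕ) ≠ 0 := by
      have := Fin.val_lt_last hi
      omega
    rw [zero_pow this, zero_mul, zero_smul]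
  · simp

/-- The operator `y ↦ (εᵏ y₀, …, ε y_{k-1}, y_k)` on `N₁ᶜ × ⋯ × N_{k+1}ᶜ`. -/
noncomputable def scale (D : Splitting K B B') (k : ℕ) (ε : K) :
    D.complProd k →L[K] D.complProd k :=
  ContinuousLinearMap.codRestrict
    ((ContinuousLinearMap.pi fun j : Fin (k + 1) =>
      ε ^ (k - (j : ℕ)) • (ContinuousLinearMap.proj j : (Fin (k + 1) → B) →L[K] B)) ∘L
      (D.complProd k).subtypeL) (D.complProd k) fun x => Splitting.mem_complProd.2 fun i =>
        Submodule.smul_mem _ _ (Splitting.mem_complProd.1 x.2 i)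

variable {D : Splitting K B B'}

theorem scale_apply (ε : K) (x : D.complProd k) (j : Fin (k + 1)) :
    (scale D k ε x : Fin (k + 1) → B) j = ε ^ (k - (j : ℕ)) • (x : Fin (k + 1) → B) j := rfl

theorem scale_scale_inv {ε : K} (hε : ε ≠ 0) (x : D.complProd k) :
    scale D k ε (scale D k ε⁻¹ x) = x := by
  refine Subtype.ext (funext fun j => ?_)
  rw [scale_apply, scale_apply, smul_smul, ← mul_pow, mul_inv_cancel₀ hε, one_pow, one_smul]

/-- `scale D k ε` as an isomorphism, for `ε ≠ 0`. -/
noncomputable def scaleEquiv (D : Splitting K B B') (k : ℕ) {ε : K} (hε : ε ≠ 0) :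
    D.complProd k ≃L[K] D.complProd k :=
  ContinuousLinearEquiv.equivOfInverse (scale D k ε) (scale D k ε⁻¹)
    (fun x => by simpa using scale_scale_inv (inv_ne_zero hε) x) (scale_scale_inv hε)

theorem norm_scale_le {ε : K} (hε : ‖ε‖ ≤ 1) (x : D.complProd k) : ‖scale D k ε x‖ ≤ ‖x‖ := by
  rw [Submodule.coe_norm, Submodule.coe_norm, pi_norm_le_iff_of_nonneg (norm_nonneg _)]
  intro j
  rw [scale_apply, norm_smul, norm_pow]
  exact (mul_le_of_le_one_left (norm_nonneg _) (pow_le_one₀ (norm_nonneg _) hε)).trans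
    (norm_le_pi_norm _ j)

/-- The operator `ev (ε θ) ∘ M ∘ (scale ε)⁻¹`, continued to `ε = 0`. -/
noncomputable def evScaled (M : (Fin (k + 1) → B) →L[K] (Fin (k + 1) → B)) (ε θ : K) :
    (Fin (k + 1) → B) →L[K] B :=
  ∑ i : Fin (k + 1), ∑ j : Fin (k + 1),
    (ε ^ ((j : ℕ) - (i : ℕ)) * θ ^ (k - (i : ℕ)) * ((2 * k + 1 - i)! : K)⁻¹) •
      ((ContinuousLinearMap.proj i : (Fin (k + 1) → B) →L[K] B) ∘L M ∘L
        ContinuousLinearMap.single K (fun _ => B) j ∘L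
        (ContinuousLinearMap.proj j : (Fin (k + 1) → B) →L[K] B))

theorem evScaled_apply (M : (Fin (k + 1) → B) →L[K] (Fin (k + 1) → B)) (ε θ : K)
    (y : Fin (k + 1) → B) : evScaled M ε θ y = ∑ i : Fin (k + 1), ∑ j : Fin (k + 1),
      (ε ^ ((j : ℕ) - (i : ℕ)) * θ ^ (k - (i : ℕ)) * ((2 * k + 1 - i)! : K)⁻¹) •
        M (Pi.single j (y j)) i := by
  simp [evScaled, _root_.sum_apply]

theorem contDiff_evScaled {W : Type*} [NormedAddCommGroup W] [NormedSpace K W]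
    (M : (Fin (k + 1) → B) →L[K] (Fin (k + 1) → B)) {n : WithTop ℕ∞} {a b : W → K}
    (ha : ContDiff K n a) (hb : ContDiff K n b) : ContDiff K n fun q => evScaled M (a q) (b q) := by
  unfold evScaled; fun_prop

/-- Entry (i, j) of M carries ε^(k-i) from `ev`, and rescaling x_j removes ε^(k-j). Upper
triangularity leaves only j ≥ i, so no negative power occurs and the expression makes sense at ε =
0. The truncated exponent for j < i multiplies a zero block. -/
theorem UpperTriangular.ev_mul_eq {c : Fin (k + 1) → K}
    {M : (Fin (k + 1) → B) →L[K] (Fin (k + 1) → B)} (hM : UpperTriangular c M) (ε θ : K)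
    (x : D.complProd k) :
    ev B k (ε * θ) (M x) = evScaled M ε θ (scale D k ε x : Fin (k + 1) → B) := by
  have hx : M (x : Fin (k + 1) → B) = ∑ j, M (Pi.single j ((x : Fin (k + 1) → B) j)) := by
    rw [← map_sum, Finset.univ_sum_single]
  rw [ev_eq_sum, evScaled_apply]
  refine Finset.sum_congr rfl fun i _ => ?_
  rw [hx, Finset.sum_apply, Finset.smul_sum]
  refine Finset.sum_congr rfl fun j _ => ?_
  rcases lt_or_ge j i with h | h
  · rw [hM.apply_single_of_lt h, hM.apply_single_of_lt h, smul_zero, smul_zero]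
  · have h' : (i : ℕ) ≤ j := h
    rw [scale_apply, Pi.single_smul, map_smul, Pi.smul_apply, smul_smul]
    congr 1
    rw [mul_pow, show k - (i : ℕ) = ((j : ℕ) - i) + (k - j) by omega, pow_add ε]
    ring

theorem UpperTriangular.evScaled_zero_one {c : Fin (k + 1) → K}
    {M : (Fin (k + 1) → B) →L[K] (Fin (k + 1) → B)} (hM : UpperTriangular c M)
    (y : Fin (k + 1) → B) :
    evScaled M 0 1 y = ∑ i : Fin (k + 1), (((2 * k + 1 - i)! : K)⁻¹ * c i) • y i := by
  rw [evScaled_apply]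
  refine Finset.sum_congr rfl fun i _ => ?_
  rw [Finset.sum_eq_single i]
  · rw [hM.apply_single, smul_smul]; simp
  · intro j _ hj
    rcases lt_or_gt_of_ne hj with h | h
    · rw [hM.apply_single_of_lt h, smul_zero]
    · have : (j : ℕ) - i ≠ 0 := by have : (i : ℕ) < j := h; omega
      rw [zero_pow this, zero_mul, zero_mul, zero_smul]
  · simp

theorem contDiff_smul_comp_add_comp {V : Type*} [NormedAddCommGroup V] [NormedSpace K V]
    {E : Type*} [NormedAddCommGroup E] [NormedSpace K E]
    {F : Type*} [NormedAddCommGroup F] [NormedSpace K F] {W : Type*} [NormedAddCommGroup W]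
    [NormedSpace K W] {n : WithTop ℕ∞} {t : W → K} {a b : W → V →L[K] F} (ht : ContDiff K n t)
    (ha : ContDiff K n a) (hb : ContDiff K n b) (S T : E →L[K] V) :
    ContDiff K n fun q => t q • (a q ∘L S + b q ∘L T) :=
  ht.smul ((ha.clm_comp contDiff_const).add (hb.clm_comp contDiff_const))

end Scaling

/-! ### Blow-up of the wedge at the scale ε^(k+1). -/

namespace Ansatz

variable {K : Type*} [RCLike K]
variable {B : Type*} [NormedAddCommGroup B] [NormedSpace K B]
variable {B' : Type*} [NormedAddCommGroup B'] [NormedSpace K B']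
variable {G : B → B'} {zbar : ℕ → B} {k : ℕ} {D : Splitting K B B'} (C : Ansatz G zbar k D)
variable {P : Submodule K B} (l : ℕ)

/-- The factor `θ` of the reparametrization `ε' = ε θ = ε + ε^{k+2-l} β`. -/
def theta (k l : ℕ) (q : K × K) : K := 1 + q.1 ^ (k + 1 - l) * q.2

theorem contDiff_theta (k l : ℕ) {n : WithTop ℕ∞} :
    ContDiff K n (fun q : K × K => theta k l q) := by
  unfold theta; fun_prop

/-- The part of `blowup` that does not depend on `nᶜ` and `p`. -/
noncomputable def blowupConst (q : K × K) : B :=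
  ∑ j ∈ Finset.Icc l k, (q.1 ^ (j - l) * (j ! : K)⁻¹ *
      (q.2 * ∑ m ∈ Finset.range j, theta k l q ^ m)) • zbar j +
    theta k l q ^ (k + 1) • ev B k (q.1 * theta k l q) C.I

/-- The part of `blowup` that is linear in `nᶜ` and `p`. -/
noncomputable def blowupLin (P : Submodule K B) (q : K × K) : D.complProd k × P →L[K] B :=
  theta k l q ^ (k + 1) •
    (evScaled C.M.toContinuousLinearMap q.1 (theta k l q) ∘L
        ((D.complProd k).subtypeL ∘L ContinuousLinearMap.fst K (D.complProd k) P) +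
      ev B k (q.1 * theta k l q) ∘L (C.M.toContinuousLinearMap ∘L C.L.toContinuousLinearMap ∘L
        ContinuousLinearMap.single K (fun _ => B) (Fin.last k) ∘L P.subtypeL ∘L
          ContinuousLinearMap.snd K (D.complProd k) P))

/-- The wedge at the scale `ε^{k+1}`, in the coordinates `β`, `scale ε nᶜ` and `p`. -/
noncomputable def blowup (ε : K) (q : K × (D.complProd k × P)) : B :=
  C.blowupConst l (ε, q.1) + C.blowupLin l P (ε, q.1) q.2

theorem contDiff_blowupConst {n : WithTop ℕ∞} : ContDiff K n (C.blowupConst l) := by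
  have h1 := contDiff_theta (K := K) k l (n := n)
  have h2 : ContDiff K n (fun q : K × K => ev B k (q.1 * theta k l q)) :=
    (contDiff_ev k).comp (contDiff_fst.mul h1)
  unfold blowupConst
  fun_prop

theorem contDiff_blowupLin {n : WithTop ℕ∞} : ContDiff K n (C.blowupLin l P) := by
  have h1 := contDiff_theta (K := K) k l (n := n)
  have h2 : ContDiff K n (fun q : K × K => ev B k (q.1 * theta k l q)) :=
    (contDiff_ev k).comp (contDiff_fst.mul h1)
  have h3 : ContDiff K n (fun q : K × K =>
      evScaled C.M.toContinuousLinearMap q.1 (theta k l q)) :=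
    contDiff_evScaled _ contDiff_fst h1
  exact contDiff_smul_comp_add_comp (h1.pow (k + 1)) h3 h2 _ _

theorem coe_lastTuple (hP : P ≤ D.N (linCoeff G zbar k) (k + 1)) (p : P) :
    (D.lastTuple (linCoeff G zbar k) hP p : Fin (k + 1) → B) = Pi.single (Fin.last k) (p : B) :=
  rfl

/-- The exponent in `theta` is chosen so that (εθ)^j - ε^j is ε^(k+1) ε^(j-l) β times a geometric
sum. The first nonzero coefficient z̄_l then moves exactly at the order of the other parameters. -/
theorem point_mul_theta (hl1 : 1 ≤ l) (hlk : l ≤ k) (hlmin : ∀ j, 1 ≤ j → j < l → zbar j = 0)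
    (ε β : K) (x : D.complProd k) (p : P) :
    C.point (ε * theta k l (ε, β)) x (Pi.single (Fin.last k) (p : B)) =
      arc zbar k ε + ε ^ (k + 1) • C.blowup l ε (β, (scale D k ε x, p)) := by
  obtain ⟨c, hc, hM⟩ := C.triangular_M
  have hM : UpperTriangular c C.M.toContinuousLinearMap := hM
  set θ := theta k l (ε, β) with hθ
  have harc : ∀ ε : K, arc zbar k ε = ∑ j ∈ Finset.Icc l k, (ε ^ j / (j ! : K)) • zbar j := by
    intro ε
    refine (Finset.sum_subset (Finset.Icc_subset_Icc_left hl1) fun j hj hj' => ?_).symm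
    rw [Finset.mem_Icc] at hj hj'
    rw [hlmin j hj.1 (by omega), smul_zero]
  have h1 : arc zbar k (ε * θ) = arc zbar k ε + ε ^ (k + 1) •
      ∑ j ∈ Finset.Icc l k, (ε ^ (j - l) * (j ! : K)⁻¹ *
        (β * ∑ m ∈ Finset.range j, θ ^ m)) • zbar j := by
    rw [harc, harc, Finset.smul_sum, ← Finset.sum_add_distrib]
    refine Finset.sum_congr rfl fun j hj => ?_
    have hj := Finset.mem_Icc.1 hj
    rw [smul_smul, ← add_smul]
    congr 1
    have e1 : θ ^ j = (∑ m ∈ Finset.range j, θ ^ m) * (ε ^ (k + 1 - l) * β) + 1 := by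
      have := geom_sum_mul θ j
      rw [show θ - 1 = ε ^ (k + 1 - l) * β by rw [hθ, theta]; ring] at this
      rw [this]; ring
    have e2 : ε ^ (k + 1) * ε ^ (j - l) = ε ^ j * ε ^ (k + 1 - l) := by
      rw [← pow_add, ← pow_add]; congr 1; omega
    rw [mul_pow, e1, div_eq_mul_inv]
    linear_combination (-(j ! : K)⁻¹ * β * ∑ m ∈ Finset.range j, θ ^ m) * e2
  rw [point_eq, h1, blowup, blowupConst, blowupLin, map_add C.M, map_add, map_add,
    show C.M (x : Fin (k + 1) → B) = C.M.toContinuousLinearMap x from rfl, hM.ev_mul_eq]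
  simp only [← hθ, mul_pow, smul_add, mul_smul, ContinuousLinearMap.comp_apply,
    _root_.add_apply, _root_.smul_apply]
  simp only [add_assoc]
  rfl

/-- The linear part of `blowup` at `ε = 0`. -/
theorem exists_blowup_equiv [CompleteSpace B] (hD : D.IsDecomposition (linCoeff G zbar k) k)
    (hl1 : 1 ≤ l) (hlk : l ≤ k) (hl : zbar l ≠ 0) (hPc : IsClosed (P : Set B))
    (hPsup : P ⊔ Submodule.span K {zbar l} = D.N (linCoeff G zbar k) (k + 1))
    (hPdisj : Disjoint P (Submodule.span K {zbar l})) :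
    ∃ Λ : (K × (D.complProd k × P)) ≃L[K] B, ∀ (ρ : ℝ) (τ : NNReal), 0 < τ → ∃ η > 0,
      ∀ ε : K, ‖ε‖ < η →
        ApproximatesLinearOn (C.blowup (P := P) l ε) (Λ : K × (D.complProd k × P) →L[K] B)
          {q | ‖q.1‖ < η ∧ ‖q.2‖ ≤ ρ} τ := by
  obtain ⟨c, hc, hM⟩ := C.triangular_M
  obtain ⟨d, hd, hL⟩ := C.triangular_L
  have hM' : UpperTriangular c C.M.toContinuousLinearMap := hM
  have hθ : ∀ β : K, theta k l (0, β) = 1 := fun β => by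
    simp [theta, show k + 1 - l ≠ 0 by omega]
  -- At ε = 0 only j = l survives and θ = 1, so the geometric sum equals l.
  have e₀ : ∀ β : K, C.blowupConst l (0, β) =
      β • (((l : K) * (l ! : K)⁻¹) • zbar l) + ev B k (0 : K) C.I := by
    intro β
    rw [blowupConst, hθ, one_pow, one_smul, mul_one,
      Finset.sum_eq_single_of_mem l (Finset.mem_Icc.2 ⟨le_rfl, hlk⟩)]
    · simp only [Nat.sub_self, pow_zero, one_pow, Finset.sum_const, Finset.card_range, smul_smul,
        nsmul_eq_mul]
      congr 2; ring
    · intro j hj hjl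
      have := Finset.mem_Icc.1 hj
      rw [zero_pow (by omega), zero_mul, zero_mul, zero_smul]
  have e₁ : ∀ β : K, C.blowupLin l P (0, β) = C.blowupLin l P (0, 0) := by
    intro β
    simp only [blowupLin, hθ]
  let f : K × (D.complProd k × P) →L[K] B :=
    (ContinuousLinearMap.fst K K (D.complProd k × P)).smulRight
      (((l : K) * (l ! : K)⁻¹) • zbar l) +
    C.blowupLin l P (0, 0) ∘L ContinuousLinearMap.snd K K (D.complProd k × P)
  obtain ⟨Λ, hΛ⟩ := hD.exists_sum_equiv hPc hl hPsup hPdisj (a := (l : K) * (l ! : K)⁻¹)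
    (b := ((k + 1)! : K)⁻¹ * (c (Fin.last k) * d (Fin.last k)))
    (e := fun i => ((2 * k + 1 - i)! : K)⁻¹ * c i) (f := f)
    (mul_ne_zero (by exact_mod_cast (by omega : l ≠ 0)) (inv_ne_zero (factorial_ne_zero' _)))
    (mul_ne_zero (inv_ne_zero (factorial_ne_zero' _)) (mul_ne_zero (hc _) (hd _)))
    (fun i => mul_ne_zero (inv_ne_zero (factorial_ne_zero' _)) (hc i)) (by
      intro β y p
      have e2 : C.M (C.L (Pi.single (Fin.last k) (p : B))) (Fin.last k) =
          (c (Fin.last k) * d (Fin.last k)) • (p : B) := by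
        rw [hM _ _ fun j hj => absurd hj (Fin.le_last j).not_gt,
          hL _ _ fun j hj => absurd hj (Fin.le_last j).not_gt, smul_smul, Pi.single_eq_same]
      have e3 : C.blowupLin l P (0, 0) (y, p) =
          (1 : K) ^ (k + 1) • (evScaled C.M.toContinuousLinearMap 0 1 (y : Fin (k + 1) → B) +
            ev B k ((0 : K) * 1) (C.M (C.L (Pi.single (Fin.last k) (p : B))))) := by
        rw [← hθ 0]; rfl
      change β • _ + C.blowupLin l P (0, 0) (y, p) = _
      rw [e3, one_pow, one_smul, mul_one, hM'.evScaled_zero_one, ev_zero, e2,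
        smul_smul _ (c _ * d _)])
  refine ⟨Λ, fun ρ τ hτ => ?_⟩
  refine exists_approximatesLinearOn_family (C.contDiff_blowupConst l) (C.contDiff_blowupLin l)
    e₀ e₁ (Λ := (Λ : K × (D.complProd k × P) →L[K] B)) (fun β u => ?_) ρ hτ
  rw [hΛ]; rfl

end Ansatz

/-! ### Graphs in regular coordinates. -/

section Regular

variable {K : Type*} [RCLike K]
variable {B : Type*} [NormedAddCommGroup B] [NormedSpace K B]

/-- A graph over `E` in coordinates with invertible derivative is immersed. -/
theorem isRegularAt_comp_graph {E F X : Type*} [NormedAddCommGroup E] [NormedSpace K E]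
    [NormedAddCommGroup F] [NormedSpace K F] [NormedAddCommGroup X] [NormedSpace K X]
    [CompleteSpace E] [CompleteSpace F] [CompleteSpace X]
    {Ψ : E × (X × F) → B} {g : E × F → X} {q : E × F} {T : (E × (X × F)) ≃L[K] B}
    (hΨ : HasFDerivAt Ψ (T : E × (X × F) →L[K] B) (q.1, (g q, q.2)))
    (hg : DifferentiableAt K g q) : IsRegularAt (K := K) (fun q => Ψ (q.1, (g q, q.2))) q := by
  let γ : E × F →L[K] E × (X × F) :=
    (ContinuousLinearMap.fst K E F).prod ((fderiv K g q).prod (ContinuousLinearMap.snd K E F))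
  have hγ : HasFDerivAt (fun q : E × F => (q.1, (g q, q.2))) γ q :=
    hasFDerivAt_fst.prodMk (hg.hasFDerivAt.prodMk hasFDerivAt_snd)
  let π : E × (X × F) →L[K] E × F := (ContinuousLinearMap.fst K E (X × F)).prod
    (ContinuousLinearMap.snd K X F ∘L ContinuousLinearMap.snd K E (X × F))
  have hinv : Function.LeftInverse (π ∘L (T.symm : B →L[K] E × (X × F)))
      ((T : E × (X × F) →L[K] B) ∘L γ) := fun v => by
    change π (T.symm (T (γ v))) = v
    rw [T.symm_apply_apply]
    rfl
  have hl : ((T : E × (X × F) →L[K] B) ∘L γ).HasLeftInverse := ⟨_, hinv⟩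
  exact ⟨_, HasFDerivAt.comp q hΨ hγ, hinv.injective,
    hl.closedComplemented_range.isClosed, hl.closedComplemented_range⟩

end Regular

/-! ### Points near the arc avoid the origin. -/

section Arc

variable {K : Type*} [RCLike K]
variable {B : Type*} [NormedAddCommGroup B] [NormedSpace K B]

/-- The arc has exact order ε^l with l ≤ k and dominates any bounded multiple of ε^(k+1). -/
theorem exists_arc_add_ne_zero {zbar : ℕ → B} {k l : ℕ} (hl1 : 1 ≤ l) (hlk : l ≤ k)
    (hl : zbar l ≠ 0) (hlmin : ∀ j, 1 ≤ j → j < l → zbar j = 0) (ρ : ℝ) :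
    ∃ ε₀ > 0, ∀ ε : K, 0 < ‖ε‖ → ‖ε‖ < ε₀ → ∀ w : B, ‖w‖ ≤ ρ →
      arc zbar k ε + ε ^ (k + 1) • w ≠ 0 := by
  let s : K → B := fun ε => ∑ j ∈ Finset.Icc l k, (ε ^ (j - l) * (j ! : K)⁻¹) • zbar j
  have hs : ∀ ε : K, arc zbar k ε = ε ^ l • s ε := by
    intro ε
    rw [Finset.smul_sum]
    refine ((Finset.sum_subset (Finset.Icc_subset_Icc_left hl1) fun j hj hj' => ?_).symm).trans
      (Finset.sum_congr rfl fun j hj => ?_)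
    · rw [Finset.mem_Icc] at hj hj'
      rw [hlmin j hj.1 (by omega), smul_zero]
    · rw [smul_smul, ← mul_assoc, ← pow_add, div_eq_mul_inv,
        Nat.add_sub_cancel' (Finset.mem_Icc.1 hj).1]
  have hs0 : s 0 = (l ! : K)⁻¹ • zbar l := by
    refine (Finset.sum_eq_single_of_mem l (Finset.mem_Icc.2 ⟨le_rfl, hlk⟩) fun j hj hjl => ?_).trans
      (by simp)
    have := Finset.mem_Icc.1 hj
    rw [zero_pow (by omega), zero_mul, zero_smul]
  have hpos : ∀ᶠ ε in 𝓝 (0 : K), 0 < ‖s ε‖ - ‖ε‖ ^ (k + 1 - l) * |ρ| := by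
    have hc : ContinuousAt (fun ε : K => ‖s ε‖ - ‖ε‖ ^ (k + 1 - l) * |ρ|) 0 := by
      have : Continuous s := by fun_prop
      fun_prop
    refine hc.eventually_const_lt ?_
    beta_reduce
    rw [hs0, norm_zero, zero_pow (by omega), zero_mul, sub_zero]
    exact norm_pos_iff.2 (smul_ne_zero (inv_ne_zero (factorial_ne_zero' _)) hl)
  obtain ⟨ε₀, hε₀, h⟩ := Metric.eventually_nhds_iff_ball.1 hpos
  refine ⟨ε₀, hε₀, fun ε hε0 hε w hw h0 => ?_⟩
  have h1 := h ε (by simpa using hε)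
  have h2 : ε ^ l • (s ε + ε ^ (k + 1 - l) • w) = 0 := by
    rw [smul_add, smul_smul, ← pow_add, ← hs, ← h0]
    congr 3; omega
  have h3 := (smul_eq_zero.1 h2).resolve_left (pow_ne_zero _ (norm_pos_iff.1 hε0))
  have h4 : ‖s ε‖ ≤ ‖ε‖ ^ (k + 1 - l) * |ρ| := by
    rw [eq_neg_of_add_eq_zero_left h3, norm_neg, norm_smul, norm_pow]
    gcongr
    exact hw.trans (le_abs_self ρ)
  linarith

end Arc

/-! ### The parametrization of the wedge is a local diffeomorphism for ε ≠ 0. -/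

namespace Ansatz

variable {K : Type*} [RCLike K]
variable {B : Type*} [NormedAddCommGroup B] [NormedSpace K B]
variable {B' : Type*} [NormedAddCommGroup B'] [NormedSpace K B']
variable {G : B → B'} {zbar : ℕ → B} {k : ℕ} {D : Splitting K B B'} (C : Ansatz G zbar k D)
variable (P : Submodule K B) {l : ℕ}

/-- The parametrization of the wedge. -/
noncomputable def chart (q : K × (D.complProd k × P)) : B :=
  C.point q.1 (q.2.1 : Fin (k + 1) → B) (Pi.single (Fin.last k) (q.2.2 : B))

theorem analyticAt_chart (q : K × (D.complProd k × P)) : AnalyticAt K (C.chart P) q := by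
  refine C.analyticAt_point analyticAt_fst ?_ ?_
  · exact ((D.complProd k).subtypeL ∘L ContinuousLinearMap.fst K (D.complProd k) P ∘L
      ContinuousLinearMap.snd K K (D.complProd k × P)).analyticAt q
  · exact (ContinuousLinearMap.single K (fun _ => B) (Fin.last k) ∘L P.subtypeL ∘L
      ContinuousLinearMap.snd K (D.complProd k) P ∘L
      ContinuousLinearMap.snd K K (D.complProd k × P)).analyticAt q

variable [CompleteSpace B]

/-- The derivative of the chart collapses as ε → 0. For each fixed ε ≠ 0, however, an affine change
of parameters turns the chart into `arc zbar k ε` plus ε^(k+1) times the blow-up, whose derivative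
is close to the fixed isomorphism Λ. -/
theorem exists_hasStrictFDerivAt_chart (hD : D.IsDecomposition (linCoeff G zbar k) k)
    (hl1 : 1 ≤ l) (hlk : l ≤ k) (hl : zbar l ≠ 0) (hlmin : ∀ j, 1 ≤ j → j < l → zbar j = 0)
    (hPc : IsClosed (P : Set B))
    (hPsup : P ⊔ Submodule.span K {zbar l} = D.N (linCoeff G zbar k) (k + 1))
    (hPdisj : Disjoint P (Submodule.span K {zbar l})) (ρ : ℝ) :
    ∃ ε₀ > 0, ∀ q : K × (D.complProd k × P), 0 < ‖q.1‖ → ‖q.1‖ < ε₀ → ‖q.2‖ < ρ →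
      ∃ T : (K × (D.complProd k × P)) ≃L[K] B,
        HasStrictFDerivAt (C.chart P) (T : K × (D.complProd k × P) →L[K] B) q := by
  have i1 : CompleteSpace (D.complProd k) := (Adapted.isClosed_complProd hD).completeSpace_coe
  have i2 : CompleteSpace P := hPc.completeSpace_coe
  obtain ⟨Λ, hΛ⟩ := C.exists_blowup_equiv l hD hl1 hlk hl hPc hPsup hPdisj
  set κ := ‖(Λ.symm : B →L[K] K × (D.complProd k × P))‖ with hκ
  obtain ⟨τ, hτ⟩ : ∃ τ : NNReal, (τ : ℝ) = 1 / (κ + 1) := ⟨⟨1 / (κ + 1), by positivity⟩, rfl⟩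
  obtain ⟨η, hη, happ⟩ := hΛ ρ τ (by rw [← NNReal.coe_pos, hτ]; positivity)
  refine ⟨min η 1, by positivity, ?_⟩
  rintro ⟨ε, x, p⟩ hε0 hε hxp
  simp only at hε0 hε hxp
  have hne : ε ≠ 0 := norm_pos_iff.1 hε0
  have hε1 : ‖ε‖ ≤ 1 := hε.le.trans (min_le_right _ _)
  -- The factor ε^(k+2-l) is the coefficient of β in ε · `theta`; the second component undoes
  -- `scale`, and P is not rescaled.
  let J : (K × (D.complProd k × P)) ≃L[K] (K × (D.complProd k × P)) :=
    (ContinuousLinearEquiv.smulLeft (Units.mk0 (ε ^ (k + 2 - l)) (pow_ne_zero _ hne))).prodCongr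
      ((scaleEquiv D k hne).symm.prodCongr (ContinuousLinearEquiv.refl K P))
  let j : K × (D.complProd k × P) → K × (D.complProd k × P) := fun u => (ε, 0) + J u
  have hj : ∀ u, j u = (ε * theta k l (ε, u.1), (scale D k ε⁻¹ u.2.1, u.2.2)) := by
    rintro ⟨β, y, p⟩
    have e1 : j (β, y, p) = (ε + ε ^ (k + 2 - l) * β, (0 + scale D k ε⁻¹ y, 0 + p)) := rfl
    rw [e1, zero_add, zero_add]
    congr 1
    rw [theta, show k + 2 - l = (k + 1 - l) + 1 by omega]
    ring
  let u₀ : K × (D.complProd k × P) := (0, (scale D k ε x, p))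
  have hju₀ : j u₀ = (ε, x, p) := by
    have : scale D k ε⁻¹ (scale D k ε x) = x := (scaleEquiv D k hne).symm_apply_apply x
    rw [hj]
    simp only [u₀, this, theta, mul_zero, add_zero, mul_one]
  have hblow : C.blowup (P := P) l ε = fun u =>
      (ε ^ (k + 1))⁻¹ • (C.chart P (j u) - arc zbar k ε) := by
    funext u
    rw [hj, chart, C.point_mul_theta l hl1 hlk hlmin, scale_scale_inv hne, add_sub_cancel_left,
      smul_smul, inv_mul_cancel₀ (pow_ne_zero _ hne), one_smul]
  have hT := (C.analyticAt_chart P (ε, x, p)).hasStrictFDerivAt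
  set T := fderiv K (C.chart P) (ε, x, p) with hTdef
  have hd : HasFDerivAt (C.blowup (P := P) l ε) ((ε ^ (k + 1))⁻¹ • (T ∘L
      (J : K × (D.complProd k × P) →L[K] K × (D.complProd k × P)))) u₀ := by
    rw [hblow]
    refine HasFDerivAt.fun_const_smul (HasFDerivAt.sub_const _ ?_) _
    refine HasFDerivAt.comp (g := C.chart P) u₀ (f := j) ?_ ?_
    · rw [hju₀]; exact hT.hasFDerivAt
    · exact (J : K × (D.complProd k × P) →L[K] K × (D.complProd k × P)).hasFDerivAt.const_add _
  have hnhds : {q : K × (D.complProd k × P) | ‖q.1‖ < η ∧ ‖q.2‖ ≤ ρ} ∈ 𝓝 u₀ := by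
    have h1 : ‖u₀.1‖ < η := by simpa [u₀] using hη
    have h2 : ‖u₀.2‖ < ρ := by
      refine lt_of_le_of_lt ?_ hxp
      exact max_le_max (norm_scale_le hε1 x) le_rfl
    filter_upwards [continuous_fst.norm.continuousAt.eventually_lt_const h1,
      continuous_snd.norm.continuousAt.eventually_lt_const h2] with q hq1 hq2
    exact ⟨hq1, hq2.le⟩
  obtain ⟨e, he⟩ := isInvertible_of_approximatesLinearOn Λ
    (happ ε (hε.trans_le (min_le_left _ _))) hnhds hd hκ.ge (by
      rw [hτ, mul_one_div, div_lt_one (by positivity)]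
      linarith)
  let S := (J.symm.trans e).trans (ContinuousLinearEquiv.smulLeft
    (Units.mk0 (ε ^ (k + 1)) (pow_ne_zero _ hne)))
  suffices hS : (S : K × (D.complProd k × P) →L[K] B) = T from ⟨S, hS ▸ hT⟩
  refine ContinuousLinearMap.ext fun v => ?_
  have h1 : e (J.symm v) = (ε ^ (k + 1))⁻¹ • T (J (J.symm v)) :=
    congrArg (fun f => f (J.symm v)) he
  change ε ^ (k + 1) • e (J.symm v) = T v
  rw [h1, J.apply_symm_apply, smul_smul, mul_inv_cancel₀ (pow_ne_zero _ hne), one_smul]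

end Ansatz

/-! ### Regularity of the reduced family and uniqueness in the wedge. -/

namespace Ansatz

variable {K : Type*} [RCLike K]
variable {B : Type*} [NormedAddCommGroup B] [NormedSpace K B]
variable {B' : Type*} [NormedAddCommGroup B'] [NormedSpace K B']
variable {G : B → B'} {zbar : ℕ → B} {k : ℕ} {D : Splitting K B B'} (C : Ansatz G zbar k D)
variable {P : Submodule K B} {l : ℕ} {Λ : D.complProd k ≃L[K] B'}
variable {nc : K × D.kerProd (linCoeff G zbar k) k → D.complProd k}

/-- `Splitting.lastTuple` as an operator. -/
noncomputable def lastTupleCLM (hP : P ≤ D.N (linCoeff G zbar k) (k + 1)) :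
    P →L[K] D.kerProd (linCoeff G zbar k) k :=
  (ContinuousLinearMap.single K (fun _ : Fin (k + 1) => B) (Fin.last k) ∘L
    P.subtypeL).codRestrict _ fun p => (D.lastTuple (linCoeff G zbar k) hP p).2

theorem norm_lastTuple (hP : P ≤ D.N (linCoeff G zbar k) (k + 1)) (p : P) :
    ‖D.lastTuple (linCoeff G zbar k) hP p‖ = ‖p‖ := by
  refine le_antisymm ?_ ?_
  · rw [Submodule.coe_norm, coe_lastTuple, pi_norm_le_iff_of_nonneg (norm_nonneg _)]
    intro i
    by_cases h : i = Fin.last k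
    · subst h; rw [Pi.single_eq_same]; rfl
    · rw [Pi.single_eq_of_ne h, norm_zero]; exact norm_nonneg _
  · have := norm_le_pi_norm (D.lastTuple (linCoeff G zbar k) hP p : Fin (k + 1) → B) (Fin.last k)
    rwa [coe_lastTuple, Pi.single_eq_same] at this

theorem zred_eq_chart (hP : P ≤ D.N (linCoeff G zbar k) (k + 1)) :
    C.zred nc hP =
      fun q => C.chart P (q.1, (nc (q.1, D.lastTuple (linCoeff G zbar k) hP q.2), q.2)) := rfl

theorem contDiffAt_nc (hP : P ≤ D.N (linCoeff G zbar k) (k + 1)) {ε₀ c : ℝ}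
    (h : ContDiffOn K ∞ nc (Metric.ball (0 : K) ε₀ ×ˢ Metric.ball 0 c)) {q : K × P}
    (hq1 : ‖q.1‖ < ε₀) (hq2 : ‖q.2‖ < c) :
    ContDiffAt K ∞ (fun q : K × P => nc (q.1, D.lastTuple (linCoeff G zbar k) hP q.2)) q := by
  have h1 : ContDiffAt K ∞ nc (q.1, lastTupleCLM hP q.2) := by
    refine h.contDiffAt ((Metric.isOpen_ball.prod Metric.isOpen_ball).mem_nhds ⟨?_, ?_⟩)
    · exact mem_ball_zero_iff.2 hq1
    · exact mem_ball_zero_iff.2 ((norm_lastTuple hP q.2).trans_lt hq2)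
  exact ContDiffAt.comp (g := nc) (f := fun q : K × P => (q.1, lastTupleCLM hP q.2)) q h1
    (contDiffAt_fst.prodMk ((lastTupleCLM hP).contDiff.contDiffAt.comp q contDiffAt_snd))

variable [CompleteSpace B] [CompleteSpace B']

theorem IsSolutionFamily.exists_isRegularAt (hD : D.IsDecomposition (linCoeff G zbar k) k)
    (hl1 : 1 ≤ l) (hlk : l ≤ k) (hl : zbar l ≠ 0) (hlmin : ∀ j, 1 ≤ j → j < l → zbar j = 0)
    (hPc : IsClosed (P : Set B)) (hP : P ≤ D.N (linCoeff G zbar k) (k + 1))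
    (hPsup : P ⊔ Submodule.span K {zbar l} = D.N (linCoeff G zbar k) (k + 1))
    (hPdisj : Disjoint P (Submodule.span K {zbar l})) (hG : AnalyticAt K G 0) (hG0 : G 0 = 0)
    (hΛ : ∀ x : D.complProd k, Λ x = conv (linCoeff (K := K) G zbar k) (relCoeff K (C.M x)) k)
    (hnc : C.IsSolutionFamily nc) {c : ℝ} (hc : 0 < c) : ∃ ε₀ > 0,
      ContDiffOn K ∞ (C.zred nc hP) {q : K × P | 0 < ‖q.1‖ ∧ ‖q.1‖ < ε₀ ∧ ‖q.2‖ < c} ∧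
      ∀ (ε : K) (p : P), 0 < ‖ε‖ → ‖ε‖ < ε₀ → ‖p‖ < c →
        IsRegularAt (K := K) (C.zred nc hP) (ε, p) := by
  have i1 : CompleteSpace (D.complProd k) := (Adapted.isClosed_complProd hD).completeSpace_coe
  have i2 : CompleteSpace P := hPc.completeSpace_coe
  obtain ⟨ε₁, hε₁, hcd, h₁⟩ := hnc.exists_norm_lt C hD hG hG0 hΛ zero_lt_one hc
  obtain ⟨ε₂, hε₂, h₂⟩ := C.exists_hasStrictFDerivAt_chart P hD hl1 hlk hl hlmin hPc hPsup hPdisj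
    (max 1 c)
  refine ⟨min ε₁ ε₂, by positivity, ?_, fun ε p hε0 hε hp => ?_⟩
  · rintro q ⟨-, hq1, hq2⟩
    have h3 := contDiffAt_nc hP hcd (hq1.trans_le (min_le_left _ _)) hq2
    refine ContDiffAt.contDiffWithinAt ?_
    rw [zred_eq_chart]
    exact ContDiffAt.comp (g := C.chart P) q (C.analyticAt_chart P _).contDiffAt
      (contDiffAt_fst.prodMk (h3.prodMk contDiffAt_snd))
  · have hε' := hε.trans_le (min_le_left ε₁ ε₂)
    have h3 := contDiffAt_nc hP hcd (q := (ε, p)) hε' hp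
    have h4 := (h₁ ε hε' (D.lastTuple (linCoeff G zbar k) hP p)
      ((norm_lastTuple hP p).trans_lt hp)).2.1
    obtain ⟨T, hT⟩ := h₂ (ε, (nc (ε, D.lastTuple (linCoeff G zbar k) hP p), p)) hε0
      (hε.trans_le (min_le_right _ _)) (max_lt_max h4 hp)
    rw [zred_eq_chart]
    exact isRegularAt_comp_graph
      (g := fun q : K × P => nc (q.1, D.lastTuple (linCoeff G zbar k) hP q.2)) (q := (ε, p))
      hT.hasFDerivAt (h3.differentiableAt (by simp))

theorem IsSolutionFamily.exists_wedge (hD : D.IsDecomposition (linCoeff G zbar k) k)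
    (hl1 : 1 ≤ l) (hlk : l ≤ k) (hl : zbar l ≠ 0) (hlmin : ∀ j, 1 ≤ j → j < l → zbar j = 0)
    (hPc : IsClosed (P : Set B)) (hP : P ≤ D.N (linCoeff G zbar k) (k + 1))
    (hPsup : P ⊔ Submodule.span K {zbar l} = D.N (linCoeff G zbar k) (k + 1))
    (hPdisj : Disjoint P (Submodule.span K {zbar l})) (hG : AnalyticAt K G 0) (hG0 : G 0 = 0)
    (hΛ : ∀ x : D.complProd k, Λ x = conv (linCoeff (K := K) G zbar k) (relCoeff K (C.M x)) k)
    (hnc : C.IsSolutionFamily nc) {r c : ℝ} (hr : 0 < r) (hc : 0 < c) :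
    ∃ ε₁ > 0, ∀ ε₀ > 0, ε₀ ≤ ε₁ →
      IsOpen (C.wedge hP ε₀ r c) ∧
      (∀ ε : K, 0 < ‖ε‖ → ‖ε‖ < ε₀ → C.z0 ε ∈ C.wedge hP ε₀ r c) ∧
      (0 : B) ∉ C.wedge hP ε₀ r c ∧
      {z ∈ C.wedge hP ε₀ r c | G z = 0} =
        C.zred nc hP '' {q : K × P | 0 < ‖q.1‖ ∧ ‖q.1‖ < ε₀ ∧ ‖q.2‖ < c} := by
  have i1 : CompleteSpace (D.complProd k) := (Adapted.isClosed_complProd hD).completeSpace_coe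
  have i2 : CompleteSpace P := hPc.completeSpace_coe
  obtain ⟨ε₁, hε₁, -, h₁⟩ := hnc.exists_norm_lt C hD hG hG0 hΛ hr hc
  obtain ⟨ε₂, hε₂, h₂⟩ := C.exists_hasStrictFDerivAt_chart P hD hl1 hlk hl hlmin hPc hPsup hPdisj
    (max r c)
  obtain ⟨ρ, -, h₃⟩ := C.exists_norm_ev_le r c
  obtain ⟨ε₄, hε₄, h₄⟩ := exists_arc_add_ne_zero (K := K) hl1 hlk hl hlmin ρ
  refine ⟨min (min ε₁ ε₂) (min ε₄ 1), by positivity, fun ε₀ hε₀ hle => ?_⟩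
  simp only [le_min_iff] at hle
  obtain ⟨⟨hle1, hle2⟩, hle4, hle5⟩ := hle
  refine ⟨?_, fun ε hε0 hε => ?_, ?_, ?_⟩
  · let U : Set (K × (D.complProd k × P)) :=
      {q | 0 < ‖q.1‖ ∧ ‖q.1‖ < ε₀ ∧ ‖q.2.1‖ < r ∧ ‖q.2.2‖ < c}
    have hU : IsOpen U := by
      have h5 : Continuous fun q : K × (D.complProd k × P) => ‖q.1‖ := by fun_prop
      have h6 : Continuous fun q : K × (D.complProd k × P) => ‖q.2.1‖ := by fun_prop
      have h7 : Continuous fun q : K × (D.complProd k × P) => ‖q.2.2‖ := by fun_prop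
      exact (isOpen_lt continuous_const h5).inter ((isOpen_lt h5 continuous_const).inter
        ((isOpen_lt h6 continuous_const).inter (isOpen_lt h7 continuous_const)))
    have hW : C.wedge hP ε₀ r c = C.chart P '' U := by
      ext z
      constructor
      · rintro ⟨ε, x, p, a1, a2, a3, a4, rfl⟩
        exact ⟨(ε, x, p), ⟨a1, a2, a3, a4⟩, rfl⟩
      · rintro ⟨⟨ε, x, p⟩, ⟨a1, a2, a3, a4⟩, rfl⟩
        exact ⟨ε, x, p, a1, a2, a3, a4, rfl⟩
    rw [hW, isOpen_iff_mem_nhds]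
    rintro _ ⟨q, hq, rfl⟩
    -- Openness is local: by the inverse function theorem the chart carries neighbourhoods of q to
    -- neighbourhoods of its image. Injectivity on the wedge is not needed.
    obtain ⟨T, hT⟩ := h₂ q hq.1 (hq.2.1.trans_le hle2) (max_lt_max hq.2.2.1 hq.2.2.2)
    rw [← hT.map_nhds_eq_of_equiv]
    exact image_mem_map (hU.mem_nhds hq)
  · refine ⟨ε, 0, 0, hε0, hε, by simpa using hr, by simpa using hc, ?_⟩
    rw [coe_lastTuple, ZeroMemClass.coe_zero, ZeroMemClass.coe_zero, Pi.single_zero]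
    rfl
  · rintro ⟨ε, x, p, hε0, hε, hx, hp, h0⟩
    rw [point_eq] at h0
    exact h₄ ε hε0 (hε.trans_le hle4) _ (h₃ ε (hε.le.trans hle5) _ _ hx.le
      ((norm_lastTuple hP p).trans_le hp.le)) h0.symm
  · ext z
    constructor
    · rintro ⟨⟨ε, x, p, hε0, hε, hx, hp, rfl⟩, hz⟩
      refine ⟨(ε, p), ⟨hε0, hε, hp⟩, ?_⟩
      rw [(h₁ ε (hε.trans_le hle1) _ ((norm_lastTuple hP p).trans_lt hp)).2.2
        (norm_pos_iff.1 hε0) x hx.le hz]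
      rfl
    · rintro ⟨⟨ε, p⟩, ⟨hε0, hε, hp⟩, rfl⟩
      obtain ⟨b1, b2, -⟩ := h₁ ε (hε.trans_le hle1) _ ((norm_lastTuple hP p).trans_lt hp)
      exact ⟨⟨ε, _, p, hε0, hε, b2, hp, rfl⟩, b1⟩

end Ansatz

/-! ### Absorption of the full family into the reduced family. -/

namespace Ansatz

variable {K : Type*} [RCLike K]
variable {B : Type*} [NormedAddCommGroup B] [NormedSpace K B]
variable {B' : Type*} [NormedAddCommGroup B'] [NormedSpace K B']
variable {G : B → B'} {zbar : ℕ → B} {k : ℕ} {D : Splitting K B B'} (C : Ansatz G zbar k D)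
variable {P : Submodule K B} {l : ℕ}

theorem blowup_zero (hl1 : 1 ≤ l) (hlk : l ≤ k) (hlmin : ∀ j, 1 ≤ j → j < l → zbar j = 0)
    {ε : K} (hε : ε ≠ 0) (p : P) : C.blowup l ε (0, ((0 : D.complProd k), p)) =
      ev B k ε (C.I + C.M (0 + C.L (Pi.single (Fin.last k) (p : B)))) := by
  have h1 := C.point_mul_theta l hl1 hlk hlmin ε 0 0 p
  rw [theta, mul_zero, add_zero, mul_one, map_zero, point_eq] at h1
  exact (smul_right_injective B (pow_ne_zero (k + 1) hε) (add_left_cancel h1)).symm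

theorem norm_theta_sub_one_le (hlk : l ≤ k) {ε β : K} (hε : ‖ε‖ ≤ 1) (hβ : ‖β‖ ≤ 1) :
    ‖theta k l (ε, β) - 1‖ ≤ ‖ε‖ := by
  rw [theta, add_sub_cancel_left, norm_mul, norm_pow]
  calc ‖ε‖ ^ (k + 1 - l) * ‖β‖ ≤ ‖ε‖ ^ (k + 1 - l) * 1 := by gcongr
    _ ≤ ‖ε‖ := by
      rw [mul_one]
      exact pow_le_of_le_one (norm_nonneg _) hε (by omega)

/-- Points near the surface `nᶜ = 0` in the reparametrized coordinates: every `w` close to the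
coefficient of `p` is reached, and the reparametrized coefficient stays bounded. -/
theorem exists_point_eq [CompleteSpace B] (hD : D.IsDecomposition (linCoeff G zbar k) k)
    (hl1 : 1 ≤ l) (hlk : l ≤ k) (hl : zbar l ≠ 0) (hlmin : ∀ j, 1 ≤ j → j < l → zbar j = 0)
    (hPc : IsClosed (P : Set B))
    (hPsup : P ⊔ Submodule.span K {zbar l} = D.N (linCoeff G zbar k) (k + 1))
    (hPdisj : Disjoint P (Submodule.span K {zbar l})) {c c' : ℝ} (hc : 0 < c) (hcc' : c < c') :
    ∃ σ > 0, ∃ ρ ≥ 0, ∃ ε₀ > 0, ∀ ε : K, 0 < ‖ε‖ → ‖ε‖ < ε₀ → ∀ p : P, ‖p‖ < c → ∀ w : B,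
      ‖w - ev B k ε (C.I + C.M (0 + C.L (Pi.single (Fin.last k) (p : B))))‖ ≤ σ →
      ∃ (ε' : K) (x : D.complProd k) (p' : P), 0 < ‖ε'‖ ∧ ‖ε'‖ ≤ 2 * ‖ε‖ ∧ ‖p'‖ < c' ∧
        ‖ev B k ε' (C.I + C.M (x + C.L (Pi.single (Fin.last k) (p' : B))))‖ ≤ ρ ∧
        arc zbar k ε + ε ^ (k + 1) • w =
          C.point ε' x (Pi.single (Fin.last k) (p' : B)) := by
  have i1 : CompleteSpace (D.complProd k) := (Adapted.isClosed_complProd hD).completeSpace_coe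
  have i2 : CompleteSpace P := hPc.completeSpace_coe
  obtain ⟨m, hm, hM⟩ := C.triangular_M
  have hM : UpperTriangular m C.M.toContinuousLinearMap := hM
  obtain ⟨Λ, hΛ⟩ := C.exists_blowup_equiv l hD hl1 hlk hl hPc hPsup hPdisj
  set κ := ‖(Λ.symm : B →L[K] K × (D.complProd k × P))‖ + 1 with hκ
  have hκ0 : 0 < κ := by positivity
  obtain ⟨τ, hτ⟩ : ∃ τ : NNReal, (τ : ℝ) = 1 / (2 * κ) := ⟨⟨1 / (2 * κ), by positivity⟩, rfl⟩
  obtain ⟨η, hη, happ⟩ := hΛ c' τ (by rw [← NNReal.coe_pos, hτ]; positivity)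
  -- The bound η / 2 keeps β in the region of approximation, 1 bounds β and y, and (c' - c) / 2
  -- keeps p' below c'.
  let s : ℝ := min (min (η / 2) 1) ((c' - c) / 2)
  have hs1 : s ≤ η / 2 := (min_le_left _ _).trans (min_le_left _ _)
  have hs2 : s ≤ 1 := (min_le_left _ _).trans (min_le_right _ _)
  have hs3 : s ≤ (c' - c) / 2 := min_le_right _ _
  have hs : 0 < s := by
    have : 0 < c' - c := by linarith
    positivity
  obtain ⟨ρ, hρ, hbd⟩ := C.exists_norm_ev_le 0 c'
  have hcont : ContinuousAt (fun q : K × K => ‖evScaled C.M.toContinuousLinearMap q.1 q.2‖)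
      (0, 1) := (contDiff_evScaled C.M.toContinuousLinearMap (n := 0) contDiff_fst
        contDiff_snd).continuous.norm.continuousAt
  obtain ⟨ε₁, hε₁, h₁⟩ := Metric.eventually_nhds_iff_ball.1
    (hcont.eventually_lt_const (lt_add_one _))
  set W := ‖evScaled C.M.toContinuousLinearMap (0 : K) 1‖ + 1
  have hW : 0 ≤ W := by positivity
  refine ⟨s / (2 * κ), by positivity, W + ρ, by positivity, min (min η (1 / 2)) ε₁, by positivity,
    fun ε hε0 hε p hp w hw => ?_⟩
  simp only [lt_min_iff] at hε
  obtain ⟨⟨hε2, hε3⟩, hε4⟩ := hε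
  have hne : ε ≠ 0 := norm_pos_iff.1 hε0
  let b : K × (D.complProd k × P) := (0, (0, p))
  have hsub : Metric.closedBall b s ⊆ {q | ‖q.1‖ < η ∧ ‖q.2‖ ≤ c'} := by
    intro q hq
    rw [mem_closedBall_iff_norm] at hq
    have h2 : ‖q.1‖ ≤ s := by simpa [b] using (norm_fst_le (q - b)).trans hq
    have h3 : ‖q.2 - (0, p)‖ ≤ s := (norm_snd_le (q - b)).trans hq
    have h4 : ‖((0 : D.complProd k), p)‖ < c := max_lt (by simpa using hc) hp
    refine ⟨by linarith, ?_⟩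
    have := norm_le_norm_add_norm_sub' q.2 ((0 : D.complProd k), p)
    linarith
  obtain ⟨⟨β, y, p'⟩, hq, hqw⟩ := exists_eq_of_approximatesLinearOn Λ hs.le
    ((happ ε hε2).mono_set hsub) (κ := κ) (by rw [hκ]; linarith) hκ0
    (by rw [hτ]; field_simp; exact le_rfl) (y := w) (by rwa [C.blowup_zero hl1 hlk hlmin hne])
  have hβ : ‖β‖ ≤ 1 := by
    have := (norm_fst_le (((β, y, p') : K × (D.complProd k × P)) - b)).trans hq
    simpa [b] using this.trans hs2
  have hq2 := (norm_snd_le (((β, y, p') : K × (D.complProd k × P)) - b)).trans hq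
  have hy : ‖y‖ ≤ 1 := by
    have := (norm_fst_le (((β, y, p') : K × (D.complProd k × P)) - b).2).trans hq2
    simpa [b] using this.trans hs2
  have hp' : ‖p'‖ < c' := by
    have h2 : ‖p' - p‖ ≤ s :=
      (norm_snd_le (((β, y, p') : K × (D.complProd k × P)) - b).2).trans hq2
    have := norm_le_norm_add_norm_sub' p' p
    linarith
  set θ := theta k l (ε, β) with hθ
  have hθ1 : ‖θ - 1‖ ≤ ‖ε‖ := norm_theta_sub_one_le hlk (by linarith) hβ
  have hθ2 : ‖θ‖ ≤ 2 := by
    have := norm_le_norm_add_norm_sub' θ 1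
    rw [norm_one] at this
    linarith
  have hθ0 : θ ≠ 0 := by
    rintro h
    rw [h, zero_sub, norm_neg, norm_one] at hθ1
    linarith
  have hε' : ‖ε * θ‖ ≤ 2 * ‖ε‖ := by
    rw [norm_mul, mul_comm]; gcongr
  refine ⟨ε * θ, scale D k ε⁻¹ y, p', norm_pos_iff.2 (mul_ne_zero hne hθ0), hε', hp', ?_, ?_⟩
  -- The coordinate x = `scale D k ε⁻¹ y` can blow up as ε → 0, but its contribution to the
  -- coefficient is `evScaled` applied to the bounded y.
  · have e1 : ev B k (ε * θ) (C.I + C.M ((scale D k ε⁻¹ y : Fin (k + 1) → B) +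
        C.L (Pi.single (Fin.last k) (p' : B)))) = evScaled C.M.toContinuousLinearMap ε θ y +
        ev B k (ε * θ) (C.I + C.M (0 + C.L (Pi.single (Fin.last k) (p' : B)))) := by
      have := C.ev_sub_ev (ε * θ) (scale D k ε⁻¹ y) 0 (Pi.single (Fin.last k) (p' : B))
      rw [sub_eq_iff_eq_add, sub_zero] at this
      rw [this]
      congr 1
      refine (hM.ev_mul_eq ε θ (scale D k ε⁻¹ y)).trans ?_
      rw [scale_scale_inv hne]
    rw [e1]
    refine (norm_add_le _ _).trans (add_le_add ?_ ?_)
    · refine (ContinuousLinearMap.le_opNorm _ _).trans ?_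
      have h2 := h₁ (ε, θ) (by
        rw [mem_ball_iff_norm, Prod.mk_sub_mk, sub_zero]
        exact max_lt hε4 (hθ1.trans_lt hε4))
      calc _ ≤ W * 1 := mul_le_mul h2.le hy (norm_nonneg _) hW
        _ = W := mul_one _
    · refine hbd _ (by linarith) _ _ (by simp) ?_
      refine (pi_norm_le_iff_of_nonneg (hc.trans hcc').le).2 fun i => ?_
      by_cases h : i = Fin.last k
      · subst h; rw [Pi.single_eq_same]; exact hp'.le
      · rw [Pi.single_eq_of_ne h, norm_zero]; exact (hc.trans hcc').le
  · rw [hθ, C.point_mul_theta l hl1 hlk hlmin, scale_scale_inv hne, hqw]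

variable {Λ : D.complProd k ≃L[K] B'}
variable {nc : K × D.kerProd (linCoeff G zbar k) k → D.complProd k}
variable [CompleteSpace B] [CompleteSpace B']

/-- For small n₁, …, n_k and α the coefficient of z(ε, n) is close to the one of p on the surface nᶜ
= 0. So the point has wedge coordinates (ε', x, p') with bounded coefficient. It and the reduced
family at (ε', p') are both solutions differing only along ∏ N_iᶜ, hence equal. -/
theorem IsSolutionFamily.exists_eq_zred (hD : D.IsDecomposition (linCoeff G zbar k) k)
    (hl1 : 1 ≤ l) (hlk : l ≤ k) (hl : zbar l ≠ 0) (hlmin : ∀ j, 1 ≤ j → j < l → zbar j = 0)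
    (hPc : IsClosed (P : Set B)) (hP : P ≤ D.N (linCoeff G zbar k) (k + 1))
    (hPsup : P ⊔ Submodule.span K {zbar l} = D.N (linCoeff G zbar k) (k + 1))
    (hPdisj : Disjoint P (Submodule.span K {zbar l})) (hG : AnalyticAt K G 0) (hG0 : G 0 = 0)
    (hΛ : ∀ x : D.complProd k, Λ x = conv (linCoeff (K := K) G zbar k) (relCoeff K (C.M x)) k)
    (hnc : C.IsSolutionFamily nc) {c c' ε₁ : ℝ} (hc : 0 < c) (hcc' : c < c') (hε₁ : 0 < ε₁) :
    ∃ δ > 0, ∃ ε₀ > 0, ∀ ε : K, 0 < ‖ε‖ → ‖ε‖ < ε₀ →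
      ∀ (n : D.kerProd (linCoeff G zbar k) k) (α : K) (p : P),
        (∀ i : Fin (k + 1), i ≠ Fin.last k → ‖(n : Fin (k + 1) → B) i‖ < δ) →
        (n : Fin (k + 1) → B) (Fin.last k) = α • zbar l + (p : B) →
        ‖α‖ < δ → ‖p‖ < c →
        ∃ (ε' : K) (p' : P), 0 < ‖ε'‖ ∧ ‖ε'‖ < ε₁ ∧ ‖p'‖ < c' ∧
          C.z nc (ε, n) = C.zred nc hP (ε', p') := by
  have hc' : 0 < c' := hc.trans hcc'
  obtain ⟨σ, hσ, ρ, hρ, ε₂, hε₂, h₂⟩ :=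
    C.exists_point_eq hD hl1 hlk hl hlmin hPc hPsup hPdisj hc hcc'
  obtain ⟨W, hW, hev⟩ := norm_ev_le (K := K) (B := B) k
  set M : (Fin (k + 1) → B) →L[K] (Fin (k + 1) → B) := C.M.toContinuousLinearMap
  set L : (Fin (k + 1) → B) →L[K] (Fin (k + 1) → B) := C.L.toContinuousLinearMap
  -- Both nᶜ and the image under L of the remaining part of n are kept below t, so that after M and
  -- `ev` the deviation is at most σ.
  let t : ℝ := σ / (2 * (W * ‖M‖ + 1))
  have ht : 0 < t := by positivity
  have ht' : W * (‖M‖ * (t + t)) ≤ σ := by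
    have : W * (‖M‖ * (t + t)) = σ * (W * ‖M‖ / (W * ‖M‖ + 1)) := by
      simp only [t]; field_simp; ring
    rw [this]
    refine mul_le_of_le_one_right hσ.le ((div_le_one (by positivity)).2 (by linarith))
  let δ : ℝ := min 1 (t / ((‖L‖ + 1) * (1 + ‖zbar l‖)))
  have hδ : 0 < δ := by positivity
  have hδ' : ‖L‖ * (δ * (1 + ‖zbar l‖)) ≤ t := by
    have h3 : δ ≤ t / ((‖L‖ + 1) * (1 + ‖zbar l‖)) := min_le_right _ _
    rw [le_div_iff₀ (by positivity)] at h3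
    have : 0 ≤ δ * (1 + ‖zbar l‖) := by positivity
    nlinarith
  obtain ⟨ε₃, hε₃, -, h₃⟩ := hnc.exists_norm_lt C hD hG hG0 hΛ ht
    (show 0 < c + 1 + ‖zbar l‖ by positivity)
  obtain ⟨ε₄, hε₄, -, h₄⟩ := hnc.exists_norm_lt C hD hG hG0 hΛ zero_lt_one hc'
  obtain ⟨ρ', hρ', hbd⟩ := C.exists_norm_ev_le 1 c'
  obtain ⟨ε₅, hε₅, h₅⟩ := C.exists_eq_zero_of_solves hG hG0 hΛ (ρ := max ρ ρ')
    (le_max_of_le_left hρ)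
  -- The halved bounds account for ‖ε'‖ ≤ 2 ‖ε‖.
  refine ⟨δ, hδ, min (min ε₂ ε₃) (min (min (ε₁ / 2) (ε₄ / 2)) (min (ε₅ / 2) (1 / 2))),
    by positivity, fun ε hε0 hε n α p hn hnl hα hp => ?_⟩
  simp only [lt_min_iff] at hε
  obtain ⟨⟨b2, b3⟩, ⟨b1, b4⟩, b5, b6⟩ := hε
  let m : Fin (k + 1) → B := (n : Fin (k + 1) → B) - Pi.single (Fin.last k) (p : B)
  have hm : ‖m‖ ≤ δ * (1 + ‖zbar l‖) := by
    refine (pi_norm_le_iff_of_nonneg (by positivity)).2 fun i => ?_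
    by_cases h : i = Fin.last k
    · subst h
      have : m (Fin.last k) = α • zbar l := by
        simp only [m, Pi.sub_apply, hnl, Pi.single_eq_same, add_sub_cancel_right]
      rw [this, norm_smul]
      gcongr
      linarith
    · have : m i = (n : Fin (k + 1) → B) i := by
        simp only [m, Pi.sub_apply, Pi.single_eq_of_ne h, sub_zero]
      rw [this]
      exact (hn i h).le.trans (le_mul_of_one_le_right hδ.le (by linarith [norm_nonneg (zbar l)]))
  have hnorm : ‖n‖ < c + 1 + ‖zbar l‖ := by
    have h6 : ‖(Pi.single (Fin.last k) (p : B) : Fin (k + 1) → B)‖ < c :=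
      (norm_lastTuple hP p).trans_lt hp
    have h7 : ‖n‖ ≤ _ := norm_le_norm_add_norm_sub' (n : Fin (k + 1) → B)
      (Pi.single (Fin.last k) (p : B))
    have h8 : δ * (1 + ‖zbar l‖) ≤ 1 * (1 + ‖zbar l‖) := by
      gcongr
      exact min_le_left _ _
    have h9 := hm.trans h8
    simp only [m] at h9
    linarith
  obtain ⟨g1, g2, -⟩ := h₃ ε b3 n hnorm
  obtain ⟨ε', x, p', a1, a2, a3, a4, a5⟩ := h₂ ε hε0 b2 p hp
    (ev B k ε (C.I + C.M (nc (ε, n) + C.L n))) (by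
      have e1 : ev B k ε (C.I + C.M (nc (ε, n) + C.L n)) -
          ev B k ε (C.I + C.M (0 + C.L (Pi.single (Fin.last k) (p : B)))) =
          ev B k ε (M (nc (ε, n) + L m)) := by
        have : L m = C.L n - C.L (Pi.single (Fin.last k) (p : B)) := map_sub C.L _ _
        rw [← map_sub, add_sub_add_left_eq_sub, ← map_sub, this, zero_add, add_sub_assoc]
        rfl
      rw [e1]
      refine ((ev B k ε).le_opNorm _).trans (le_trans ?_ ht')
      refine mul_le_mul (hev ε (by linarith)) ((M.le_opNorm _).trans ?_) (norm_nonneg _) hW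
      gcongr
      refine (norm_add_le _ _).trans (add_le_add g2.le ((L.le_opNorm _).trans (le_trans ?_ hδ')))
      gcongr)
  rw [← point_eq] at a5
  have hp' : ‖D.lastTuple (linCoeff G zbar k) hP p'‖ < c' := (norm_lastTuple hP p').trans_lt a3
  obtain ⟨f1, f2, -⟩ := h₄ ε' (by linarith) _ hp'
  -- No bound on x is available, so uniqueness within a ball of nᶜ does not apply; the version with
  -- bounded coefficients does.
  have hx : x - nc (ε', D.lastTuple (linCoeff G zbar k) hP p') = 0 := by
    refine h₅ ε' a1 (by linarith) _ _ _ (a4.trans (le_max_left _ _))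
      ((hbd ε' (by linarith) (nc (ε', D.lastTuple (linCoeff G zbar k) hP p')) _ f2.le
        hp'.le).trans (le_max_right _ _)) (C.ev_sub_ev ε' x _ _) ?_ ?_
    · rw [← point_eq, ← a5]; exact g1
    · rw [← point_eq]; exact f1
  refine ⟨ε', p', a1, by linarith, a3, ?_⟩
  rw [sub_eq_zero] at hx
  rw [z, a5, hx]
  rfl

end Ansatz

end Undet

theorem corollary3 {K : Type*} [RCLike K]
    {B : Type*} [NormedAddCommGroup B] [NormedSpace K B] [CompleteSpace B]
    {B' : Type*} [NormedAddCommGroup B'] [NormedSpace K B'] [CompleteSpace B']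
    (G : B → B') (hG : AnalyticAt K G 0) (hG0 : G 0 = 0)
    (k : ℕ) (zbar : ℕ → B)
    -- `[z̄₁, …, z̄ₖ]` are the leading coefficients of an element of `X_{2k}`
    (hX : ∃ z : ℕ → B, (∀ j ∈ Finset.Icc 1 k, z j = zbar j) ∧ Undet.MemX K G (2 * k) z)
    (D : Undet.Splitting K B B')
    (hD : D.IsDecomposition (Undet.linCoeff G zbar k) k)
    (hS : D.SumSurjective (Undet.linCoeff G zbar k) k)
    -- `z̄ₗ` is the first nonzero leading coefficient
    (l : ℕ) (hl1 : 1 ≤ l) (hlk : l ≤ k) (hl : zbar l ≠ 0) (hlmin : ∀ j, 1 ≤ j → j < l → zbar j = 0)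
    -- `P` is a closed complement of the span of `z̄ₗ` in `N_{k+1}`
    (P : Submodule K B) (hPc : IsClosed (P : Set B))
    (hP : P ≤ D.N (Undet.linCoeff G zbar k) (k + 1))
    (hPsup : P ⊔ Submodule.span K {zbar l} = D.N (Undet.linCoeff G zbar k) (k + 1))
    (hPdisj : Disjoint P (Submodule.span K {zbar l})) :
    Nonempty (Undet.Ansatz G zbar k D) ∧
    ∀ C : Undet.Ansatz G zbar k D,
      (∃ nc, C.IsSolutionFamily nc) ∧
      ∀ nc, C.IsSolutionFamily nc →
        -- (i) regularity
        (∀ c > 0, ∃ ε₀ > 0,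
          ContDiffOn K ∞ (C.zred nc hP) {q : K × P | 0 < ‖q.1‖ ∧ ‖q.1‖ < ε₀ ∧ ‖q.2‖ < c} ∧
          ∀ (ε : K) (p : P), 0 < ‖ε‖ → ‖ε‖ < ε₀ → ‖p‖ < c →
            Undet.IsRegularAt (K := K) (C.zred nc hP) (ε, p)) ∧
        -- (ii) uniqueness in a pointed wedge around the centre line
        (∀ r > 0, ∀ c > 0, ∃ ε₁ > 0, ∀ ε₀ > 0, ε₀ ≤ ε₁ →
          IsOpen (C.wedge hP ε₀ r c) ∧
          (∀ ε : K, 0 < ‖ε‖ → ‖ε‖ < ε₀ → C.z0 ε ∈ C.wedge hP ε₀ r c) ∧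
          (0 : B) ∉ C.wedge hP ε₀ r c ∧
          {z ∈ C.wedge hP ε₀ r c | G z = 0} =
            C.zred nc hP '' {q : K × P | 0 < ‖q.1‖ ∧ ‖q.1‖ < ε₀ ∧ ‖q.2‖ < c}) ∧
        -- (iii) the whole family is contained in the reduced family
        (∀ c > 0, ∀ c' > c, ∀ ε₁ > 0, ∃ δ > 0, ∃ ε₀ > 0, ∀ ε : K, 0 < ‖ε‖ → ‖ε‖ < ε₀ →
          ∀ (n : D.kerProd (Undet.linCoeff G zbar k) k) (α : K) (p : P),
            (∀ i : Fin (k + 1), i ≠ Fin.last k → ‖(n : Fin (k + 1) → B) i‖ < δ) →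
            (n : Fin (k + 1) → B) (Fin.last k) = α • zbar l + (p : B) →
            ‖α‖ < δ → ‖p‖ < c →
            ∃ (ε' : K) (p' : P), 0 < ‖ε'‖ ∧ ‖ε'‖ < ε₁ ∧ ‖p'‖ < c' ∧
              C.z nc (ε, n) = C.zred nc hP (ε', p')) := by
  refine ⟨Undet.nonempty_ansatz hG hG0 hD hS hX, fun C => ?_⟩
  obtain ⟨Λ, hΛ⟩ := (C.adapted hG hG0).exists_equiv hD hS
  refine ⟨⟨_, C.isSolutionFamily_solution hD hG hG0 hΛ⟩, fun nc hnc => ⟨fun c hc => ?_,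
    fun r hr c hc => ?_, fun c hc c' hcc' ε₁ hε₁ => ?_⟩⟩
  · exact hnc.exists_isRegularAt C hD hl1 hlk hl hlmin hPc hP hPsup hPdisj hG hG0 hΛ hc
  · exact hnc.exists_wedge C hD hl1 hlk hl hlmin hPc hP hPsup hPdisj hG hG0 hΛ hr hc
  · exact hnc.exists_eq_zred C hD hl1 hlk hl hlmin hPc hP hPsup hPdisj hG hG0 hΛ hc hcc' hε₁
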